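/- Theorem 3.1. Let $\delta>3$ and $\frac12<s<\frac{\delta-2}{2}$, and write $\langle x\rangle=(1+|x|^2)^{1/2}$. There is $m_0>0$, depending only on $\delta$ and $s$, such that for every $m\ge m_0$ the following holds. Let $n\ge 3$, $E>0$, and let $V:\mathbb{R}^n\to\mathbb{R}$ be a measurable function with $|V(x)|\le C_V\langle x\rangle^{-\delta}$ for almost every $x\in\mathbb{R}^n$, for some constant $C_V>0$. For $h>0$ let $P(h)=-h^2\Delta+V$, where $\Delta=\sum_j\partial_{x_j}^2$. Then there is $T\ge1$ such that for every $\tau_0\ge T$ there are constants $h_0>0$ and $C>0$ with the following property. For $0<h\le h_0$ put $a=h^{-m}$ and $\tau=\tau_0h^{-1/3}$, let $\varphi\in C^1([0,\infty))$ be the function with $\varphi(0)=0$, $$\varphi'(r)=\tau(r+1)^{-1}-\tau(a+1)^{-1}\ \text{ for } 0\le r\le a,\qquad \varphi'(r)=0\ \text{ for } r\ge a,$$ and regard $\varphi=\varphi(|x|)$ as a radial function on $\mathbb{R}^n$. Then for all $0<h\le h_0$, all $0<\varepsilon\le ha^{-2}$, each choice of the sign $\pm$, and all (complex-valued) $f\in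 H^2(\mathbb{R}^n)$ with $\langle x\rangle^{s}(P(h)-E\pm i\varepsilon)f\in L^2(\mathbb{R}^n)$, $$\|\langle x\rangle^{-s}e^{\varphi/h}f\|_{L^2}\le Ca^2h^{-1}\|\langle x\rangle^{s}e^{\varphi/h}(P(h)-E\pm i\varepsilon)f\|_{L^2}+Ca\tau\left(\frac{\varepsilon}{h}\right)^{1/2}\|e^{\varphi/h}f\|_{L^2}.$$ In particular $h_0$ and $C$ do not depend on $h$, $\varepsilon$ and $f$. -/

import Mathlib

open MeasureTheory
open scoped SchwartzMap Laplacian ENNReal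

noncomputable section

namespace Carleman

/-- The Euclidean space `ℝⁿ`. -/
abbrev Space (n : ℕ) : Type := EuclideanSpace ℝ (Fin n)

/-- The complex Hilbert space `L²(ℝⁿ)` with respect to Lebesgue measure. -/
abbrev L2 (n : ℕ) : Type := Lp ℂ 2 (volume : Measure (Space n))

/-- `f ∈ L²(ℝⁿ)` belongs to the Sobolev space `H²(ℝⁿ)`. -/
def MemH2 {n : ℕ} (f : L2 n) : Prop :=
  TemperedDistribution.MemSobolev 2 2 (f : 𝓢'(Space n, ℂ))

/-- The distributional Laplacian of an `H²` function is an `L²` function. -/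
theorem exists_laplacian {n : ℕ} {f : L2 n} (hf : MemH2 f) :
    ∃ g : L2 n, Δ (f : 𝓢'(Space n, ℂ)) = (g : 𝓢'(Space n, ℂ)) := by
  have h := TemperedDistribution.MemSobolev.laplacian hf
  rw [sub_self] at h
  exact TemperedDistribution.memSobolev_zero_iff.mp h

/-- The Laplacian `Δf = ∑ⱼ ∂ⱼ² f`, as an element of `L²`, of `f ∈ H²`. -/
def laplacianH2 {n : ℕ} {f : L2 n} (hf : MemH2 f) : L2 n :=
  (exists_laplacian hf).choose

theorem laplacianH2_spec {n : ℕ} {f : L2 n} (hf : MemH2 f) :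
    Δ (f : 𝓢'(Space n, ℂ)) = (laplacianH2 hf : 𝓢'(Space n, ℂ)) :=
  (exists_laplacian hf).choose_spec

/-- The function `(P(h) - z) f`, where `P(h) = -h² Δ + V` and `f ∈ H²`. -/
def schrodingerSub {n : ℕ} (h : ℝ) (V : Space n → ℝ) (z : ℂ) {f : L2 n} (hf : MemH2 f) :
    Space n → ℂ :=
  fun x => -(h : ℂ) ^ 2 * laplacianH2 hf x + (V x : ℂ) * f x - z * f x

/-- The weight `⟨x⟩ = (1 + |x|²)^{1/2}`. -/
def bracket {n : ℕ} (x : Space n) : ℝ := Real.sqrt (1 + ‖x‖ ^ 2)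

/-- The derivative of the phase:
`φ'(r) = τ (r + 1)⁻¹ - τ (a + 1)⁻¹` for `0 ≤ r ≤ a`, and `φ'(r) = 0` for `r ≥ a`. -/
def phaseDeriv (τ a r : ℝ) : ℝ :=
  if r ≤ a then τ * (r + 1)⁻¹ - τ * (a + 1)⁻¹ else 0

/-- The radial phase `φ`, determined by `φ(0) = 0` and its derivative. -/
def phase (τ a r : ℝ) : ℝ := ∫ t in (0 : ℝ)..r, phaseDeriv τ a t

/-- The Carleman weight `e^{φ(|x|)/h}` on `ℝⁿ`. -/
def expWeight {n : ℕ} (τ a h : ℝ) (x : Space n) : ℝ := Real.exp (phase τ a ‖x‖ / h)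

/-- The parameter `a = h^{-m}`. -/
def aParam (m h : ℝ) : ℝ := h ^ (-m)

/-- The parameter `τ = τ₀ h^{-1/3}`. -/
def tauParam (τ₀ h : ℝ) : ℝ := τ₀ * h ^ (-(1 / 3 : ℝ))

end Carleman

end

/-!
# A Carleman estimate for `-h² Δ + V - E ± iε` with a radial phase

Write `x = r ω` in polar coordinates and restrict a function `f` to the ray through `ω`. With
`φ` the phase, `Z = r^{-(n-1)/2} e^{-φ/h} r ∂ᵣ (r^{(n-1)/2} e^{φ/h} f)` and `N` the squared
spherical gradient, consider along the ray the energy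

`W = r^{n-2} e^{2φ/h} (m (h² |Z|² + (E + φ'²) r² |f|² - h² N - h² (n-1)(n-3)/4 |f|²)
  + λ (h² Re (f̄ Z) - h φ' r |f|²))`,

where `μ = r m` is a multiplier with `μ = (r + 1)² - 1` for `r ≤ a` and `μ' = (r + 1)^{-2s}` for
`r > a`. Its derivative (`hasDerivAt_rayEnergy`, from the algebraic identity `energy_identity`) is
the sum of a bulk term and of a radial function times the two spherical divergences `angDiv` and
`angDivEuler`. Two facts then give the estimate.

* The bulk term is bounded below by `(r + 1)^{-2s} |f|²` up to the square of the right-hand side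
  `(P(h) - E ± iε) f` and a multiple of `(ε/h) |f|²` (`bulk_lower_bound`). In the ball of radius
  `a` the potential, of size `⟨x⟩^{-3}` or smaller, is absorbed by the positive terms with `φ'`
  (`Admissible.positivity_inner`: where `2 (r + 1) ≤ a + 1` this needs `h τ³` large compared with
  the square of the constant in the bound for `V`, which is why `τ = τ₀ h^{-1/3}`); outside the
  ball the decay of `V` and the size of `a = h^{-m}` suffice (`Admissible.bulk_outer`). The
  term with coefficient `λ = O(ε a² / h)` absorbs the contribution `ε Im (f̄ Z)` of
  the imaginary part of the spectral parameter.
* Spherical divergences are sums of derivatives along rotation fields, and Lebesgue measure is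
  rotation invariant, so they integrate to zero against radial weights
  (`integral_radial_mul_fderiv_skew`). Thus neither spherical harmonics nor a decomposition of
  `L²(Sⁿ⁻¹)` is needed.

As `W` vanishes at the origin, integrating `χ W'` over all rays, with `χ` a cutoff near infinity,
gives the estimate for functions of class `C²` (`Admissible.spatial_estimate`). Schwartz functions
are dense in `H²`, the Fourier multipliers `(1 + |ξ|²)⁻¹` and `|ξ|² (1 + |ξ|²)⁻¹` being bounded
(`exists_schwartz_norm_sub_le`); this, and the limit in the cutoff, give the estimate in `H²`
(`Admissible.estimate_of_ae`). All conditions on the parameters are collected in the structure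
`Admissible`, and hold for small `h` by `exists_admissible`.
-/

/-! ### Rotation fields integrate to zero -/

namespace Carleman

/-- The one-parameter group generated by a skew-adjoint operator consists of isometries. -/
theorem exp_smul_mem_unitary {n : ℕ} {A : Space n →L[ℝ] Space n}
    (hA : A ∈ skewAdjoint (Space n →L[ℝ] Space n)) (t : ℝ) :
    NormedSpace.exp (t • A) ∈ unitary (Space n →L[ℝ] Space n) := by
  -- the exponential series is formed over `ℚ`
  let _ : NormedAlgebra ℚ (Space n →L[ℝ] Space n) := NormedAlgebra.restrictScalars ℚ ℝ _
  apply NormedSpace.exp_mem_unitary_of_mem_skewAdjoint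
  rw [skewAdjoint.mem_iff] at hA ⊢
  rw [star_smul, hA]; simp

theorem integral_radial_comp_exp {n : ℕ} {A : Space n →L[ℝ] Space n}
    (hA : A ∈ skewAdjoint (Space n →L[ℝ] Space n)) (k : ℝ → ℝ) (g : Space n → ℝ) (t : ℝ) :
    ∫ x : Space n, k ‖x‖ * g (NormedSpace.exp (t • A) x) = ∫ x : Space n, k ‖x‖ * g x := by
  set U := Unitary.linearIsometryEquiv ⟨_, exp_smul_mem_unitary hA t⟩ with hU
  have h1 : ∀ x, NormedSpace.exp (t • A) x = U x := fun x => by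
    rw [hU]; rfl
  have := U.measurePreserving.integral_comp U.toHomeomorph.measurableEmbedding
    (fun x => k ‖x‖ * g x)
  rw [← this]
  simp [h1]

/-- Rotation invariance of Lebesgue measure, differentiated: a rotation field applied to `g`
integrates to zero against radial weights. -/
theorem integral_radial_mul_fderiv_skew {n : ℕ} {A : Space n →L[ℝ] Space n}
    (hA : A ∈ skewAdjoint (Space n →L[ℝ] Space n)) {k : ℝ → ℝ} {R : ℝ}
    (hk : Integrable (fun x : Space n => k ‖x‖)) (hR : ∀ r, R < r → k r = 0)
    {g : Space n → ℝ} (hg : ContDiff ℝ 1 g) :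
    Integrable (fun x => k ‖x‖ * fderiv ℝ g x (A x)) ∧
      ∫ x, k ‖x‖ * fderiv ℝ g x (A x) = 0 := by
  obtain ⟨C, hC⟩ : ∃ C, ∀ x ∈ Metric.closedBall (0 : Space n) R, ‖fderiv ℝ g x‖ ≤ C :=
    (isCompact_closedBall _ _).exists_bound_of_continuousOn
      (hg.continuous_fderiv (by norm_num)).continuousOn
  obtain ⟨C', hC'⟩ : ∃ C, ∀ x ∈ Metric.closedBall (0 : Space n) R, ‖g x‖ ≤ C :=
    (isCompact_closedBall _ _).exists_bound_of_continuousOn hg.continuous.continuousOn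
  set P : ℝ → Space n →L[ℝ] Space n := fun t => NormedSpace.exp (t • A) with hP
  have hPd : ∀ t, HasDerivAt P (A * P t) t := fun t => hasDerivAt_exp_smul_const' A t
  have hPn : ∀ t x, ‖P t x‖ = ‖x‖ := fun t x =>
    ContinuousLinearMap.norm_map_of_mem_unitary (exp_smul_mem_unitary hA t) x
  have hP0 : P 0 = 1 := by
    have e : (0 : ℝ) • A = 0 := zero_smul ℝ A
    let _ : NormedAlgebra ℚ (Space n →L[ℝ] Space n) := NormedAlgebra.restrictScalars ℚ ℝ _
    exact (congrArg NormedSpace.exp e).trans NormedSpace.exp_zero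
  have hgd : Continuous (fderiv ℝ g) := hg.continuous_fderiv (by norm_num)
  have key := hasDerivAt_integral_of_dominated_loc_of_deriv_le (μ := (volume : Measure (Space n)))
    (F := fun t x => k ‖x‖ * g (P t x)) (F' := fun t x => k ‖x‖ * fderiv ℝ g (P t x) (A (P t x)))
    (x₀ := (0 : ℝ)) (s := Set.univ) (bound := fun x => ‖k ‖x‖‖ * (|C| * (‖A‖ * |R|)))
    Filter.univ_mem ?_ ?_ ?_ ?_ ?_ ?_
  · have h0 : ∀ x, k ‖x‖ * fderiv ℝ g (P 0 x) (A (P 0 x)) = k ‖x‖ * fderiv ℝ g x (A x) := by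
      intro x; simp [hP0]
    simp only [h0] at key
    refine ⟨key.1, ?_⟩
    have h2 : (fun t => ∫ x : Space n, k ‖x‖ * g (P t x)) = fun _ => ∫ x : Space n, k ‖x‖ * g x :=
      funext fun t => integral_radial_comp_exp hA k g t
    rw [h2] at key
    exact key.2.unique (hasDerivAt_const _ _)
  · refine Filter.Eventually.of_forall fun t => hk.1.mul ?_
    exact (hg.continuous.comp (P t).continuous).aestronglyMeasurable
  · refine Integrable.mono' (hk.norm.mul_const |C'|)
      (hk.1.mul (hg.continuous.comp (P 0).continuous).aestronglyMeasurable) ?_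
    refine Filter.Eventually.of_forall fun x => ?_
    rw [norm_mul]
    by_cases hx : ‖x‖ ≤ R
    · gcongr
      refine (hC' _ ?_).trans (le_abs_self _)
      simpa [hPn] using hx
    · simp [hR _ (not_le.mp hx)]
  · refine hk.1.mul ?_
    exact ((hgd.comp (P 0).continuous).clm_apply
      (A.continuous.comp (P 0).continuous)).aestronglyMeasurable
  · refine Filter.Eventually.of_forall fun x t _ => ?_
    rw [norm_mul]
    by_cases hx : ‖x‖ ≤ R
    · gcongr
      refine (ContinuousLinearMap.le_opNorm _ _).trans ?_
      have h3 : ‖A (P t x)‖ ≤ ‖A‖ * |R| := by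
        refine (A.le_opNorm _).trans ?_
        rw [hPn]
        gcongr
        exact hx.trans (le_abs_self _)
      gcongr
      refine (hC _ ?_).trans (le_abs_self _)
      simpa [hPn] using hx
    · simp [hR _ (not_le.mp hx)]
  · exact hk.norm.mul_const _
  · refine Filter.Eventually.of_forall fun x t _ => ?_
    have h4 : HasDerivAt (fun t => P t x) (A (P t x)) t := by
      simpa using (hPd t).clm_apply (hasDerivAt_const t x)
    have h5 := ((hg.differentiable (by norm_num)) (P t x)).hasFDerivAt.comp_hasDerivAt t h4
    exact h5.const_mul _

end Carleman

/-! ### Polar coordinates -/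

namespace Carleman

/-- Integration in polar coordinates: an integrable function has nonpositive integral as soon as
its integral along almost every ray, with density `r ^ (n - 1)`, is nonpositive. -/
theorem integral_nonpos_of_rays {n : ℕ} (hn : 1 ≤ n) {B : Space n → ℝ} (hB : Integrable B)
    (h : ∀ ω : Space n, ‖ω‖ = 1 →
      IntegrableOn (fun r : ℝ => r ^ (n - 1) * B (r • ω)) (Set.Ioi 0) →
      ∫ r in Set.Ioi (0 : ℝ), r ^ (n - 1) * B (r • ω) ≤ 0) :
    ∫ x, B x ≤ 0 := by
  have : Nonempty (Fin n) := ⟨⟨0, hn⟩⟩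
  have hmp := (volume : Measure (Space n)).measurePreserving_homeomorphUnitSphereProd
  have hemb := (homeomorphUnitSphereProd (Space n)).measurableEmbedding
  have hdim : Module.finrank ℝ (Space n) = n := by simp
  rw [hdim] at hmp
  set G : Metric.sphere (0 : Space n) 1 × Set.Ioi (0 : ℝ) → ℝ :=
    fun p => B ((p.2 : ℝ) • (p.1 : Space n)) with hG
  have hGB : ∀ x : ({0}ᶜ : Set (Space n)), G (homeomorphUnitSphereProd (Space n) x) = B x := by
    intro x
    have hx : ‖(x : Space n)‖ ≠ 0 := norm_ne_zero_iff.mpr x.2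
    simp [hG, smul_smul, hx]
  have hcomap : Integrable (fun x : ({0}ᶜ : Set (Space n)) => B x)
      (Measure.comap (↑) (volume : Measure (Space n))) := by
    have h1 : IntegrableOn B ({0}ᶜ : Set (Space n)) := hB.integrableOn
    rwa [integrableOn_iff_comap_subtypeVal (by measurability)] at h1
  have hGint : Integrable G ((volume : Measure (Space n)).toSphere.prod
      (Measure.volumeIoiPow (n - 1))) := by
    rw [← hmp.integrable_comp_emb hemb]
    exact hcomap.congr (Filter.Eventually.of_forall fun x => (hGB x).symm)
  have hI : ∫ x, B x = ∫ p, G p ∂((volume : Measure (Space n)).toSphere.prod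
      (Measure.volumeIoiPow (n - 1))) := by
    rw [← hmp.integral_comp hemb]
    simp only [hGB]
    rw [integral_subtype_comap (measurableSet_singleton _).compl fun x => B x,
      restrict_compl_singleton]
  rw [hI, integral_prod _ hGint]
  refine integral_nonpos_of_ae ?_
  filter_upwards [hGint.prod_right_ae] with ω hω
  have hω1 : ‖(ω : Space n)‖ = 1 := by simp
  have hpos : ∀ x : Set.Ioi (0 : ℝ), (0 : ℝ) ≤ (x : ℝ) ^ (n - 1) :=
    fun x => pow_nonneg (le_of_lt x.2) _
  have hmeas : Measurable fun x : Set.Ioi (0 : ℝ) => ENNReal.ofReal ((x : ℝ) ^ (n - 1)) := by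
    fun_prop
  have e1 : ∀ x : Set.Ioi (0 : ℝ), (ENNReal.ofReal ((x : ℝ) ^ (n - 1))).toReal • G (ω, x) =
      (x : ℝ) ^ (n - 1) * B ((x : ℝ) • (ω : Space n)) := fun x => by
    rw [ENNReal.toReal_ofReal (hpos x), smul_eq_mul]
  have h2 : IntegrableOn (fun r : ℝ => r ^ (n - 1) * B (r • (ω : Space n))) (Set.Ioi 0) := by
    rw [integrableOn_iff_comap_subtypeVal measurableSet_Ioi]
    unfold Measure.volumeIoiPow at hω
    rw [integrable_withDensity_iff_integrable_smul' hmeas (by simp)] at hω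
    simp only [e1] at hω
    exact hω
  have h3 := h ω hω1 h2
  rw [← integral_subtype_comap measurableSet_Ioi
    (fun r : ℝ => r ^ (n - 1) * B (r • (ω : Space n)))] at h3
  unfold Measure.volumeIoiPow
  rw [integral_withDensity_eq_integral_toReal_smul hmeas (by simp)]
  simp only [e1]
  exact h3

end Carleman

/-! ### The generators of rotations -/

namespace Carleman

/-- The `j`-th standard basis vector of `ℝⁿ`. -/
noncomputable abbrev stdVec {n : ℕ} (j : Fin n) : Space n := EuclideanSpace.single j 1

/-- The infinitesimal rotation `x ↦ xⱼ eₖ - xₖ eⱼ` in the `(j, k)` plane. -/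
noncomputable def rotGen {n : ℕ} (j k : Fin n) : Space n →L[ℝ] Space n :=
  (EuclideanSpace.proj j : Space n →L[ℝ] ℝ).smulRight (stdVec k) -
    (EuclideanSpace.proj k : Space n →L[ℝ] ℝ).smulRight (stdVec j)

theorem rotGen_apply {n : ℕ} (j k : Fin n) (x : Space n) :
    rotGen j k x = x j • stdVec k - x k • stdVec j := by
  simp [rotGen]

theorem rotGen_mem_skewAdjoint {n : ℕ} (j k : Fin n) :
    rotGen j k ∈ skewAdjoint (Space n →L[ℝ] Space n) := by
  rw [skewAdjoint.mem_iff, ContinuousLinearMap.star_eq_adjoint, eq_comm,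
    ContinuousLinearMap.eq_adjoint_iff]
  intro x y
  simp only [neg_apply, rotGen_apply, inner_neg_left, inner_sub_left,
    inner_sub_right, inner_smul_left, inner_smul_right, stdVec, EuclideanSpace.inner_single_left,
    EuclideanSpace.inner_single_right]
  simp
  ring

theorem sum_coord_smul_stdVec {n : ℕ} (x : Space n) : ∑ j, x j • stdVec j = x := by
  have := (EuclideanSpace.basisFun (Fin n) ℝ).sum_repr x
  simpa using this

/-- The quadratic form of `B` on the rotation fields. It produces the spherical gradient and the
spherical Laplacian from the rotation generators. -/
theorem sum_bilin_rotGen {n : ℕ} (B : Space n →ₗ[ℝ] Space n →ₗ[ℝ] ℝ) (x : Space n) :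
    ∑ j, ∑ k, B (rotGen j k x) (rotGen j k x) =
      2 * (‖x‖ ^ 2 * ∑ j, B (stdVec j) (stdVec j) - B x x) := by
  have hx : B x x = ∑ j, ∑ k, x j * x k * B (stdVec j) (stdVec k) := by
    conv_lhs => rw [← sum_coord_smul_stdVec x]
    simp only [map_sum, map_smul, LinearMap.sum_apply, LinearMap.smul_apply, smul_eq_mul,
      Finset.mul_sum]
    rw [Finset.sum_comm]
    refine Finset.sum_congr rfl fun j _ => Finset.sum_congr rfl fun k _ => by ring
  have hx' : B x x = ∑ j, ∑ k, x j * x k * B (stdVec k) (stdVec j) := by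
    rw [hx, Finset.sum_comm]
    refine Finset.sum_congr rfl fun j _ => Finset.sum_congr rfl fun k _ => by ring
  have hn : ‖x‖ ^ 2 = ∑ j, x j ^ 2 := by
    rw [EuclideanSpace.norm_sq_eq]; simp
  have h1 : ‖x‖ ^ 2 * ∑ j, B (stdVec j) (stdVec j) =
      ∑ j, ∑ k, x j ^ 2 * B (stdVec k) (stdVec k) := by
    rw [hn, Finset.sum_mul_sum]
  have h2 : ‖x‖ ^ 2 * ∑ j, B (stdVec j) (stdVec j) =
      ∑ j, ∑ k, x k ^ 2 * B (stdVec j) (stdVec j) := by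
    rw [h1, Finset.sum_comm]
  have : 2 * (‖x‖ ^ 2 * ∑ j, B (stdVec j) (stdVec j) - B x x) =
    (∑ j, ∑ k, x j ^ 2 * B (stdVec k) (stdVec k)) + (∑ j, ∑ k, x k ^ 2 * B (stdVec j) (stdVec j))
      - (∑ j, ∑ k, x j * x k * B (stdVec j) (stdVec k))
      - (∑ j, ∑ k, x j * x k * B (stdVec k) (stdVec j)) := by
    rw [← hx, ← hx', ← h1, ← h2]; ring
  rw [this]
  simp only [← Finset.sum_add_distrib, ← Finset.sum_sub_distrib]
  refine Finset.sum_congr rfl fun j _ => Finset.sum_congr rfl fun k _ => ?_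
  rw [rotGen_apply]
  simp only [map_sub, map_smul, LinearMap.sub_apply, LinearMap.smul_apply, smul_eq_mul]
  ring

theorem sum_rotGen_rotGen {n : ℕ} (x : Space n) :
    ∑ j, ∑ k, rotGen j k (rotGen j k x) = (-2 * ((n : ℝ) - 1)) • x := by
  ext i
  simp only [rotGen_apply, WithLp.ofLp_sum, Finset.sum_apply, PiLp.sub_apply, PiLp.smul_apply,
    smul_eq_mul, PiLp.single_apply]
  have h : ∀ j k : Fin n,
      (x j * (if j = k then 1 else 0) - x k * (if j = j then (1 : ℝ) else 0)) *
          (if i = k then 1 else 0) -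
        (x j * (if k = k then (1 : ℝ) else 0) - x k * (if k = j then 1 else 0)) *
          (if i = j then 1 else 0) =
      (if i = k then (if j = k then x k else 0) else 0) - (if i = k then x k else 0)
        - (if i = j then x j else 0) + (if i = j then (if k = j then x j else 0) else 0) := by
    intro j k
    split_ifs <;> simp_all
  simp only [Finset.sum_sub_distrib]
  simp
  ring

end Carleman

/-! ### Spherical divergences -/

namespace Carleman

variable {n : ℕ}

/-- The second derivative `D²f(x)(v, w)`. -/
noncomputable abbrev hess (f : Space n → ℂ) (x v w : Space n) : ℂ := fderiv ℝ (fderiv ℝ f) x v w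

/-- The trace of the second derivative. -/
noncomputable def hessTrace (f : Space n → ℂ) (x : Space n) : ℂ :=
  ∑ j, hess f x (stdVec j) (stdVec j)

/-- The squared length of the gradient. -/
noncomputable def gradSq (f : Space n → ℂ) (x : Space n) : ℝ :=
  ∑ j, ‖fderiv ℝ f x (stdVec j)‖ ^ 2

/-- The squared length of the spherical gradient, `∑_{j<k} |Ω_{jk} f|²` with
`Ω_{jk} = xⱼ ∂ₖ - xₖ ∂ⱼ`. -/
noncomputable def angGradSq (f : Space n → ℂ) (x : Space n) : ℝ :=
  ‖x‖ ^ 2 * gradSq f x - ‖fderiv ℝ f x x‖ ^ 2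

/-- The spherical Laplacian `∑_{j<k} Ω_{jk}² f`. -/
noncomputable def angLaplacian (f : Space n → ℂ) (x : Space n) : ℂ :=
  (‖x‖ : ℂ) ^ 2 * hessTrace f x - hess f x x x - ((n : ℂ) - 1) * fderiv ℝ f x x

/-- The derivative of `angGradSq f` along the Euler field `r ∂ᵣ`. -/
noncomputable def angGradSqEuler (f : Space n → ℂ) (x : Space n) : ℝ :=
  2 * angGradSq f x + 2 * (‖x‖ ^ 2 *
    ∑ j, inner ℝ (hess f x x (stdVec j)) (fderiv ℝ f x (stdVec j))) -
    2 * inner ℝ (hess f x x x) (fderiv ℝ f x x)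

/-- The spherical divergence `∑_{j<k} Ω_{jk} Re(f̄ Ω_{jk} f)`. -/
noncomputable def angDiv (f : Space n → ℂ) (x : Space n) : ℝ :=
  inner ℝ (f x) (angLaplacian f x) + angGradSq f x

/-- The spherical divergence `∑_{j<k} Ω_{jk} Re(conj (r ∂ᵣ f) Ω_{jk} f)`. -/
noncomputable def angDivEuler (f : Space n → ℂ) (x : Space n) : ℝ :=
  inner ℝ (fderiv ℝ f x x) (angLaplacian f x) + angGradSqEuler f x / 2

variable {f : Space n → ℂ}

theorem differentiable_fderiv_of_contDiff (hf : ContDiff ℝ 2 f) :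
    Differentiable ℝ (fderiv ℝ f) :=
  (hf.fderiv_right (m := 1) (by norm_num)).differentiable (by norm_num)

theorem hess_symm (hf : ContDiff ℝ 2 f) (x v w : Space n) : hess f x v w = hess f x w v :=
  (hf.contDiffAt.isSymmSndFDerivAt (by simp)).eq v w

/-- `D²f(x)` as a bilinear map of real vector spaces, paired with a constant. -/
noncomputable def innerHess (f : Space n → ℂ) (x : Space n) (c : ℂ) :
    Space n →ₗ[ℝ] Space n →ₗ[ℝ] ℝ :=
  LinearMap.mk₂ ℝ (fun v w => inner ℝ c (hess f x v w))
    (fun a b w => by simp [hess, inner_add_right]) (fun a b w => by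
      simp only [hess, map_smul, smul_apply, real_inner_smul_right, smul_eq_mul])
    (fun a b w => by simp [hess, inner_add_right]) (fun a b w => by
      simp only [hess, map_smul, real_inner_smul_right, smul_eq_mul])

/-- The bilinear form `(v, w) ↦ Re(conj (T v) S w)`. -/
noncomputable def innerPair (T S : Space n →L[ℝ] ℂ) : Space n →ₗ[ℝ] Space n →ₗ[ℝ] ℝ :=
  LinearMap.mk₂ ℝ (fun v w => inner ℝ (T v) (S w))
    (fun a b w => by simp [inner_add_left])
    (fun a b w => by simp only [map_smul, real_inner_smul_left, smul_eq_mul])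
    (fun a b w => by simp [inner_add_right])
    (fun a b w => by simp only [map_smul, real_inner_smul_right, smul_eq_mul])

theorem hasFDerivAt_fderiv_rotGen (hf : ContDiff ℝ 2 f) (A : Space n →L[ℝ] Space n)
    (x : Space n) : HasFDerivAt (fun x => fderiv ℝ f x (A x))
      ((fderiv ℝ f x).comp A + (fderiv ℝ (fderiv ℝ f) x).flip (A x)) x :=
  (differentiable_fderiv_of_contDiff hf x).hasFDerivAt.clm_apply A.hasFDerivAt

theorem contDiff_fderiv_rotGen (hf : ContDiff ℝ 2 f) (A : Space n →L[ℝ] Space n) :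
    ContDiff ℝ 1 (fun x => fderiv ℝ f x (A x)) :=
  (hf.fderiv_right (m := 1) (by norm_num)).clm_apply A.contDiff

/-- The sum of the squares of the rotation fields is twice the spherical Laplacian: every plane is
counted twice. -/
theorem sum_inner_rotGen_sq (f : Space n → ℂ) (x : Space n) (c : ℂ) :
    ∑ j, ∑ k, inner ℝ c (fderiv ℝ f x (rotGen j k (rotGen j k x)) +
      hess f x (rotGen j k x) (rotGen j k x)) = 2 * inner ℝ c (angLaplacian f x) := by
  simp only [inner_add_right, Finset.sum_add_distrib]
  have h1 : ∑ j, ∑ k, inner ℝ c (hess f x (rotGen j k x) (rotGen j k x)) = _ :=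
    sum_bilin_rotGen (innerHess f x c) x
  rw [h1]
  have h2 : ∑ j, ∑ k, inner ℝ c (fderiv ℝ f x (rotGen j k (rotGen j k x))) =
      inner ℝ c (fderiv ℝ f x ((-2 * ((n : ℝ) - 1)) • x)) := by
    rw [← sum_rotGen_rotGen]
    simp only [map_sum, inner_sum]
  rw [h2]
  simp only [innerHess, LinearMap.mk₂_apply, ← inner_sum]
  change _ + 2 * (‖x‖ ^ 2 * inner ℝ c (hessTrace f x) - _) = _
  rw [angLaplacian, map_smul, inner_smul_right]
  have e1 : (‖x‖ : ℂ) ^ 2 * hessTrace f x = (‖x‖ ^ 2 : ℝ) • hessTrace f x := by simp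
  have e2 : ((n : ℂ) - 1) * fderiv ℝ f x x = ((n : ℝ) - 1) • fderiv ℝ f x x := by simp
  rw [e1, e2, inner_sub_right, inner_sub_right, inner_smul_right, inner_smul_right]
  ring

theorem angGradSq_eq_sum (f : Space n → ℂ) (x : Space n) :
    ∑ j, ∑ k, ‖fderiv ℝ f x (rotGen j k x)‖ ^ 2 = 2 * angGradSq f x := by
  have h1 : ∑ j, ∑ k, inner ℝ (fderiv ℝ f x (rotGen j k x)) (fderiv ℝ f x (rotGen j k x)) = _ :=
    sum_bilin_rotGen (innerPair (fderiv ℝ f x) (fderiv ℝ f x)) x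
  simp only [innerPair, LinearMap.mk₂_apply, real_inner_self_eq_norm_sq] at h1
  rw [h1, angGradSq, gradSq]

theorem angGradSq_nonneg (f : Space n → ℂ) (x : Space n) : 0 ≤ angGradSq f x := by
  have h := angGradSq_eq_sum f x
  have : 0 ≤ ∑ j, ∑ k, ‖fderiv ℝ f x (rotGen j k x)‖ ^ 2 := by positivity
  linarith

theorem angDiv_eq_sum (hf : ContDiff ℝ 2 f) (x : Space n) :
    ∑ j, ∑ k, fderiv ℝ (fun x => inner ℝ (f x) (fderiv ℝ f x (rotGen j k x))) x (rotGen j k x) =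
      2 * angDiv f x := by
  have h : ∀ j k, fderiv ℝ (fun x => inner ℝ (f x) (fderiv ℝ f x (rotGen j k x))) x
      (rotGen j k x) = inner ℝ (f x) (fderiv ℝ f x (rotGen j k (rotGen j k x)) +
        hess f x (rotGen j k x) (rotGen j k x)) + ‖fderiv ℝ f x (rotGen j k x)‖ ^ 2 := by
    intro j k
    have h1 := hasFDerivAt_fderiv_rotGen hf (rotGen j k) x
    rw [fderiv_inner_apply ℝ (hf.differentiable (by norm_num) x) h1.differentiableAt, h1.fderiv]
    simp only [add_apply, ContinuousLinearMap.comp_apply, ContinuousLinearMap.flip_apply,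
      real_inner_self_eq_norm_sq]
  simp only [h, Finset.sum_add_distrib]
  rw [sum_inner_rotGen_sq, angGradSq_eq_sum, angDiv]
  ring

theorem angDivEuler_eq_sum (hf : ContDiff ℝ 2 f) (x : Space n) :
    ∑ j, ∑ k, fderiv ℝ (fun x => inner ℝ (fderiv ℝ f x x) (fderiv ℝ f x (rotGen j k x))) x
      (rotGen j k x) = 2 * angDivEuler f x := by
  have h : ∀ j k, fderiv ℝ (fun x => inner ℝ (fderiv ℝ f x x) (fderiv ℝ f x (rotGen j k x))) x
      (rotGen j k x) = inner ℝ (fderiv ℝ f x x) (fderiv ℝ f x (rotGen j k (rotGen j k x)) +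
        hess f x (rotGen j k x) (rotGen j k x)) + ‖fderiv ℝ f x (rotGen j k x)‖ ^ 2
        + inner ℝ (hess f x x (rotGen j k x)) (fderiv ℝ f x (rotGen j k x)) := by
    intro j k
    have h1 := hasFDerivAt_fderiv_rotGen hf (rotGen j k) x
    have h2 := hasFDerivAt_fderiv_rotGen hf (ContinuousLinearMap.id ℝ _) x
    simp only [ContinuousLinearMap.id_apply] at h2
    rw [fderiv_inner_apply ℝ h2.differentiableAt h1.differentiableAt, h1.fderiv, h2.fderiv]
    simp only [add_apply, ContinuousLinearMap.comp_apply,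
      ContinuousLinearMap.flip_apply, ContinuousLinearMap.id_apply, inner_add_left,
      real_inner_self_eq_norm_sq]
    rw [show fderiv ℝ (fderiv ℝ f) x (rotGen j k x) x = hess f x x (rotGen j k x) from
      hess_symm hf _ _ _]
    ring
  have h3 : ∑ j, ∑ k, inner ℝ (hess f x x (rotGen j k x)) (fderiv ℝ f x (rotGen j k x)) = _ :=
    sum_bilin_rotGen (innerPair (fderiv ℝ (fderiv ℝ f) x x) (fderiv ℝ f x)) x
  simp only [innerPair, LinearMap.mk₂_apply] at h3
  simp only [h, Finset.sum_add_distrib]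
  rw [sum_inner_rotGen_sq, angGradSq_eq_sum, h3, angDivEuler, angGradSqEuler]
  ring

/-- The spherical divergence `angDiv` integrates to zero against radial weights. -/
theorem integral_radial_mul_angDiv (hf : ContDiff ℝ 2 f) {k : ℝ → ℝ} {R : ℝ}
    (hk : Integrable (fun x : Space n => k ‖x‖)) (hR : ∀ r, R < r → k r = 0) :
    Integrable (fun x => k ‖x‖ * angDiv f x) ∧ ∫ x, k ‖x‖ * angDiv f x = 0 := by
  have h := fun i j : Fin n => integral_radial_mul_fderiv_skew (rotGen_mem_skewAdjoint i j) hk hR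
    ((hf.of_le (by norm_num)).inner ℝ (contDiff_fderiv_rotGen hf (rotGen i j)))
  have e : ∀ x, k ‖x‖ * angDiv f x = (1 / 2) * ∑ i, ∑ j, k ‖x‖ *
      fderiv ℝ (fun x => inner ℝ (f x) (fderiv ℝ f x (rotGen i j x))) x (rotGen i j x) := by
    intro x
    simp only [← Finset.mul_sum]
    rw [angDiv_eq_sum hf]
    ring
  have hi : ∀ i ∈ Finset.univ, Integrable (fun x => ∑ j, k ‖x‖ *
      fderiv ℝ (fun x => inner ℝ (f x) (fderiv ℝ f x (rotGen i j x))) x (rotGen i j x)) :=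
    fun i _ => integrable_finsetSum _ fun j _ => (h i j).1
  simp only [e]
  refine ⟨(integrable_finsetSum _ hi).const_mul _, ?_⟩
  rw [integral_const_mul, integral_finsetSum _ hi]
  refine mul_eq_zero_of_right _ (Finset.sum_eq_zero fun i _ => ?_)
  rw [integral_finsetSum _ (fun j _ => (h i j).1)]
  exact Finset.sum_eq_zero fun j _ => (h i j).2

/-- The spherical divergence `angDivEuler` integrates to zero against radial weights. -/
theorem integral_radial_mul_angDivEuler (hf : ContDiff ℝ 2 f) {k : ℝ → ℝ} {R : ℝ}
    (hk : Integrable (fun x : Space n => k ‖x‖)) (hR : ∀ r, R < r → k r = 0) :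
    Integrable (fun x => k ‖x‖ * angDivEuler f x) ∧ ∫ x, k ‖x‖ * angDivEuler f x = 0 := by
  have h := fun i j : Fin n => integral_radial_mul_fderiv_skew (rotGen_mem_skewAdjoint i j) hk hR
    ((contDiff_fderiv_rotGen hf (ContinuousLinearMap.id ℝ _)).inner ℝ
      (contDiff_fderiv_rotGen hf (rotGen i j)))
  have e : ∀ x, k ‖x‖ * angDivEuler f x = (1 / 2) * ∑ i, ∑ j, k ‖x‖ *
      fderiv ℝ (fun x => inner ℝ (fderiv ℝ f x x) (fderiv ℝ f x (rotGen i j x))) x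
        (rotGen i j x) := by
    intro x
    simp only [← Finset.mul_sum]
    rw [angDivEuler_eq_sum hf]
    ring
  have hi : ∀ i ∈ Finset.univ, Integrable (fun x => ∑ j, k ‖x‖ *
      fderiv ℝ (fun x => inner ℝ (fderiv ℝ f x x) (fderiv ℝ f x (rotGen i j x))) x
        (rotGen i j x)) :=
    fun i _ => integrable_finsetSum _ fun j _ => (h i j).1
  simp only [e]
  refine ⟨(integrable_finsetSum _ hi).const_mul _, ?_⟩
  rw [integral_const_mul, integral_finsetSum _ hi]
  refine mul_eq_zero_of_right _ (Finset.sum_eq_zero fun i _ => ?_)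
  refine (integral_finsetSum _ (fun j _ => (h i j).1)).trans ?_
  exact Finset.sum_eq_zero fun j _ => (h i j).2

/-! ### Derivatives along rays -/

theorem hasDerivAt_ray (hf : ContDiff ℝ 2 f) (ω : Space n) (r : ℝ) :
    HasDerivAt (fun r : ℝ => f (r • ω)) (fderiv ℝ f (r • ω) ω) r := by
  have h := ((hf.differentiable (by norm_num)) (r • ω)).hasFDerivAt.comp_hasDerivAt r
    ((hasDerivAt_id r).smul_const ω)
  rwa [one_smul] at h

theorem hasDerivAt_fderiv_ray (hf : ContDiff ℝ 2 f) (ω v : Space n) (r : ℝ) :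
    HasDerivAt (fun r : ℝ => fderiv ℝ f (r • ω) v) (hess f (r • ω) ω v) r := by
  have h := (differentiable_fderiv_of_contDiff hf (r • ω)).hasFDerivAt.comp_hasDerivAt r
    ((hasDerivAt_id r).smul_const ω)
  have h2 := h.clm_apply (hasDerivAt_const r v)
  simpa using h2

/-- Along a ray `r ∂ᵣ` is the Euler field, so `∂ᵣ` of the spherical gradient is
`r⁻¹ angGradSqEuler`. -/
theorem hasDerivAt_angGradSq_ray (hf : ContDiff ℝ 2 f) {ω : Space n} (hω : ‖ω‖ = 1) (r : ℝ) :
    HasDerivAt (fun r : ℝ => angGradSq f (r • ω))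
      (angGradSqEuler f (r • ω) / r) r := by
  have e : (fun r : ℝ => angGradSq f (r • ω)) = fun r : ℝ => r ^ 2 *
      (∑ j, ‖fderiv ℝ f (r • ω) (stdVec j)‖ ^ 2 - ‖fderiv ℝ f (r • ω) ω‖ ^ 2) := by
    funext r
    simp only [angGradSq, gradSq, map_smul, norm_smul, hω, mul_one, Real.norm_eq_abs, sq_abs,
      mul_pow]
    ring
  rw [e]
  have h1 := (HasDerivAt.fun_sum (u := Finset.univ) fun j _ =>
    (hasDerivAt_fderiv_ray hf ω (stdVec j) r).norm_sq).sub
      (hasDerivAt_fderiv_ray hf ω ω r).norm_sq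
  refine ((hasDerivAt_pow 2 r).mul h1).congr_deriv ?_
  have e1 : ∀ j, hess f (r • ω) (r • ω) (stdVec j) = r • hess f (r • ω) ω (stdVec j) :=
    fun j => by simp only [hess, map_smul, smul_apply]
  have e2 : hess f (r • ω) (r • ω) (r • ω) = (r * r) • hess f (r • ω) ω ω := by
    simp only [hess, map_smul, smul_apply, smul_smul]
  simp only [angGradSqEuler, angGradSq, gradSq, e1, e2, map_smul, norm_smul, hω, mul_one,
    Real.norm_eq_abs, sq_abs, mul_pow, real_inner_smul_left, real_inner_smul_right,
    ← Finset.mul_sum, Pi.sub_apply]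
  simp_rw [real_inner_comm (hess f _ _ _)]
  field_simp
  ring

end Carleman

/-! ### The pointwise energy identity -/

namespace Carleman

/-- The zeroth order coefficient of `r^{1 - (n - 1) / 2} e^{-φ/h} ∂ᵣ (r^{(n - 1) / 2} e^{φ/h} ·)` in
dimension `n = k + 3`. -/
noncomputable def rayCoeff (k : ℕ) (h p r : ℝ) : ℝ := ((k : ℝ) + 2) / 2 + r * p / h

/-- The conjugated radial derivative
`r^{1 - (n - 1) / 2} e^{-φ/h} ∂ᵣ (r^{(n - 1) / 2} e^{φ/h} y)`. -/
noncomputable def rayDeriv (k : ℕ) (h p r : ℝ) (y y₁ : ℂ) : ℂ :=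
  (r : ℂ) * y₁ + (rayCoeff k h p r : ℂ) * y

/-- The density of the energy functional along a ray, without the factor `r^{n - 2} e^{2φ/h}`, in
dimension `n = k + 3`. Here `y` and `y₁` are the function and its radial derivative, `N` is the
squared spherical gradient, `p = φ'`, `m` is the multiplier divided by `r`, and `lam` weighs the
lower order energy. The number `(k + 2) k / 4` is `(n - 1) (n - 3) / 4`. -/
noncomputable def energyDensity (k : ℕ) (h E lam m p r : ℝ) (y y₁ : ℂ) (N : ℝ) : ℝ :=
  m * (h ^ 2 * ‖rayDeriv k h p r y y₁‖ ^ 2 + (E + p ^ 2) * r ^ 2 * ‖y‖ ^ 2 - h ^ 2 * N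
      - h ^ 2 * (((k : ℝ) + 2) * k / 4) * ‖y‖ ^ 2) +
    lam * (h ^ 2 * inner ℝ y (rayDeriv k h p r y y₁) - h * p * r * ‖y‖ ^ 2)

/-- The bulk term produced by differentiating the energy, with `U` the conjugated radial derivative
divided by `r`, `μ` the multiplier, `p = φ'`, `μ₁` and `p₁` the derivatives of `μ` and `p`, and `g`
the value of `(-h² Δ + V - E - i e) f`. -/
noncomputable def bulk (k : ℕ) (h E lam V e r μ μ₁ p p₁ : ℝ) (y U g : ℂ) (N : ℝ) : ℝ :=
  (μ₁ + 4 * p * μ / h) * (h ^ 2 * ‖U‖ ^ 2) + (μ₁ * (E + p ^ 2) + 2 * μ * p * p₁) * ‖y‖ ^ 2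
    + (2 * μ / r ^ 3 - μ₁ / r ^ 2) * h ^ 2 * (N + (((k : ℝ) + 2) * k / 4) * ‖y‖ ^ 2)
    - 2 * μ * inner ℝ g U + 2 * h * μ * p₁ * inner ℝ y U + 2 * μ * V * inner ℝ y U
    + 2 * e * μ * inner ℝ y (Complex.I * U)
    + lam * (h ^ 2 * ‖U‖ ^ 2 + h ^ 2 / r ^ 2 * (N + (((k : ℝ) + 2) * k / 4) * ‖y‖ ^ 2)
      - (E + p ^ 2 - V) * ‖y‖ ^ 2 - inner ℝ g y)

/-- The energy identity along a ray. The left-hand side is `r` times the derivative of the energy,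
divided by `r^{n - 2} e^{2φ/h}`; `L` is the spherical Laplacian, and by `hg` the second derivatives
cancel. The last two terms on the right are the spherical divergences. -/
theorem energy_identity (k : ℕ) {h r : ℝ} (hh : h ≠ 0) (hr : r ≠ 0)
    (E lam V e m m₁ p p₁ N N₁ : ℝ) (y y₁ y₂ g L : ℂ)
    (hg : g = -(h : ℂ) ^ 2 * (y₂ + ((k : ℂ) + 2) / r * y₁ + L / (r : ℂ) ^ 2)
      + ((V : ℂ) - (E + Complex.I * e)) * y) :
    ((k : ℝ) + 1 + 2 * r * p / h) * energyDensity k h E lam m p r y y₁ N +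
      r * (m₁ * (h ^ 2 * ‖rayDeriv k h p r y y₁‖ ^ 2 + (E + p ^ 2) * r ^ 2 * ‖y‖ ^ 2 - h ^ 2 * N
          - h ^ 2 * (((k : ℝ) + 2) * k / 4) * ‖y‖ ^ 2) +
        m * (h ^ 2 * (2 * inner ℝ (rayDeriv k h p r y y₁) (y₁ + r * y₂ +
            (((p + r * p₁) / h : ℝ) : ℂ) * y + (rayCoeff k h p r : ℂ) * y₁)) +
          (2 * p * p₁ * r ^ 2 + (E + p ^ 2) * (2 * r)) * ‖y‖ ^ 2 +
          (E + p ^ 2) * r ^ 2 * (2 * inner ℝ y y₁) - h ^ 2 * (N₁ / r)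
          - h ^ 2 * (((k : ℝ) + 2) * k / 4) * (2 * inner ℝ y y₁)) +
        lam * (h ^ 2 * (inner ℝ y (y₁ + r * y₂ +
            (((p + r * p₁) / h : ℝ) : ℂ) * y + (rayCoeff k h p r : ℂ) * y₁)
              + inner ℝ y₁ (rayDeriv k h p r y y₁))
          - (h * (p₁ * r + p) * ‖y‖ ^ 2 + h * p * r * (2 * inner ℝ y y₁)))) =
    r ^ 2 * bulk k h E lam V e r (r * m) (m + r * m₁) p p₁ y (rayDeriv k h p r y y₁ / r) g N
      - (h ^ 2 * (2 * m * rayCoeff k h p r + lam) * (inner ℝ y L + N)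
        + 2 * h ^ 2 * m * (inner ℝ ((r : ℂ) * y₁) L + N₁ / 2)) := by
  have hL : L = (r : ℂ) ^ 2 * ((((V : ℂ) - (E + Complex.I * e)) * y - g) / (h : ℂ) ^ 2 - y₂)
      - ((k : ℂ) + 2) * r * y₁ := by
    have h1 : (h : ℂ) ≠ 0 := by exact_mod_cast hh
    have h2 : (r : ℂ) ≠ 0 := by exact_mod_cast hr
    rw [hg]
    field_simp
    ring
  -- `L` contains `r² y₂`, so that all second derivatives cancel
  have hLre : L.re = r ^ 2 * (((V - E) * y.re + e * y.im - g.re) / h ^ 2 - y₂.re)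
      - (k + 2) * r * y₁.re := by
    rw [hL]
    simp only [← Complex.ofReal_pow, Complex.sub_re, Complex.div_ofReal_re,
      Complex.mul_re, Complex.I_re, Complex.I_im, Complex.ofReal_re, Complex.ofReal_im,
      Complex.add_re, Complex.add_im, Complex.sub_im, Complex.mul_im, Complex.natCast_re,
      Complex.natCast_im, Complex.re_ofNat, Complex.im_ofNat]
    ring
  have hLim : L.im = r ^ 2 * (((V - E) * y.im - e * y.re - g.im) / h ^ 2 - y₂.im)
      - (k + 2) * r * y₁.im := by
    rw [hL]
    simp only [← Complex.ofReal_pow, Complex.sub_im, Complex.div_ofReal_im,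
      Complex.mul_im, Complex.I_re, Complex.I_im, Complex.ofReal_re, Complex.ofReal_im,
      Complex.add_re, Complex.add_im, Complex.sub_re, Complex.mul_re, Complex.natCast_re,
      Complex.natCast_im, Complex.re_ofNat, Complex.im_ofNat]
    ring
  simp only [energyDensity, bulk, rayDeriv, rayCoeff, Complex.inner, Complex.sq_norm,
    Complex.normSq_apply, Complex.mul_re, Complex.mul_im, Complex.conj_re, Complex.conj_im,
    Complex.div_ofReal_re, Complex.div_ofReal_im, Complex.add_re, Complex.add_im,
    Complex.ofReal_re, Complex.ofReal_im, Complex.I_re, Complex.I_im, hLre, hLim]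
  field_simp
  ring

end Carleman

/-! ### The energy along rays and its derivative -/

namespace Carleman

/-- The energy functional along a ray: `m`, `p` and `Φ` stand for the multiplier divided by `r`, for
`φ'` and for `φ`. -/
noncomputable def rayEnergy (k : ℕ) (h E lam : ℝ) (m p Φ : ℝ → ℝ) (y y₁ : ℝ → ℂ) (N : ℝ → ℝ)
    (r : ℝ) : ℝ :=
  r ^ (k + 1) * Real.exp (2 * Φ r / h) * energyDensity k h E lam (m r) (p r) r (y r) (y₁ r) (N r)

/-- The derivative of the energy: the bulk term and the two spherical divergences. -/
theorem hasDerivAt_rayEnergy (k : ℕ) {h r : ℝ} (hh : h ≠ 0) (hr : r ≠ 0) (E lam V e : ℝ)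
    {m p Φ N : ℝ → ℝ} {y y₁ : ℝ → ℂ} {m₁ p₁ N₁ : ℝ} {y₂ g L : ℂ}
    (hm : HasDerivAt m m₁ r) (hp : HasDerivAt p p₁ r) (hΦ : HasDerivAt Φ (p r) r)
    (hy : HasDerivAt y (y₁ r) r) (hy₁ : HasDerivAt y₁ y₂ r) (hN : HasDerivAt N (N₁ / r) r)
    (hg : g = -(h : ℂ) ^ 2 * (y₂ + ((k : ℂ) + 2) / r * y₁ r + L / (r : ℂ) ^ 2)
      + ((V : ℂ) - (E + Complex.I * e)) * y r) :
    HasDerivAt (rayEnergy k h E lam m p Φ y y₁ N)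
      (r ^ (k + 2) * (Real.exp (2 * Φ r / h) *
        (bulk k h E lam V e r (r * m r) (m r + r * m₁) (p r) p₁ (y r)
          (rayDeriv k h (p r) r (y r) (y₁ r) / r) g (N r) -
        (r ^ 2)⁻¹ * (h ^ 2 * (2 * m r * rayCoeff k h (p r) r + lam) * (inner ℝ (y r) L + N r)
        + 2 * h ^ 2 * m r * (inner ℝ ((r : ℂ) * y₁ r) L + N₁ / 2))))) r := by
  have hid := energy_identity k hh hr E lam V e (m r) m₁ (p r) p₁ (N r) N₁ (y r) (y₁ r) y₂ g L hg
  have hb : HasDerivAt (fun r => rayCoeff k h (p r) r) ((p r + r * p₁) / h) r := by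
    have := (((hasDerivAt_id r).mul hp).div_const h).const_add (((k : ℝ) + 2) / 2)
    refine this.congr_deriv ?_
    simp
  have hZ : HasDerivAt (fun r => rayDeriv k h (p r) r (y r) (y₁ r))
      (y₁ r + r * y₂ + (((p r + r * p₁) / h : ℝ) : ℂ) * y r + (rayCoeff k h (p r) r : ℂ) * y₁ r)
      r := by
    have := ((hasDerivAt_id r).ofReal_comp.mul hy₁).add (hb.ofReal_comp.mul hy)
    refine this.congr_deriv ?_
    simp
    ring
  have hS : HasDerivAt (fun r => energyDensity k h E lam (m r) (p r) r (y r) (y₁ r) (N r)) _ r :=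
    (hm.mul (((((hZ.norm_sq).const_mul (h ^ 2)).add
      ((((((hp.pow 2).const_add E).mul (hasDerivAt_pow 2 r)).mul hy.norm_sq)))).sub
        (hN.const_mul (h ^ 2))).sub (hy.norm_sq.const_mul (h ^ 2 * (((k : ℝ) + 2) * k / 4))))).add
    ((((hy.inner ℝ hZ).const_mul (h ^ 2)).sub
      ((((hp.const_mul h).mul (hasDerivAt_id r)).mul hy.norm_sq))).const_mul lam)
  have hW := (((hasDerivAt_pow (k + 1) r).mul ((hΦ.const_mul 2).div_const h).exp).mul hS)
  refine hW.congr_deriv ?_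
  have e1 : ∀ K B : ℝ, B = r ^ 2 * K → r ^ (k + 2) * (Real.exp (2 * Φ r / h) * K) =
      r ^ k * Real.exp (2 * Φ r / h) * B := fun K B hB => by rw [hB]; ring
  rw [e1 _ ((((k : ℝ) + 1 + 2 * r * p r / h) *
      energyDensity k h E lam (m r) (p r) r (y r) (y₁ r) (N r)) + _) (by
    rw [hid]; field_simp)]
  simp only [Nat.cast_add, Nat.cast_one, add_tsub_cancel_right, Nat.cast_ofNat, id_eq,
    Nat.add_one_sub_one, pow_one, Pi.mul_apply, Pi.add_apply, Pi.pow_apply, Pi.sub_apply]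
  ring

theorem quadratic_form_nonneg {a b c : ℝ} (ha : 0 < a) (hb : b ^ 2 ≤ 4 * a * c) (x y : ℝ) :
    0 ≤ a * x ^ 2 - b * (x * y) + c * y ^ 2 := by
  have h1 : b ^ 2 * y ^ 2 ≤ 4 * a * c * y ^ 2 := mul_le_mul_of_nonneg_right hb (sq_nonneg y)
  have h2 : 0 ≤ (4 * a) * (a * x ^ 2 - b * (x * y) + c * y ^ 2) := by
    have h3 : (4 * a) * (a * x ^ 2 - b * (x * y) + c * y ^ 2) =
      (2 * a * x - b * y) ^ 2 + (4 * a * c * y ^ 2 - b ^ 2 * y ^ 2) := by ring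
    rw [h3]
    exact add_nonneg (sq_nonneg _) (sub_nonneg.mpr h1)
  exact nonneg_of_mul_nonneg_right h2 (by positivity)

/-- Lower bound for the bulk term, by completing squares. By `hkey` the mixed terms in `y` and `U`,
of size `μ β`, are absorbed with `w |y|²` to spare; `hcut` and `hcut'` say that the weight `G₁ + G₂`
of the right-hand side absorbs its products with `U` and `y`; `he` lets the lower order energy
control the imaginary part `e` of the spectral parameter. -/
theorem bulk_lower_bound (k : ℕ) {h E lam V e r μ μ₁ p p₁ β w G₁ G₂ N : ℝ} {y U g : ℂ}
    (hh : 0 < h) (hlam : 0 ≤ lam) (hr : 0 < r) (hμ : 0 ≤ μ) (hμ₁ : 0 < μ₁)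
    (hp : 0 ≤ p) (hN : 0 ≤ N) (hw : 0 < w)
    (hconv : r * μ₁ ≤ 2 * μ) (he : |e| * μ / h ≤ lam) (hβ : |p₁| + |V| / h ≤ β)
    (hkey : 2 * (μ * β) ^ 2 ≤ (μ₁ + 4 * p * μ / h) * (μ₁ * (E + p ^ 2) + 2 * μ * p * p₁ - w))
    (hcut : 2 * μ ^ 2 ≤ h ^ 2 * μ₁ * G₁) (hcut' : lam ^ 2 ≤ 2 * w * G₂) :
    w / 2 * ‖y‖ ^ 2 - (G₁ + G₂) * ‖g‖ ^ 2 - lam * (1 + E + p ^ 2 + |V|) * ‖y‖ ^ 2 ≤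
      bulk k h E lam V e r μ μ₁ p p₁ y U g N := by
  set X := h * ‖U‖ with hX
  set Y := ‖y‖ with hY
  set Gn := ‖g‖ with hGn
  set κ := μ₁ + 4 * p * μ / h with hκ
  set A := μ₁ * (E + p ^ 2) + 2 * μ * p * p₁ with hA
  have hX0 : 0 ≤ X := by positivity
  have hY0 : 0 ≤ Y := norm_nonneg _
  have hG0 : 0 ≤ Gn := norm_nonneg _
  have hpos : 0 ≤ 4 * p * μ / h := by positivity
  have hκμ : μ₁ ≤ κ := by rw [hκ]; linarith
  have hκ0 : 0 < κ := lt_of_lt_of_le hμ₁ hκμ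
  have hUX : ‖U‖ = X / h := by rw [hX]; field_simp
  have hN' : 0 ≤ N + (((k : ℝ) + 2) * k / 4) * Y ^ 2 := by positivity
  -- the four mixed terms
  have b1 : μ * inner ℝ g U ≤ μ * (Gn * (X / h)) := by
    rw [← hUX]; exact mul_le_mul_of_nonneg_left (real_inner_le_norm _ _) hμ
  have b2 : -(μ * β * (Y * X)) ≤ h * μ * p₁ * inner ℝ y U + μ * V * inner ℝ y U := by
    have h1 : |inner ℝ y U| ≤ Y * (X / h) := by rw [← hUX]; exact abs_real_inner_le_norm _ _
    have h2 : |(h * μ * p₁ + μ * V) * inner ℝ y U| ≤ μ * β * (Y * X) := by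
      rw [abs_mul]
      have h3 : |h * μ * p₁ + μ * V| ≤ h * (μ * β) := by
        have : h * μ * p₁ + μ * V = μ * (h * p₁ + V) := by ring
        rw [this, abs_mul, abs_of_nonneg hμ]
        have h4 : |h * p₁ + V| ≤ h * β := by
          refine (abs_add_le _ _).trans ?_
          rw [abs_mul, abs_of_pos hh]
          have : h * (|p₁| + |V| / h) ≤ h * β := mul_le_mul_of_nonneg_left hβ hh.le
          rw [mul_add, mul_div_cancel₀ _ hh.ne'] at this
          exact this
        calc μ * |h * p₁ + V| ≤ μ * (h * β) := mul_le_mul_of_nonneg_left h4 hμ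
          _ = h * (μ * β) := by ring
      have hβ0 : 0 ≤ β := le_trans (by positivity) hβ
      calc _ ≤ h * (μ * β) * (Y * (X / h)) := mul_le_mul h3 h1 (abs_nonneg _) (by positivity)
        _ = _ := by field_simp
    have := (abs_le.mp h2).1
    linarith [this]
  have b3 : -(lam * (X ^ 2 + Y ^ 2)) ≤ 2 * e * μ * inner ℝ y (Complex.I * U) := by
    have h1 : |inner ℝ y (Complex.I * U)| ≤ Y * (X / h) := by
      refine (abs_real_inner_le_norm _ _).trans ?_
      rw [norm_mul, Complex.norm_I, one_mul, hUX]
    have h2 : |2 * e * μ * inner ℝ y (Complex.I * U)| ≤ lam * (2 * X * Y) := by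
      rw [abs_mul, abs_mul, abs_mul, abs_of_nonneg hμ, abs_two]
      calc _ ≤ 2 * |e| * μ * (Y * (X / h)) := mul_le_mul_of_nonneg_left h1 (by positivity)
        _ = (|e| * μ / h) * (2 * X * Y) := by ring
        _ ≤ _ := mul_le_mul_of_nonneg_right he (by positivity)
    have h3 : lam * (2 * X * Y) ≤ lam * (X ^ 2 + Y ^ 2) :=
      mul_le_mul_of_nonneg_left (by nlinarith [sq_nonneg (X - Y)]) hlam
    have := (abs_le.mp h2).1
    linarith
  have b4 : lam * inner ℝ g y ≤ w / 2 * Y ^ 2 + G₂ * Gn ^ 2 := by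
    have h1 : lam * inner ℝ g y ≤ lam * (Gn * Y) :=
      mul_le_mul_of_nonneg_left (real_inner_le_norm _ _) hlam
    have h2 := quadratic_form_nonneg (a := w / 2) (b := lam) (c := G₂) (by positivity)
      (by linarith) Y Gn
    have h3 : lam * (Gn * Y) = lam * (Y * Gn) := by ring
    linarith
  -- completing the squares
  have c1 : 0 ≤ κ / 2 * X ^ 2 - 2 * (μ * β) * (X * Y) + (A - w) * Y ^ 2 :=
    quadratic_form_nonneg (by positivity) (by linarith) X Y
  have c2 : 0 ≤ μ₁ / 2 * X ^ 2 - 2 * μ / h * (X * Gn) + G₁ * Gn ^ 2 := by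
    refine quadratic_form_nonneg (by positivity) ?_ X Gn
    rw [div_pow, div_le_iff₀ (by positivity)]
    linarith
  have c3 : 0 ≤ (κ / 2 - μ₁ / 2) * X ^ 2 := mul_nonneg (by linarith) (by positivity)
  have c4 : 0 ≤ (2 * μ / r ^ 3 - μ₁ / r ^ 2) * h ^ 2 *
      (N + (((k : ℝ) + 2) * k / 4) * Y ^ 2) := by
    refine mul_nonneg (mul_nonneg ?_ (by positivity)) hN'
    have : 2 * μ / r ^ 3 - μ₁ / r ^ 2 = (2 * μ - r * μ₁) / r ^ 3 := by field_simp
    rw [this]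
    exact div_nonneg (by linarith) (by positivity)
  have c5 : 0 ≤ lam * (h ^ 2 / r ^ 2 * (N + (((k : ℝ) + 2) * k / 4) * Y ^ 2)) := by positivity
  have c6 : 0 ≤ lam * (V + |V|) * Y ^ 2 := by
    have := neg_abs_le V
    exact mul_nonneg (mul_nonneg hlam (by linarith)) (by positivity)
  have hX2 : h ^ 2 * ‖U‖ ^ 2 = X ^ 2 := by rw [hX]; ring
  simp only [bulk, hX2]
  rw [← hκ, ← hA, ← hY]
  have d1 : μ * β * (Y * X) = μ * β * (X * Y) := by ring
  have d2 : 2 * μ / h * (X * Gn) = 2 * (μ * (Gn * (X / h))) := by ring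
  rw [d1] at b2
  rw [d2] at c2
  linarith [b1, b2, b3, b4, c1, c2, c3, c4, c5, c6]

end Carleman

/-! ### Positivity of the bulk term -/

namespace Carleman

/-- The relations between the parameters under which the bulk term is positive up to the right-hand
side and the remainder; `e` is the imaginary part `± ε` of the spectral parameter, and `cV` bounds
the potential by `cV (|x| + 1)^{-δ}`. Of the conditions on the size of the potential and the phase,
`potential_le` and `phase_le` serve where `2 (|x| + 1) ≤ a + 1`, `potential_le_far` in the rest of
the ball of radius `a`, `phase_sq_le` in all of that ball, and `potential_le_outer` outside it. -/
structure Admissible (δ s E cV τ a h e : ℝ) : Prop where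
  s_gt : 1 / 2 < s
  δ_ge : 3 ≤ δ
  s_le : 2 * s ≤ δ
  E_pos : 0 < E
  cV_nonneg : 0 ≤ cV
  τ_ge : 1 ≤ τ
  a_ge : 1 ≤ a
  h_pos : 0 < h
  h_le : h ≤ 1
  potential_le : 2 * cV ^ 2 ≤ h * τ ^ 3
  phase_le : 2 * τ * h ≤ E
  phase_sq_le : 8 * τ ^ 2 ≤ E * a
  potential_le_far : 64 * cV ^ 2 ≤ E * h ^ 2 * a ^ 4
  potential_le_outer :
    4 * (3 + 1 / (2 * s - 1)) ^ 2 * cV ^ 2 * a ^ 4 * a ^ (4 * s - 2 * δ) ≤ E * h ^ 2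
  e_le : |e| ≤ h / a ^ 2

/-- The multiplier is bounded by `multBound s * a ^ 2`. -/
noncomputable def multBound (s : ℝ) : ℝ := 3 + 1 / (2 * s - 1)

/-- The coefficient of the lower order energy; it is chosen so as to bound `|e| / h` times the
multiplier. -/
noncomputable def lowerCoeff (s a h e : ℝ) : ℝ := |e| / h * (multBound s * a ^ 2)

/-- The constant in front of the square of the right-hand side. -/
noncomputable def sourceConst (s E : ℝ) : ℝ := 4 + 2 * multBound s ^ 2 + multBound s ^ 2 / E

/-- The constant in front of the remainder. -/
noncomputable def remainderConst (s E cV : ℝ) : ℝ := multBound s * (2 + E + cV)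

/-- The multiplier outside the ball of radius `a`: its derivative is `(r + 1)^{-2s}`, and its value
`a ^ 2 + 2 * a` at `r = a` is that of the inner multiplier `r (r + 2)`. -/
noncomputable def multOuter (s a r : ℝ) : ℝ :=
  a ^ 2 + 2 * a + ((a + 1) ^ (1 - 2 * s) - (r + 1) ^ (1 - 2 * s)) / (2 * s - 1)

/-- The phase derivative inside the ball of radius `a`. -/
noncomputable def slopeInner (τ a r : ℝ) : ℝ := τ * (r + 1)⁻¹ - τ * (a + 1)⁻¹

variable {δ s E cV τ a h e : ℝ}

theorem Admissible.multBound_ge (H : Admissible δ s E cV τ a h e) : 3 ≤ multBound s := by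
  have h1 : 0 < 2 * s - 1 := by linarith [H.s_gt]
  have : 0 < 1 / (2 * s - 1) := by positivity
  unfold multBound; linarith

theorem Admissible.lowerCoeff_nonneg (H : Admissible δ s E cV τ a h e) :
    0 ≤ lowerCoeff s a h e := by
  have := H.multBound_ge
  have := H.h_pos
  unfold lowerCoeff; positivity

theorem Admissible.lowerCoeff_le (H : Admissible δ s E cV τ a h e) :
    lowerCoeff s a h e ≤ multBound s := by
  have h1 := H.multBound_ge
  have h2 := H.h_pos
  have h3 := H.a_ge
  unfold lowerCoeff
  calc |e| / h * (multBound s * a ^ 2) ≤ (h / a ^ 2) / h * (multBound s * a ^ 2) := by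
        gcongr; exact H.e_le
    _ = multBound s := by field_simp

/-- Collecting the constants in the lower bound for the bulk term. -/
theorem Admissible.collect (H : Admissible δ s E cV τ a h e) {r p V x y G : ℝ} (hr : 0 ≤ r)
    (hp : p ^ 2 ≤ τ ^ 2) (hV : |V| ≤ cV * (r + 1) ^ (-δ)) (hG : G = (r + 1) ^ (2 * s))
    (w : ℝ) :
    w * y ^ 2 - sourceConst s E * (a ^ 4 / h ^ 2) * G * x ^ 2 -
        remainderConst s E cV * (|e| / h) * a ^ 2 * τ ^ 2 * y ^ 2 ≤
      w * y ^ 2 - ((4 + 2 * multBound s ^ 2) * (a ^ 4 / h ^ 2) * G + multBound s ^ 2 / E * G) *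
        x ^ 2 - lowerCoeff s a h e * (1 + E + p ^ 2 + |V|) * y ^ 2 := by
  have hM := H.multBound_ge
  have ha := H.a_ge
  have hh := H.h_pos
  have hE := H.E_pos
  have hlam := H.lowerCoeff_nonneg
  have hG0 : 0 ≤ G := by rw [hG]; positivity
  have h1 : 1 ≤ a ^ 4 / h ^ 2 := by
    rw [le_div_iff₀ (by positivity)]
    have : h ^ 2 ≤ 1 := pow_le_one₀ hh.le H.h_le
    have : 1 ≤ a ^ 4 := one_le_pow₀ ha
    linarith
  have h2 : multBound s ^ 2 / E * G * x ^ 2 ≤ (a ^ 4 / h ^ 2) * (multBound s ^ 2 / E * G * x ^ 2) :=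
    le_mul_of_one_le_left (by positivity) h1
  have hV1 : |V| ≤ cV := by
    refine hV.trans (mul_le_of_le_one_right H.cV_nonneg ?_)
    exact Real.rpow_le_one_of_one_le_of_nonpos (by linarith) (by linarith [H.δ_ge])
  have hτ : 1 ≤ τ ^ 2 := one_le_pow₀ H.τ_ge
  have h3 : 1 + E + p ^ 2 + |V| ≤ (2 + E + cV) * τ ^ 2 := by
    nlinarith [H.cV_nonneg]
  have h4 : lowerCoeff s a h e * (1 + E + p ^ 2 + |V|) * y ^ 2 ≤
      lowerCoeff s a h e * ((2 + E + cV) * τ ^ 2) * y ^ 2 := by gcongr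
  have h5 : lowerCoeff s a h e * ((2 + E + cV) * τ ^ 2) * y ^ 2 =
      remainderConst s E cV * (|e| / h) * a ^ 2 * τ ^ 2 * y ^ 2 := by
    unfold lowerCoeff remainderConst; ring
  unfold sourceConst
  rw [← h5]
  linarith [h2, h4]

/-- Positivity of the conjugated operator inside the ball of radius `a`. -/
theorem Admissible.positivity_inner (H : Admissible δ s E cV τ a h e) {ρ μ p w : ℝ} (hρ1 : 1 < ρ)
    (hρa : ρ ≤ a + 1) (hμρ : μ = ρ ^ 2 - 1) (hp' : p = τ * (ρ⁻¹ - (a + 1)⁻¹)) (hw : w ≤ E / 2) :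
    2 * (μ * (τ * (ρ ^ 2)⁻¹ + cV * (ρ ^ 3)⁻¹ / h)) ^ 2 ≤ (2 * ρ + 4 * p * μ / h) *
      (2 * ρ * (E + p ^ 2) + 2 * μ * p * -(τ * (ρ ^ 2)⁻¹) - w) := by
  have ha := H.a_ge
  have hh := H.h_pos
  have hE := H.E_pos
  have hτ := H.τ_ge
  have hcV := H.cV_nonneg
  have hρ0 : 0 < ρ := by linarith
  have hinv : (a + 1)⁻¹ ≤ ρ⁻¹ := inv_anti₀ hρ0 hρa
  have hp0 : 0 ≤ p := by
    rw [hp']; exact mul_nonneg (by linarith) (by linarith)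
  have hq0 : 0 < (a + 1)⁻¹ := by positivity
  have hpρ : p ≤ τ * ρ⁻¹ := by
    rw [hp']; exact mul_le_mul_of_nonneg_left (by linarith) (by linarith)
  have hμ0 : 0 < μ := by rw [hμρ]; linarith [one_lt_pow₀ hρ1 (n := 2) (by norm_num)]
  have hμle : μ ≤ ρ ^ 2 := by linarith
  have hA : E * ρ + 2 * p * τ * (ρ ^ 2)⁻¹ ≤
      2 * ρ * (E + p ^ 2) + 2 * μ * p * -(τ * (ρ ^ 2)⁻¹) - w := by
    have e1 : 2 * ρ * (E + p ^ 2) + 2 * μ * p * -(τ * (ρ ^ 2)⁻¹) =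
        2 * E * ρ + 2 * p * τ * (ρ ^ 2)⁻¹ - 2 * τ * (a + 1)⁻¹ * (p * ρ) := by
      have : ρ * p ^ 2 = p * (τ * (1 - ρ * (a + 1)⁻¹)) := by
        rw [show ρ * p ^ 2 = p * (ρ * p) by ring]
        congr 1
        rw [hp']; field_simp
      rw [mul_add, show 2 * ρ * p ^ 2 = 2 * (ρ * p ^ 2) by ring, this, hμρ]
      field_simp
      ring
    have e2 : p * ρ ≤ τ := by
      calc p * ρ ≤ τ * ρ⁻¹ * ρ := by gcongr
        _ = τ := by field_simp
    have e3 : 2 * τ * (a + 1)⁻¹ * (p * ρ) ≤ E / 2 := by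
      calc 2 * τ * (a + 1)⁻¹ * (p * ρ) ≤ 2 * τ * (a + 1)⁻¹ * τ := by gcongr
        _ ≤ 2 * τ * a⁻¹ * τ := by
          gcongr
          linarith
        _ = 2 * τ ^ 2 / a := by ring
        _ ≤ E / 2 := by
          rw [div_le_iff₀ (by positivity)]
          linarith [H.phase_sq_le, sq_nonneg τ]
    rw [e1]
    nlinarith
  have hβ2 : (τ * (ρ ^ 2)⁻¹ + cV * (ρ ^ 3)⁻¹ / h) ^ 2 ≤
      2 * (τ ^ 2 * (ρ ^ 4)⁻¹ + cV ^ 2 * (ρ ^ 6)⁻¹ / h ^ 2) := by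
    have : 2 * (τ ^ 2 * (ρ ^ 4)⁻¹ + cV ^ 2 * (ρ ^ 6)⁻¹ / h ^ 2) =
      2 * ((τ * (ρ ^ 2)⁻¹) ^ 2 + (cV * (ρ ^ 3)⁻¹ / h) ^ 2) := by field_simp
    rw [this]
    exact add_sq_le
  rcases le_total (2 * ρ) (a + 1) with hc | hc
  · -- here `φ' ≥ τ / (2 ρ)` and the first order term `4 φ' μ / h` dominates
    have hpl : τ * (2 * ρ)⁻¹ ≤ p := by
      rw [hp']
      refine mul_le_mul_of_nonneg_left ?_ (by linarith)
      have : (a + 1)⁻¹ ≤ (2 * ρ)⁻¹ := inv_anti₀ (by positivity) hc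
      have e : ρ⁻¹ = (2 * ρ)⁻¹ + (2 * ρ)⁻¹ := by field_simp; norm_num
      linarith
    have hκ : 2 * τ * μ / (h * ρ) ≤ 2 * ρ + 4 * p * μ / h := by
      have : 2 * τ * μ / (h * ρ) = 4 * (τ * (2 * ρ)⁻¹) * μ / h := by field_simp; norm_num
      rw [this]
      have : 4 * (τ * (2 * ρ)⁻¹) * μ / h ≤ 4 * p * μ / h := by gcongr
      linarith
    have hB : E * ρ + τ ^ 2 * (ρ ^ 3)⁻¹ ≤ E * ρ + 2 * p * τ * (ρ ^ 2)⁻¹ := by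
      have : τ ^ 2 * (ρ ^ 3)⁻¹ = 2 * (τ * (2 * ρ)⁻¹) * τ * (ρ ^ 2)⁻¹ := by field_simp
      rw [this]
      gcongr
    refine le_trans ?_ (mul_le_mul hκ (hB.trans hA) (by positivity) (by positivity))
    have h1 : 2 * (μ * (τ * (ρ ^ 2)⁻¹ + cV * (ρ ^ 3)⁻¹ / h)) ^ 2 ≤
        2 * (μ * ρ ^ 2) * (2 * (τ ^ 2 * (ρ ^ 4)⁻¹ + cV ^ 2 * (ρ ^ 6)⁻¹ / h ^ 2)) := by
      rw [mul_pow, ← mul_assoc, sq μ]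
      gcongr
    refine h1.trans ?_
    have e1 : 2 * (μ * ρ ^ 2) * (2 * (τ ^ 2 * (ρ ^ 4)⁻¹ + cV ^ 2 * (ρ ^ 6)⁻¹ / h ^ 2)) =
        2 * μ / (h ^ 2 * ρ ^ 4) * (2 * τ ^ 2 * h ^ 2 * ρ ^ 2 + 2 * cV ^ 2) := by field_simp
    have e2 : 2 * τ * μ / (h * ρ) * (E * ρ + τ ^ 2 * (ρ ^ 3)⁻¹) =
        2 * μ / (h ^ 2 * ρ ^ 4) * (h * τ * ρ ^ 2 * (E * ρ ^ 2) + h * τ ^ 3) := by field_simp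
    rw [e1, e2]
    refine mul_le_mul_of_nonneg_left (add_le_add ?_ H.potential_le) (by positivity)
    have : 2 * τ * h ≤ E * ρ ^ 2 := H.phase_le.trans
      (le_mul_of_one_le_right hE.le (one_le_pow₀ hρ1.le))
    calc 2 * τ ^ 2 * h ^ 2 * ρ ^ 2 = h * τ * ρ ^ 2 * (2 * τ * h) := by ring
      _ ≤ _ := by gcongr
  · -- here `ρ` is comparable with `a`
    have hρa2 : a / 2 ≤ ρ := by linarith
    have hκ : 2 * ρ ≤ 2 * ρ + 4 * p * μ / h := by
      have : 0 ≤ 4 * p * μ / h := by positivity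
      linarith
    have hB : E * ρ ≤ E * ρ + 2 * p * τ * (ρ ^ 2)⁻¹ := by
      have : 0 ≤ 2 * p * τ * (ρ ^ 2)⁻¹ := by positivity
      linarith
    refine le_trans ?_ (mul_le_mul hκ (hB.trans hA) (by positivity) (by positivity))
    have h1 : 2 * (μ * (τ * (ρ ^ 2)⁻¹ + cV * (ρ ^ 3)⁻¹ / h)) ^ 2 ≤
        2 * (ρ ^ 2) ^ 2 * (2 * (τ ^ 2 * (ρ ^ 4)⁻¹ + cV ^ 2 * (ρ ^ 6)⁻¹ / h ^ 2)) := by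
      rw [mul_pow, ← mul_assoc]
      gcongr
    refine h1.trans ?_
    have e1 : 2 * (ρ ^ 2) ^ 2 * (2 * (τ ^ 2 * (ρ ^ 4)⁻¹ + cV ^ 2 * (ρ ^ 6)⁻¹ / h ^ 2)) =
        4 * τ ^ 2 + 4 * cV ^ 2 / (ρ ^ 2 * h ^ 2) := by
      field_simp
      norm_num
    rw [e1]
    have h2 : 4 * τ ^ 2 ≤ E * ρ ^ 2 := by
      have h6 : ρ ≤ ρ ^ 2 := le_self_pow₀ hρ1.le (by norm_num)
      have h7 : E * a ≤ E * (2 * ρ ^ 2) := mul_le_mul_of_nonneg_left (by linarith) hE.le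
      linarith [H.phase_sq_le]
    have h3 : 4 * cV ^ 2 / (ρ ^ 2 * h ^ 2) ≤ E * ρ ^ 2 := by
      rw [div_le_iff₀ (by positivity)]
      have h4 : (a / 2) ^ 4 ≤ ρ ^ 4 := by gcongr
      have h5 : E * h ^ 2 * (a / 2) ^ 4 ≤ E * h ^ 2 * ρ ^ 4 :=
        mul_le_mul_of_nonneg_left h4 (by positivity)
      have h6 : E * h ^ 2 * (a / 2) ^ 4 = E * h ^ 2 * a ^ 4 / 16 := by ring
      have h7 : E * ρ ^ 2 * (ρ ^ 2 * h ^ 2) = E * h ^ 2 * ρ ^ 4 := by ring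
      linarith [H.potential_le_far]
    have h4 : 2 * ρ * (E * ρ) = E * ρ ^ 2 + E * ρ ^ 2 := by ring
    linarith

/-- The lower bound for the bulk term inside the ball of radius `a`, with multiplier
`r (r + 2) = (r + 1)² - 1`. -/
theorem Admissible.bulk_inner (H : Admissible δ s E cV τ a h e) (k : ℕ) {r V N : ℝ} {y U g : ℂ}
    (hr : 0 < r) (hra : r < a) (hN : 0 ≤ N) (hV : |V| ≤ cV * (r + 1) ^ (-δ)) :
    E / 4 * (r + 1) ^ (-(2 * s)) * ‖y‖ ^ 2 -
        sourceConst s E * (a ^ 4 / h ^ 2) * (r + 1) ^ (2 * s) * ‖g‖ ^ 2 -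
        remainderConst s E cV * (|e| / h) * a ^ 2 * τ ^ 2 * ‖y‖ ^ 2 ≤
      bulk k h E (lowerCoeff s a h e) V e r (r * (r + 2)) (r + 2 + r * 1) (slopeInner τ a r)
        (-(τ * ((r + 1) ^ 2)⁻¹)) y U g N := by
  -- the multiplier and the phase derivative are simplest in the variable `ρ = r + 1`
  obtain ⟨ρ, hρ⟩ : ∃ ρ, ρ = r + 1 := ⟨_, rfl⟩
  have hr' : r = ρ - 1 := by linarith
  have hM := H.multBound_ge
  have ha := H.a_ge
  have hh := H.h_pos
  have hE := H.E_pos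
  have hτ := H.τ_ge
  have hs := H.s_gt
  have hcV := H.cV_nonneg
  have hρ1 : 1 < ρ := by linarith
  have hρ0 : 0 < ρ := by linarith
  have hρa : ρ ≤ a + 1 := by linarith
  set p := slopeInner τ a r with hp
  have hp' : p = τ * (ρ⁻¹ - (a + 1)⁻¹) := by rw [hp, slopeInner, ← hρ]; ring
  have hinv : (a + 1)⁻¹ ≤ ρ⁻¹ := inv_anti₀ hρ0 hρa
  have hp0 : 0 ≤ p := by
    rw [hp']; exact mul_nonneg (by linarith) (by linarith)
  have hq0 : 0 < (a + 1)⁻¹ := by positivity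
  have hpρ : p ≤ τ * ρ⁻¹ := by
    rw [hp']; exact mul_le_mul_of_nonneg_left (by linarith) (by linarith)
  have hρinv1 : ρ⁻¹ ≤ 1 := inv_le_one_of_one_le₀ hρ1.le
  have hpτ : p ≤ τ := hpρ.trans (mul_le_of_le_one_right (by linarith) hρinv1)
  have hw1 : ρ ^ (-(2 * s)) ≤ 1 :=
    Real.rpow_le_one_of_one_le_of_nonpos hρ1.le (by linarith)
  have hw0 : 0 < ρ ^ (-(2 * s)) := by positivity
  have hG1 : ρ ≤ ρ ^ (2 * s) := by
    conv_lhs => rw [← Real.rpow_one ρ]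
    exact Real.rpow_le_rpow_of_exponent_le hρ1.le (by linarith)
  have hGw : ρ ^ (-(2 * s)) * ρ ^ (2 * s) = 1 := by
    rw [← Real.rpow_add hρ0]; simp
  have hVρ : |V| ≤ cV * (ρ ^ 3)⁻¹ := by
    refine hV.trans (mul_le_mul_of_nonneg_left ?_ hcV)
    rw [← hρ, ← Real.rpow_natCast, ← Real.rpow_neg hρ0.le]
    exact Real.rpow_le_rpow_of_exponent_le hρ1.le (by push_cast; linarith [H.δ_ge])
  set μ := r * (r + 2) with hμ
  have hμρ : μ = ρ ^ 2 - 1 := by rw [hμ, hr']; ring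
  have hμ0 : 0 < μ := by rw [hμ]; positivity
  have hμle : μ ≤ ρ ^ 2 := by linarith
  have hμa : μ ≤ multBound s * a ^ 2 := by
    have : μ ≤ 3 * a ^ 2 := by rw [hμ]; nlinarith
    refine this.trans (mul_le_mul_of_nonneg_right hM (by positivity))
  have hμ₁ : r + 2 + r * 1 = 2 * ρ := by rw [hr']; ring
  rw [hμ₁, ← hρ]
  refine (H.collect (r := r) (p := p) hr.le (by gcongr) hV (by rw [hρ]) _).trans ?_
  have hwE : E / 4 * ρ ^ (-(2 * s)) = (E / 2 * ρ ^ (-(2 * s))) / 2 := by ring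
  rw [hwE]
  refine bulk_lower_bound k (β := τ * (ρ ^ 2)⁻¹ + cV * (ρ ^ 3)⁻¹ / h) hh H.lowerCoeff_nonneg hr
    hμ0.le (by positivity) hp0 hN (by positivity) ?_ ?_ ?_ ?_ ?_ ?_
  · rw [hμ, hr']; nlinarith
  · unfold lowerCoeff
    calc |e| * μ / h = |e| / h * μ := by ring
      _ ≤ _ := by gcongr
  · gcongr
    rw [abs_neg, abs_of_nonneg (by positivity)]
  · exact H.positivity_inner hρ1 hρa hμρ hp' (mul_le_of_le_one_right (by positivity) hw1)
  · -- the weight in front of the source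
    have e1 : h ^ 2 * (2 * ρ) * ((4 + 2 * multBound s ^ 2) * (a ^ 4 / h ^ 2) * ρ ^ (2 * s)) =
        2 * ρ * (4 + 2 * multBound s ^ 2) * a ^ 4 * ρ ^ (2 * s) := by field_simp
    rw [e1]
    have h1 : ρ ^ 2 ≤ 4 * a ^ 4 := by
      have : a ^ 2 ≤ a ^ 4 := pow_le_pow_right₀ ha (by norm_num)
      nlinarith
    calc 2 * μ ^ 2 ≤ 2 * (ρ ^ 2) ^ 2 := by gcongr
      _ = 2 * ρ * (ρ ^ 2) * ρ := by ring
      _ ≤ 2 * ρ * (4 * a ^ 4) * ρ ^ (2 * s) := by gcongr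
      _ ≤ 2 * ρ * ((4 + 2 * multBound s ^ 2) * a ^ 4) * ρ ^ (2 * s) := by
        gcongr
        linarith [sq_nonneg (multBound s)]
      _ = _ := by ring
  · have e1 : 2 * (E / 2 * ρ ^ (-(2 * s))) * (multBound s ^ 2 / E * ρ ^ (2 * s)) =
        multBound s ^ 2 * (ρ ^ (-(2 * s)) * ρ ^ (2 * s)) := by field_simp
    rw [e1, hGw, mul_one]
    have := H.lowerCoeff_nonneg
    have := H.lowerCoeff_le
    gcongr

theorem Admissible.multOuter_bounds (H : Admissible δ s E cV τ a h e) {r : ℝ} (hr : a ≤ r) :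
    1 ≤ multOuter s a r ∧ multOuter s a r ≤ multBound s * a ^ 2 := by
  have ha := H.a_ge
  have hs : 0 < 2 * s - 1 := by linarith [H.s_gt]
  have h1 : (r + 1) ^ (1 - 2 * s) ≤ (a + 1) ^ (1 - 2 * s) :=
    Real.rpow_le_rpow_of_nonpos (by linarith) (by linarith) (by linarith)
  have h2 : (a + 1) ^ (1 - 2 * s) ≤ 1 :=
    Real.rpow_le_one_of_one_le_of_nonpos (by linarith) (by linarith)
  have h3 : 0 < (r + 1) ^ (1 - 2 * s) := Real.rpow_pos_of_pos (by linarith) _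
  have h4 : 0 ≤ ((a + 1) ^ (1 - 2 * s) - (r + 1) ^ (1 - 2 * s)) / (2 * s - 1) :=
    div_nonneg (by linarith) hs.le
  have h5 : ((a + 1) ^ (1 - 2 * s) - (r + 1) ^ (1 - 2 * s)) / (2 * s - 1) ≤ 1 / (2 * s - 1) :=
    div_le_div_of_nonneg_right (by linarith) hs.le
  have h6 : 1 / (2 * s - 1) ≤ 1 / (2 * s - 1) * a ^ 2 :=
    le_mul_of_one_le_right (by positivity) (one_le_pow₀ ha)
  unfold multOuter multBound
  constructor <;> nlinarith

theorem hasDerivAt_multOuter {r : ℝ} (hs : 1 / 2 < s) (hr : -1 < r) :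
    HasDerivAt (multOuter s a) ((r + 1) ^ (-(2 * s))) r := by
  have h1 : 2 * s - 1 ≠ 0 := by linarith
  have h2 := ((((hasDerivAt_id r).add_const 1).rpow_const (p := 1 - 2 * s)
    (Or.inl (by simp only [id_eq]; linarith))).const_sub ((a + 1) ^ (1 - 2 * s))).div_const
      (2 * s - 1) |>.const_add (a ^ 2 + 2 * a)
  refine h2.congr_deriv ?_
  have h3 : (1 - 2 * s - 1) = -(2 * s) := by ring
  simp only [id_eq, h3]
  rw [div_eq_iff h1]
  ring

/-- The lower bound for the bulk term outside the ball of radius `a`. There the phase is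
constant. -/
theorem Admissible.bulk_outer (H : Admissible δ s E cV τ a h e) (k : ℕ) {r V N : ℝ} {y U g : ℂ}
    (hra : a < r) (hN : 0 ≤ N) (hV : |V| ≤ cV * (r + 1) ^ (-δ)) :
    E / 4 * (r + 1) ^ (-(2 * s)) * ‖y‖ ^ 2 -
        sourceConst s E * (a ^ 4 / h ^ 2) * (r + 1) ^ (2 * s) * ‖g‖ ^ 2 -
        remainderConst s E cV * (|e| / h) * a ^ 2 * τ ^ 2 * ‖y‖ ^ 2 ≤
      bulk k h E (lowerCoeff s a h e) V e r (multOuter s a r) ((r + 1) ^ (-(2 * s))) 0 0 y U g N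
      := by
  obtain ⟨ρ, hρ⟩ : ∃ ρ, ρ = r + 1 := ⟨_, rfl⟩
  have hr' : r = ρ - 1 := by linarith
  have hM := H.multBound_ge
  have ha := H.a_ge
  have hh := H.h_pos
  have hE := H.E_pos
  have hs := H.s_gt
  have hcV := H.cV_nonneg
  have hr : 0 < r := by linarith
  have hρ1 : 1 < ρ := by linarith
  have hρ0 : 0 < ρ := by linarith
  have hρa : a ≤ ρ := by linarith
  obtain ⟨hμ1, hμa⟩ := H.multOuter_bounds hra.le
  set μ := multOuter s a r with hμ
  have hw0 : 0 < ρ ^ (-(2 * s)) := by positivity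
  have hGw : ρ ^ (-(2 * s)) * ρ ^ (2 * s) = 1 := by
    rw [← Real.rpow_add hρ0]; simp
  refine (H.collect (r := r) (p := 0) hr.le (by simp; positivity) hV rfl _).trans ?_
  rw [← hρ]
  have hwE : E / 4 * ρ ^ (-(2 * s)) = (E / 2 * ρ ^ (-(2 * s))) / 2 := by ring
  rw [hwE]
  have hV2 : |V| ≤ cV * ρ ^ (-δ) := by rw [hρ]; exact hV
  refine bulk_lower_bound k (β := cV * ρ ^ (-δ) / h) hh H.lowerCoeff_nonneg hr
    (by linarith) hw0 le_rfl hN (by positivity) ?_ ?_ ?_ ?_ ?_ ?_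
  · have h1 : ρ ^ (-(2 * s)) ≤ ρ ^ (-1 : ℝ) :=
      Real.rpow_le_rpow_of_exponent_le hρ1.le (by linarith)
    rw [Real.rpow_neg_one] at h1
    have h2 : r * ρ ^ (-(2 * s)) ≤ ρ * ρ⁻¹ := by
      apply mul_le_mul (by linarith) h1 hw0.le hρ0.le
    rw [mul_inv_cancel₀ hρ0.ne'] at h2
    linarith
  · unfold lowerCoeff
    calc |e| * μ / h = |e| / h * μ := by ring
      _ ≤ _ := by gcongr
  · rw [abs_zero, zero_add]
    gcongr
  · -- outside the ball the potential is a lower order perturbation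
    have e0 : (ρ ^ (-(2 * s)) + 4 * 0 * μ / h) *
        (ρ ^ (-(2 * s)) * (E + 0 ^ 2) + 2 * μ * 0 * 0 - E / 2 * ρ ^ (-(2 * s))) =
        E / 2 * (ρ ^ (-(2 * s))) ^ 2 := by ring
    rw [e0]
    have h1 : ρ ^ (4 * s - 2 * δ) ≤ a ^ (4 * s - 2 * δ) :=
      Real.rpow_le_rpow_of_nonpos (by linarith) hρa (by linarith [H.s_le])
    have h2 : (ρ ^ (-δ)) ^ 2 = ρ ^ (4 * s - 2 * δ) * (ρ ^ (-(2 * s))) ^ 2 := by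
      rw [← Real.rpow_natCast, ← Real.rpow_natCast, ← Real.rpow_mul hρ0.le, ← Real.rpow_mul hρ0.le,
        ← Real.rpow_add hρ0]
      congr 1
      push_cast
      ring
    have h3 : 4 * multBound s ^ 2 * cV ^ 2 * a ^ 4 * ρ ^ (4 * s - 2 * δ) ≤ E * h ^ 2 := by
      refine le_trans ?_ H.potential_le_outer
      unfold multBound
      gcongr
    calc 2 * (μ * (cV * ρ ^ (-δ) / h)) ^ 2
        ≤ 2 * (multBound s * a ^ 2 * (cV * ρ ^ (-δ) / h)) ^ 2 := by
          have : 0 ≤ μ := by linarith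
          gcongr
      _ = (4 * multBound s ^ 2 * cV ^ 2 * a ^ 4 * ρ ^ (4 * s - 2 * δ)) / (2 * h ^ 2) *
          (ρ ^ (-(2 * s))) ^ 2 := by
          rw [mul_pow, div_pow, mul_pow cV, h2]
          ring
      _ ≤ (E * h ^ 2) / (2 * h ^ 2) * (ρ ^ (-(2 * s))) ^ 2 := by gcongr
      _ = _ := by field_simp
  · have e1 : h ^ 2 * ρ ^ (-(2 * s)) *
        ((4 + 2 * multBound s ^ 2) * (a ^ 4 / h ^ 2) * ρ ^ (2 * s)) =
        (4 + 2 * multBound s ^ 2) * a ^ 4 * (ρ ^ (-(2 * s)) * ρ ^ (2 * s)) := by field_simp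
    rw [e1, hGw, mul_one]
    calc 2 * μ ^ 2 ≤ 2 * (multBound s * a ^ 2) ^ 2 := by
          have : 0 ≤ μ := by linarith
          gcongr
      _ = 2 * multBound s ^ 2 * a ^ 4 := by ring
      _ ≤ _ := by gcongr; linarith
  · have e1 : 2 * (E / 2 * ρ ^ (-(2 * s))) * (multBound s ^ 2 / E * ρ ^ (2 * s)) =
        multBound s ^ 2 * (ρ ^ (-(2 * s)) * ρ ^ (2 * s)) := by field_simp
    rw [e1, hGw, mul_one]
    have := H.lowerCoeff_nonneg
    have := H.lowerCoeff_le
    gcongr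

end Carleman

namespace Carleman

/-! ### The phase -/

/-- A continuous extension to `ℝ` of the derivative of the phase. -/
noncomputable def slope (τ a r : ℝ) : ℝ := slopeInner τ a (min (max r 0) a)

/-- The primitive of `slope`; it agrees with `phase` on `[0, ∞)`. -/
noncomputable def phaseExt (τ a r : ℝ) : ℝ := ∫ t in (0 : ℝ)..r, slope τ a t

variable {τ a : ℝ}

theorem continuous_slope (ha : 0 ≤ a) : Continuous (slope τ a) := by
  have h1 : Continuous fun r : ℝ => min (max r 0) a := by fun_prop
  have h2 : ∀ r : ℝ, min (max r 0) a + 1 ≠ 0 := fun r => by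
    have : 0 ≤ min (max r 0) a := le_min (le_max_right _ _) ha
    linarith
  exact ((continuous_const.mul ((h1.add continuous_const).inv₀ h2))).sub continuous_const

theorem slope_eq_phaseDeriv {r : ℝ} (hr : 0 ≤ r) : slope τ a r = phaseDeriv τ a r := by
  unfold slope phaseDeriv slopeInner
  rw [max_eq_left hr]
  split_ifs with h
  · rw [min_eq_left h]
  · rw [min_eq_right (not_le.mp h).le, sub_self]

theorem slope_of_mem {r : ℝ} (hr : 0 ≤ r) (hra : r ≤ a) :
    slope τ a r = slopeInner τ a r := by
  unfold slope
  rw [max_eq_left hr, min_eq_left hra]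

theorem slope_of_ge (ha : 0 ≤ a) {r : ℝ} (hra : a ≤ r) : slope τ a r = 0 := by
  unfold slope slopeInner
  rw [max_eq_left (ha.trans hra), min_eq_right hra, sub_self]

theorem phaseExt_eq_phase {r : ℝ} (hr : 0 ≤ r) : phaseExt τ a r = phase τ a r := by
  refine intervalIntegral.integral_congr fun t ht => ?_
  rw [Set.uIcc_of_le hr] at ht
  exact slope_eq_phaseDeriv ht.1

theorem hasDerivAt_phaseExt (ha : 0 ≤ a) (r : ℝ) :
    HasDerivAt (phaseExt τ a) (slope τ a r) r :=
  ((continuous_slope ha).integral_hasStrictDerivAt 0 r).hasDerivAt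

theorem continuous_phaseExt (ha : 0 ≤ a) : Continuous (phaseExt τ a) :=
  continuous_iff_continuousAt.mpr fun r => (hasDerivAt_phaseExt ha r).continuousAt

theorem slope_mem_Icc (ha : 0 ≤ a) (hτ : 0 ≤ τ) (r : ℝ) : slope τ a r ∈ Set.Icc 0 τ := by
  have h0 : 0 ≤ min (max r 0) a := le_min (le_max_right _ _) ha
  have h1 : (a + 1)⁻¹ ≤ (min (max r 0) a + 1)⁻¹ :=
    inv_anti₀ (by linarith) (by linarith [min_le_right (max r 0) a])
  have h2 : (min (max r 0) a + 1)⁻¹ ≤ 1 := inv_le_one_of_one_le₀ (by linarith)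
  have h3 : 0 < (a + 1)⁻¹ := by positivity
  unfold slope slopeInner
  constructor
  · have := mul_le_mul_of_nonneg_left h1 hτ
    linarith
  · have h4 := mul_le_mul_of_nonneg_left h2 hτ
    have : 0 ≤ τ * (a + 1)⁻¹ := by positivity
    linarith

theorem phaseExt_le (ha : 0 ≤ a) (hτ : 0 ≤ τ) {r : ℝ} (hr : 0 ≤ r) : phaseExt τ a r ≤ τ * a := by
  have hI : ∀ x y, IntervalIntegrable (slope τ a) volume x y :=
    fun x y => (continuous_slope ha).intervalIntegrable x y
  have key : ∀ r, 0 ≤ r → r ≤ a → phaseExt τ a r ≤ τ * a := fun r hr hra => by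
    have h1 : phaseExt τ a r ≤ ∫ t in (0 : ℝ)..r, τ :=
      intervalIntegral.integral_mono_on hr (hI _ _) (by simp) fun x _ => (slope_mem_Icc ha hτ x).2
    rw [intervalIntegral.integral_const, sub_zero, smul_eq_mul] at h1
    calc _ ≤ r * τ := h1
      _ ≤ a * τ := by gcongr
      _ = _ := mul_comm _ _
  rcases le_total r a with h | h
  · exact key r hr h
  · have h1 : ∫ t in a..r, slope τ a t = 0 := by
      rw [intervalIntegral.integral_congr (g := fun _ => 0)]
      · simp
      · intro t ht
        rw [Set.uIcc_of_le h] at ht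
        exact slope_of_ge ha ht.1
    have h2 : phaseExt τ a r = phaseExt τ a a := by
      unfold phaseExt
      rw [← intervalIntegral.integral_add_adjacent_intervals (hI 0 a) (hI a r), h1, add_zero]
    rw [h2]
    exact key a ha le_rfl

/-! ### The cutoff -/

/-- A piecewise linear cutoff, equal to `1` on `[0, a]` and to `0` on `[R, ∞)`. -/
noncomputable def cutoff (a R r : ℝ) : ℝ := max 0 (min 1 ((R - r) / (R - a)))

variable {R : ℝ}

theorem cutoff_mem_Icc (a R r : ℝ) : cutoff a R r ∈ Set.Icc (0 : ℝ) 1 :=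
  ⟨le_max_left _ _, max_le zero_le_one (min_le_left _ _)⟩

theorem continuous_cutoff (a R : ℝ) : Continuous (cutoff a R) := by
  unfold cutoff; fun_prop

theorem cutoff_of_le (hR : a < R) {r : ℝ} (hr : r ≤ a) : cutoff a R r = 1 := by
  have : 1 ≤ (R - r) / (R - a) := by rw [one_le_div (by linarith)]; linarith
  rw [cutoff, min_eq_left this, max_eq_right zero_le_one]

theorem cutoff_of_mem (hR : a < R) {r : ℝ} (hr : a ≤ r) (hrR : r ≤ R) :
    cutoff a R r = (R - r) / (R - a) := by
  have h1 : (R - r) / (R - a) ≤ 1 := by rw [div_le_one (by linarith)]; linarith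
  have h2 : 0 ≤ (R - r) / (R - a) := div_nonneg (by linarith) (by linarith)
  rw [cutoff, min_eq_right h1, max_eq_right h2]

theorem cutoff_of_ge (hR : a < R) {r : ℝ} (hr : R ≤ r) : cutoff a R r = 0 := by
  have h1 : (R - r) / (R - a) ≤ 0 := div_nonpos_of_nonpos_of_nonneg (by linarith) (by linarith)
  rw [cutoff, min_eq_right (h1.trans zero_le_one), max_eq_left h1]

end Carleman

namespace Carleman

/-! ### Monotonicity of the energy along rays -/

/-- The multiplier divided by `r`; the multiplier is `r (r + 2)` for `r ≤ a` and `multOuter` for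
`r > a`. -/
noncomputable def mult (s a r : ℝ) : ℝ := if r ≤ a then r + 2 else multOuter s a r / r

/-- The square `e^{2φ/h}` of the weight. -/
noncomputable def weightSq (τ a h r : ℝ) : ℝ := Real.exp (2 * phaseExt τ a r / h)

/-- The radial weight in front of `angDiv`. -/
noncomputable def angWeight (k : ℕ) (s τ a h e R r : ℝ) : ℝ :=
  cutoff a R r * weightSq τ a h r * ((r ^ 2)⁻¹ *
    (h ^ 2 * (2 * mult s a r * rayCoeff k h (slope τ a r) r + lowerCoeff s a h e)))

/-- The radial weight in front of `angDivEuler`. -/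
noncomputable def angWeightEuler (s τ a h R r : ℝ) : ℝ :=
  cutoff a R r * weightSq τ a h r * ((r ^ 2)⁻¹ * (2 * h ^ 2 * mult s a r))

/-- The operator `-h² Δ + V - (E + i e)` applied to a `C²` function. -/
noncomputable def schrodingerC2 {n : ℕ} (h E e : ℝ) (V : Space n → ℝ) (f : Space n → ℂ)
    (x : Space n) : ℂ :=
  -(h : ℂ) ^ 2 * hessTrace f x + ((V x : ℂ) - (E + Complex.I * e)) * f x

/-- The lower bound for the bulk term. -/
noncomputable def bulkBound {n : ℕ} (s E cV τ a h e : ℝ) (V : Space n → ℝ) (f : Space n → ℂ)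
    (x : Space n) : ℝ :=
  E / 4 * (‖x‖ + 1) ^ (-(2 * s)) * ‖f x‖ ^ 2 -
    sourceConst s E * (a ^ 4 / h ^ 2) * (‖x‖ + 1) ^ (2 * s) * ‖schrodingerC2 h E e V f x‖ ^ 2 -
    remainderConst s E cV * (|e| / h) * a ^ 2 * τ ^ 2 * ‖f x‖ ^ 2

/-- The constant in the error caused by the cutoff. -/
noncomputable def cutoffConst (k : ℕ) (s E a : ℝ) : ℝ :=
  multBound s * a ^ 2 * (3 + ((k : ℝ) + 2) ^ 2 / 2 + E + 1 + ((k : ℝ) + 2) / 2)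

/-- The density of the error caused by the cutoff. -/
noncomputable def cutoffError (k : ℕ) (s E τ a h R : ℝ) (f : Space (k + 3) → ℂ)
    (x : Space (k + 3)) : ℝ :=
  (Set.Ioc a R).indicator (fun r => (R - a)⁻¹ * (cutoffConst k s E a * weightSq τ a h r)) ‖x‖ *
    (gradSq f x + ‖f x‖ ^ 2)

/-- The integrand whose integral is shown to be nonpositive: along each ray, its product with
`r ^ (n - 1)` is at most the derivative of the cut off energy. -/
noncomputable def lowerBound (k : ℕ) (s E cV τ a h e R : ℝ) (V : Space (k + 3) → ℝ)
    (f : Space (k + 3) → ℂ) (x : Space (k + 3)) : ℝ :=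
  cutoff a R ‖x‖ * weightSq τ a h ‖x‖ * bulkBound s E cV τ a h e V f x
    - angWeight k s τ a h e R ‖x‖ * angDiv f x - angWeightEuler s τ a h R ‖x‖ * angDivEuler f x
    - cutoffError k s E τ a h R f x

/-- The energy of a function on `ℝ^{k + 3}` along the ray through `ω`. -/
noncomputable def energyOnRay (k : ℕ) (s E τ a h e : ℝ) (f : Space (k + 3) → ℂ)
    (ω : Space (k + 3)) : ℝ → ℝ :=
  rayEnergy k h E (lowerCoeff s a h e) (mult s a) (slope τ a) (phaseExt τ a)
    (fun r => f (r • ω)) (fun r => fderiv ℝ f (r • ω) ω) (fun r => angGradSq f (r • ω))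

variable {δ s E cV τ a h e R : ℝ} {k : ℕ} {V : Space (k + 3) → ℝ} {f : Space (k + 3) → ℂ}
  {ω : Space (k + 3)}

theorem hasDerivAt_energyOnRay (hf : ContDiff ℝ 2 f) (hω : ‖ω‖ = 1) (ha : 0 ≤ a) (hh : h ≠ 0)
    {r m₁ p₁ : ℝ} (hr : 0 < r) (hm : HasDerivAt (mult s a) m₁ r)
    (hp : HasDerivAt (slope τ a) p₁ r) :
    HasDerivAt (energyOnRay k s E τ a h e f ω) (r ^ (k + 2) * (weightSq τ a h r *
        (bulk k h E (lowerCoeff s a h e) (V (r • ω)) e r (r * mult s a r) (mult s a r + r * m₁)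
          (slope τ a r) p₁ (f (r • ω))
          (rayDeriv k h (slope τ a r) r (f (r • ω)) (fderiv ℝ f (r • ω) ω) / r)
          (schrodingerC2 h E e V f (r • ω)) (angGradSq f (r • ω)) -
        (r ^ 2)⁻¹ * (h ^ 2 * (2 * mult s a r * rayCoeff k h (slope τ a r) r + lowerCoeff s a h e)
          * angDiv f (r • ω) + 2 * h ^ 2 * mult s a r * angDivEuler f (r • ω))))) r := by
  have hxr : ‖r • ω‖ = r := by rw [norm_smul, hω, mul_one, Real.norm_of_nonneg hr.le]
  have e1 : fderiv ℝ f (r • ω) (r • ω) = (r : ℂ) * fderiv ℝ f (r • ω) ω := by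
    rw [map_smul, Complex.real_smul]
  have e2 : hess f (r • ω) (r • ω) (r • ω) = (r : ℂ) ^ 2 * hess f (r • ω) ω ω := by
    simp only [hess, map_smul, smul_apply, Complex.real_smul]
    ring
  have hrC : (r : ℂ) ≠ 0 := by exact_mod_cast hr.ne'
  refine (hasDerivAt_rayEnergy k hh hr.ne' E (lowerCoeff s a h e) (V (r • ω)) e
    (L := angLaplacian f (r • ω)) (g := schrodingerC2 h E e V f (r • ω)) hm hp
    (hasDerivAt_phaseExt ha r) (hasDerivAt_ray hf ω r) (hasDerivAt_fderiv_ray hf ω ω r)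
    (hasDerivAt_angGradSq_ray hf hω r) ?_).congr_deriv ?_
  · rw [schrodingerC2, angLaplacian, e1, e2, hxr]
    congr 2
    push_cast
    field_simp
    ring
  · rw [angDiv, angDivEuler, e1, weightSq]

theorem mult_of_le {r : ℝ} (hr : r ≤ a) : mult s a r = r + 2 := if_pos hr

theorem mult_of_ge (ha : 0 < a) {r : ℝ} (hr : a ≤ r) : mult s a r = multOuter s a r / r := by
  rcases hr.eq_or_lt with rfl | h
  · rw [mult, if_pos le_rfl, multOuter]
    simp only [sub_self, zero_div, add_zero]
    field_simp
  · exact if_neg (not_le.mpr h)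

theorem fderiv_ray_sq_le (hω : ‖ω‖ = 1) {r : ℝ} (hr : 0 < r) :
    ‖fderiv ℝ f (r • ω) ω‖ ^ 2 ≤ gradSq f (r • ω) := by
  have h1 := angGradSq_nonneg f (r • ω)
  have e1 : ‖fderiv ℝ f (r • ω) (r • ω)‖ ^ 2 = r ^ 2 * ‖fderiv ℝ f (r • ω) ω‖ ^ 2 := by
    rw [map_smul, norm_smul, mul_pow, Real.norm_of_nonneg hr.le]
  have hxr : ‖r • ω‖ = r := by rw [norm_smul, hω, mul_one, Real.norm_of_nonneg hr.le]
  rw [angGradSq, e1, hxr, ← mul_sub] at h1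
  linarith [nonneg_of_mul_nonneg_right h1 (by positivity)]

/-- The differential inequality for the energy inside the ball of radius `a`. -/
theorem Admissible.lowerBound_inner (H : Admissible δ s E cV τ a h e) (hf : ContDiff ℝ 2 f)
    (hω : ‖ω‖ = 1) (hR : a < R) (hV : ∀ x, |V x| ≤ cV * (‖x‖ + 1) ^ (-δ)) {r : ℝ} (hr : 0 < r)
    (hra : r < a) : ∃ W', HasDerivAt (energyOnRay k s E τ a h e f ω) W' r ∧
      r ^ (k + 2) * lowerBound k s E cV τ a h e R V f (r • ω) ≤ W' := by
  have ha := H.a_ge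
  have hxr : ‖r • ω‖ = r := by rw [norm_smul, hω, mul_one, Real.norm_of_nonneg hr.le]
  have hm : HasDerivAt (mult s a) 1 r := by
    refine ((hasDerivAt_id r).add_const 2).congr_of_eventuallyEq ?_
    filter_upwards [Iio_mem_nhds hra] with x hx
    exact mult_of_le (le_of_lt hx)
  have hp : HasDerivAt (slope τ a) (-(τ * ((r + 1) ^ 2)⁻¹)) r := by
    have h1 : HasDerivAt (slopeInner τ a) (-(τ * ((r + 1) ^ 2)⁻¹)) r := by
      have := ((((hasDerivAt_id r).add_const 1).inv (by simp only [id_eq]; linarith)).const_mul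
        τ).sub_const (τ * (a + 1)⁻¹)
      refine this.congr_deriv ?_
      simp only [id_eq]
      ring
    refine h1.congr_of_eventuallyEq ?_
    filter_upwards [Ioo_mem_nhds hr hra] with x hx
    exact slope_of_mem hx.1.le hx.2.le
  refine ⟨_, hasDerivAt_energyOnRay (V := V) hf hω (by linarith) H.h_pos.ne' hr hm hp, ?_⟩
  have hb := H.bulk_inner k (y := f (r • ω))
    (U := rayDeriv k h (slope τ a r) r (f (r • ω)) (fderiv ℝ f (r • ω) ω) / r)
    (g := schrodingerC2 h E e V f (r • ω)) hr hra (angGradSq_nonneg f (r • ω))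
    (by have := hV (r • ω); rwa [hxr] at this)
  rw [← slope_of_mem hr.le hra.le] at hb
  have hcut : cutoff a R r = 1 := cutoff_of_le hR hra.le
  have herr : cutoffError k s E τ a h R f (r • ω) = 0 := by
    rw [cutoffError, hxr, Set.indicator_of_notMem (fun hx => absurd hx.1 (not_lt.mpr hra.le)),
      zero_mul]
  rw [lowerBound, herr, angWeight, angWeightEuler, bulkBound, hxr, hcut, mult_of_le hra.le]
  refine mul_le_mul_of_nonneg_left ?_ (by positivity)
  have hψ : 0 ≤ weightSq τ a h r := (Real.exp_pos _).le
  have := mul_le_mul_of_nonneg_left hb hψ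
  linarith

/-- An upper bound for the energy outside the ball of radius `a`, which controls the term with the
derivative of the cutoff. -/
theorem Admissible.energyOnRay_le (H : Admissible δ s E cV τ a h e) (hω : ‖ω‖ = 1) {r : ℝ}
    (hra : a ≤ r) : energyOnRay k s E τ a h e f ω r ≤
      r ^ (k + 2) * (cutoffConst k s E a * weightSq τ a h r *
        (gradSq f (r • ω) + ‖f (r • ω)‖ ^ 2)) := by
  have ha := H.a_ge
  have hr : 0 < r := by linarith
  have hr1 : 1 ≤ r := by linarith
  have hh := H.h_pos
  have hE := H.E_pos
  have hM := H.multBound_ge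
  obtain ⟨hμ1, hμa⟩ := H.multOuter_bounds hra
  have hψ : 0 ≤ weightSq τ a h r := (Real.exp_pos _).le
  have hgrad := fderiv_ray_sq_le (f := f) hω hr
  have hN := angGradSq_nonneg f (r • ω)
  have hlam := H.lowerCoeff_nonneg
  have hlamM : lowerCoeff s a h e ≤ multBound s * a ^ 2 :=
    H.lowerCoeff_le.trans (le_mul_of_one_le_right (by linarith) (one_le_pow₀ ha))
  have hh2 : h ^ 2 ≤ 1 := pow_le_one₀ hh.le H.h_le
  set y := f (r • ω) with hy
  set y₁ := fderiv ℝ f (r • ω) ω with hy₁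
  set N := angGradSq f (r • ω) with hNdef
  set Q := gradSq f (r • ω) with hQ
  set M := multBound s * a ^ 2 with hMdef
  set μ := multOuter s a r with hμ
  set lam := lowerCoeff s a h e with hlamdef
  obtain ⟨b, hb⟩ : ∃ b : ℝ, b = ((k : ℝ) + 2) / 2 := ⟨_, rfl⟩
  have hb0 : 0 ≤ b := by rw [hb]; positivity
  have hM0 : 0 ≤ M := by positivity
  have hZ : ‖rayDeriv k h 0 r y y₁‖ ≤ r * (‖y₁‖ + b * ‖y‖) := by
    have : rayDeriv k h 0 r y y₁ = (r : ℂ) * y₁ + (b : ℂ) * y := by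
      rw [rayDeriv, rayCoeff, hb]; simp
    rw [this]
    refine (norm_add_le _ _).trans ?_
    rw [norm_mul, norm_mul, Complex.norm_real, Complex.norm_real, Real.norm_of_nonneg hr.le,
      Real.norm_of_nonneg hb0]
    have : b * ‖y‖ ≤ r * (b * ‖y‖) := le_mul_of_one_le_left (by positivity) hr1
    linarith
  have hZ2 : ‖rayDeriv k h 0 r y y₁‖ ^ 2 ≤ r ^ 2 * (2 * (Q + b ^ 2 * ‖y‖ ^ 2)) := by
    calc ‖rayDeriv k h 0 r y y₁‖ ^ 2 ≤ (r * (‖y₁‖ + b * ‖y‖)) ^ 2 := by gcongr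
      _ = r ^ 2 * (‖y₁‖ + b * ‖y‖) ^ 2 := by ring
      _ ≤ r ^ 2 * (2 * (‖y₁‖ ^ 2 + (b * ‖y‖) ^ 2)) := by gcongr; exact add_sq_le
      _ ≤ _ := by rw [mul_pow]; gcongr
  have hin : inner ℝ y (rayDeriv k h 0 r y y₁) ≤ r * (Q + (1 + b) * ‖y‖ ^ 2) := by
    refine (real_inner_le_norm _ _).trans ?_
    calc ‖y‖ * ‖rayDeriv k h 0 r y y₁‖ ≤ ‖y‖ * (r * (‖y₁‖ + b * ‖y‖)) := by gcongr
      _ = r * (‖y‖ * ‖y₁‖ + b * ‖y‖ ^ 2) := by ring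
      _ ≤ r * (Q + (1 + b) * ‖y‖ ^ 2) := by
        refine mul_le_mul_of_nonneg_left ?_ hr.le
        linarith [sq_nonneg (‖y‖ - ‖y₁‖), sub_sq ‖y‖ ‖y₁‖, sq_nonneg ‖y‖, sq_nonneg ‖y₁‖]
  have hQ0 : 0 ≤ Q := le_trans (by positivity) hgrad
  have hden : energyDensity k h E lam (μ / r) 0 r y y₁ N ≤
      r * (M * (3 + 2 * b ^ 2 + E + 1 + b) * (Q + ‖y‖ ^ 2)) := by
    rw [energyDensity]
    have t1 : μ / r * (h ^ 2 * ‖rayDeriv k h 0 r y y₁‖ ^ 2 + (E + 0 ^ 2) * r ^ 2 * ‖y‖ ^ 2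
        - h ^ 2 * N - h ^ 2 * (((k : ℝ) + 2) * k / 4) * ‖y‖ ^ 2) ≤
        M / r * (r ^ 2 * (2 * (Q + b ^ 2 * ‖y‖ ^ 2)) + E * r ^ 2 * ‖y‖ ^ 2) := by
      calc _ ≤ μ / r * (r ^ 2 * (2 * (Q + b ^ 2 * ‖y‖ ^ 2)) + E * r ^ 2 * ‖y‖ ^ 2) := by
            refine mul_le_mul_of_nonneg_left ?_ (by positivity)
            have q1 : h ^ 2 * ‖rayDeriv k h 0 r y y₁‖ ^ 2 ≤
                1 * (r ^ 2 * (2 * (Q + b ^ 2 * ‖y‖ ^ 2))) := by gcongr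
            have q2 : 0 ≤ h ^ 2 * N := by positivity
            have q3 : 0 ≤ h ^ 2 * (((k : ℝ) + 2) * k / 4) * ‖y‖ ^ 2 := by positivity
            linarith
        _ ≤ _ := by gcongr
    have t2 : lam * (h ^ 2 * inner ℝ y (rayDeriv k h 0 r y y₁) - h * 0 * r * ‖y‖ ^ 2) ≤
        M * (r * (Q + (1 + b) * ‖y‖ ^ 2)) := by
      calc _ = lam * h ^ 2 * inner ℝ y (rayDeriv k h 0 r y y₁) := by ring
        _ ≤ lam * h ^ 2 * (r * (Q + (1 + b) * ‖y‖ ^ 2)) :=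
            mul_le_mul_of_nonneg_left hin (by positivity)
        _ ≤ M * 1 * (r * (Q + (1 + b) * ‖y‖ ^ 2)) := by gcongr
        _ = _ := by ring
    refine (add_le_add t1 t2).trans ?_
    have t3 : M / r * (r ^ 2 * (2 * (Q + b ^ 2 * ‖y‖ ^ 2)) + E * r ^ 2 * ‖y‖ ^ 2) =
        M * (r * ((2 * (Q + b ^ 2 * ‖y‖ ^ 2)) + E * ‖y‖ ^ 2)) := by field_simp
    rw [t3]
    have t4 : r * (M * (3 + 2 * b ^ 2 + E + 1 + b) * (Q + ‖y‖ ^ 2)) -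
        (M * (r * ((2 * (Q + b ^ 2 * ‖y‖ ^ 2)) + E * ‖y‖ ^ 2)) +
          M * (r * (Q + (1 + b) * ‖y‖ ^ 2))) =
        r * M * ((2 * b ^ 2 + E + 1 + b) * Q + 3 * ‖y‖ ^ 2) := by ring
    have t5 : 0 ≤ r * M * ((2 * b ^ 2 + E + 1 + b) * Q + 3 * ‖y‖ ^ 2) := by positivity
    linarith
  have hC : cutoffConst k s E a = M * (3 + 2 * b ^ 2 + E + 1 + b) := by
    rw [cutoffConst, hb]; ring
  rw [energyOnRay, rayEnergy, slope_of_ge (by linarith) hra, mult_of_ge (by linarith) hra, hC]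
  calc _ ≤ r ^ (k + 1) * weightSq τ a h r *
        (r * (M * (3 + 2 * b ^ 2 + E + 1 + b) * (Q + ‖y‖ ^ 2))) :=
        mul_le_mul_of_nonneg_left hden (by positivity)
    _ = _ := by ring

/-- The differential inequality for the cut off energy outside the ball of radius `a`. -/
theorem Admissible.lowerBound_outer (H : Admissible δ s E cV τ a h e) (hf : ContDiff ℝ 2 f)
    (hω : ‖ω‖ = 1) (hV : ∀ x, |V x| ≤ cV * (‖x‖ + 1) ^ (-δ)) {r : ℝ}
    (hra : a < r) (hrR : r < R) :
    ∃ W', HasDerivAt (fun r => (R - r) / (R - a) * energyOnRay k s E τ a h e f ω r) W' r ∧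
      r ^ (k + 2) * lowerBound k s E cV τ a h e R V f (r • ω) ≤ W' := by
  have ha := H.a_ge
  have hr : 0 < r := by linarith
  have hR : a < R := hra.trans hrR
  have hxr : ‖r • ω‖ = r := by rw [norm_smul, hω, mul_one, Real.norm_of_nonneg hr.le]
  have hm : HasDerivAt (mult s a) (((r + 1) ^ (-(2 * s)) * r - multOuter s a r * 1) / r ^ 2) r := by
    refine ((hasDerivAt_multOuter H.s_gt (by linarith)).div (hasDerivAt_id r)
      hr.ne').congr_of_eventuallyEq ?_
    filter_upwards [Ioi_mem_nhds hra] with x hx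
    exact mult_of_ge (by linarith) (le_of_lt hx)
  have hp : HasDerivAt (slope τ a) 0 r := by
    refine (hasDerivAt_const r (0 : ℝ)).congr_of_eventuallyEq ?_
    filter_upwards [Ioi_mem_nhds hra] with x hx
    exact slope_of_ge (by linarith) (le_of_lt hx)
  have hW := hasDerivAt_energyOnRay (V := V) (E := E) (e := e) hf hω (by linarith) H.h_pos.ne'
    hr hm hp
  have hc : HasDerivAt (fun r => (R - r) / (R - a)) (-1 / (R - a)) r :=
    ((hasDerivAt_id r).const_sub R).div_const _
  refine ⟨_, hc.mul hW, ?_⟩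
  have hmr : mult s a r = multOuter s a r / r := mult_of_ge (by linarith) hra.le
  have hsl : slope τ a r = 0 := slope_of_ge (by linarith) hra.le
  have e1 : r * mult s a r = multOuter s a r := by rw [hmr]; field_simp
  have e2 : mult s a r + r * (((r + 1) ^ (-(2 * s)) * r - multOuter s a r * 1) / r ^ 2) =
      (r + 1) ^ (-(2 * s)) := by rw [hmr]; field_simp; ring
  have hb := H.bulk_outer k (y := f (r • ω))
    (U := rayDeriv k h (slope τ a r) r (f (r • ω)) (fderiv ℝ f (r • ω) ω) / r)
    (g := schrodingerC2 h E e V f (r • ω)) hra (angGradSq_nonneg f (r • ω))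
    (by have := hV (r • ω); rwa [hxr] at this)
  have hcut : cutoff a R r = (R - r) / (R - a) := cutoff_of_mem hR hra.le hrR.le
  have herr : cutoffError k s E τ a h R f (r • ω) = (R - a)⁻¹ *
      (cutoffConst k s E a * weightSq τ a h r) * (gradSq f (r • ω) + ‖f (r • ω)‖ ^ 2) := by
    rw [cutoffError, hxr, Set.indicator_of_mem (show r ∈ Set.Ioc a R from ⟨hra, hrR.le⟩)]
  have hWle := H.energyOnRay_le (f := f) hω hra.le
  have hRinv : 0 ≤ (R - a)⁻¹ := inv_nonneg.mpr (by linarith)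
  have hWle' := mul_le_mul_of_nonneg_left hWle hRinv
  rw [hsl] at hb
  rw [lowerBound, herr, angWeight, angWeightEuler, bulkBound, hxr, hcut, e1, e2, hsl]
  have hψ : 0 ≤ weightSq τ a h r := (Real.exp_pos _).le
  have hχ : 0 ≤ (R - r) / (R - a) := div_nonneg (by linarith) (by linarith)
  have hr2 : 0 ≤ r ^ (k + 2) := by positivity
  have := mul_le_mul_of_nonneg_left hb (mul_nonneg hr2 (mul_nonneg hχ hψ))
  rw [neg_div, one_div]
  linarith

end Carleman

/-! ### Integration along rays -/

namespace Carleman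

variable {δ s E cV τ a h e R : ℝ} {k : ℕ} {V : Space (k + 3) → ℝ} {f : Space (k + 3) → ℂ}
  {ω : Space (k + 3)}

theorem continuousOn_mult (hs : 1 / 2 < s) (ha : 0 < a) :
    ContinuousOn (mult s a) (Set.Ici 0) := by
  have h1 : ContinuousOn (mult s a) (Set.Icc 0 a) :=
    ContinuousOn.congr (f := fun r => r + 2) (by fun_prop) fun r hr => mult_of_le hr.2
  have h2 : ContinuousOn (mult s a) (Set.Ici a) := by
    refine ContinuousOn.congr (f := fun r => multOuter s a r / r) ?_ fun r hr => mult_of_ge ha hr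
    refine ContinuousOn.div (fun r hr => ?_) continuousOn_id fun r hr => (ha.trans_le hr).ne'
    have hr' : a ≤ r := hr
    exact (hasDerivAt_multOuter hs (by linarith)).continuousAt.continuousWithinAt
  have h3 := h1.union_of_isClosed h2 isClosed_Icc isClosed_Ici
  rwa [Set.Icc_union_Ici_eq_Ici ha.le] at h3

theorem continuous_weightSq (ha : 0 ≤ a) : Continuous (weightSq τ a h) :=
  ((continuous_const.mul (continuous_phaseExt ha)).div_const h).rexp

theorem continuous_rayCoeff (ha : 0 ≤ a) :
    Continuous fun r => rayCoeff k h (slope τ a r) r :=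
  continuous_const.add ((continuous_id.mul (continuous_slope ha)).div_const h)

theorem continuousOn_energyOnRay (hf : ContDiff ℝ 2 f) (hω : ‖ω‖ = 1) (hs : 1 / 2 < s)
    (ha : 0 < a) : ContinuousOn (energyOnRay k s E τ a h e f ω) (Set.Ici 0) := by
  have hm := continuousOn_mult hs ha
  have hsl := continuous_slope (τ := τ) ha.le
  have hy : Continuous fun r : ℝ => f (r • ω) :=
    continuous_iff_continuousAt.mpr fun r => (hasDerivAt_ray hf ω r).continuousAt
  have hy₁ : Continuous fun r : ℝ => fderiv ℝ f (r • ω) ω :=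
    continuous_iff_continuousAt.mpr fun r => (hasDerivAt_fderiv_ray hf ω ω r).continuousAt
  have hN : Continuous fun r : ℝ => angGradSq f (r • ω) :=
    continuous_iff_continuousAt.mpr fun r => (hasDerivAt_angGradSq_ray hf hω r).continuousAt
  have hZ : Continuous fun r : ℝ =>
      rayDeriv k h (slope τ a r) r (f (r • ω)) (fderiv ℝ f (r • ω) ω) :=
    (Complex.continuous_ofReal.mul hy₁).add
      ((Complex.continuous_ofReal.comp (continuous_rayCoeff ha.le)).mul hy)
  have hψ := continuous_weightSq (τ := τ) (h := h) ha.le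
  have hin : Continuous fun r : ℝ => (inner ℝ (f (r • ω))
      (rayDeriv k h (slope τ a r) r (f (r • ω)) (fderiv ℝ f (r • ω) ω)) : ℝ) := hy.inner hZ
  have h1 : Continuous fun r : ℝ => r ^ (k + 1) * weightSq τ a h r := by fun_prop
  refine h1.continuousOn.mul ?_
  have h2 : Continuous fun r : ℝ =>
    h ^ 2 * ‖rayDeriv k h (slope τ a r) r (f (r • ω)) (fderiv ℝ f (r • ω) ω)‖ ^ 2 +
      (E + slope τ a r ^ 2) * r ^ 2 * ‖f (r • ω)‖ ^ 2 - h ^ 2 * angGradSq f (r • ω)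
      - h ^ 2 * (((k : ℝ) + 2) * k / 4) * ‖f (r • ω)‖ ^ 2 := by fun_prop
  have h3 : Continuous fun r : ℝ => lowerCoeff s a h e * (h ^ 2 * (inner ℝ (f (r • ω))
      (rayDeriv k h (slope τ a r) r (f (r • ω)) (fderiv ℝ f (r • ω) ω)) : ℝ) -
      h * slope τ a r * r * ‖f (r • ω)‖ ^ 2) := by fun_prop
  exact (hm.mul h2.continuousOn).add h3.continuousOn

theorem lowerBound_of_gt (hR : a < R) {x : Space (k + 3)} (hx : R < ‖x‖) :
    lowerBound k s E cV τ a h e R V f x = 0 := by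
  rw [lowerBound, angWeight, angWeightEuler, cutoffError, cutoff_of_ge hR hx.le,
    Set.indicator_of_notMem (fun h => absurd h.2 (not_le.mpr hx))]
  ring

/-- The integral of `lowerBound` along a ray is nonpositive: the energy vanishes at the origin, and
the cutoff makes it vanish at the other end. -/
theorem Admissible.integral_ray_nonpos (H : Admissible δ s E cV τ a h e) (hf : ContDiff ℝ 2 f)
    (hω : ‖ω‖ = 1) (hR : a < R) (hV : ∀ x, |V x| ≤ cV * (‖x‖ + 1) ^ (-δ))
    (hint : IntegrableOn (fun r : ℝ => r ^ (k + 2) * lowerBound k s E cV τ a h e R V f (r • ω))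
      (Set.Ioi 0)) :
    ∫ r in Set.Ioi (0 : ℝ), r ^ (k + 2) * lowerBound k s E cV τ a h e R V f (r • ω) ≤ 0 := by
  have ha := H.a_ge
  have ha0 : 0 < a := by linarith
  set F : ℝ → ℝ := fun r => r ^ (k + 2) * lowerBound k s E cV τ a h e R V f (r • ω) with hF
  set W := energyOnRay k s E τ a h e f ω with hW
  have hc : ContinuousOn W (Set.Ici 0) := continuousOn_energyOnRay hf hω H.s_gt ha0
  have hzero : ∫ r in Set.Ioi (0 : ℝ), F r = ∫ r in Set.Ioc (0 : ℝ) R, F r := by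
    refine setIntegral_eq_of_subset_of_forall_sdiff_eq_zero measurableSet_Ioi
      Set.Ioc_subset_Ioi_self fun r hr => ?_
    have hr0 : (0 : ℝ) < r := hr.1
    have hrR : R < r := not_le.mp fun h' => hr.2 ⟨hr0, h'⟩
    rw [hF]
    simp only
    rw [lowerBound_of_gt hR, mul_zero]
    rwa [norm_smul, hω, mul_one, Real.norm_of_nonneg hr0.le]
  have hI : ∀ x y : ℝ, 0 ≤ x → IntegrableOn F (Set.Icc x y) := fun x y hx => by
    rw [integrableOn_Icc_iff_integrableOn_Ioc]
    exact hint.mono_set fun r hr => lt_of_le_of_lt hx hr.1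
  have hII : ∀ x y : ℝ, 0 ≤ x → x ≤ y → IntervalIntegrable F volume x y := fun x y hx hxy => by
    rw [intervalIntegrable_iff_integrableOn_Icc_of_le hxy]
    exact hI x y hx
  rw [hzero, ← intervalIntegral.integral_of_le (ha0.trans hR).le,
    ← intervalIntegral.integral_add_adjacent_intervals (hII 0 a le_rfl ha0.le)
      (hII a R ha0.le hR.le)]
  have h1 : ∫ r in (0 : ℝ)..a, F r ≤ W a - W 0 := by
    refine intervalIntegral.integral_le_sub_of_hasDeriv_right_of_le ha0.le
      (hc.mono Set.Icc_subset_Ici_self) (g' := deriv W) ?_ (hI 0 a le_rfl) ?_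
    · intro r hr
      obtain ⟨W', h', -⟩ := H.lowerBound_inner hf hω hR hV hr.1 hr.2
      exact h'.differentiableAt.hasDerivAt.hasDerivWithinAt
    · intro r hr
      obtain ⟨W', h', hle⟩ := H.lowerBound_inner hf hω hR hV hr.1 hr.2
      rwa [h'.deriv]
  have h2 : ∫ r in a..R, F r ≤ (R - R) / (R - a) * W R - (R - a) / (R - a) * W a := by
    refine intervalIntegral.integral_le_sub_of_hasDeriv_right_of_le hR.le
      (g := fun r => (R - r) / (R - a) * W r)
      (g' := deriv fun r => (R - r) / (R - a) * W r) ?_ ?_ (hI a R ha0.le) ?_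
    · exact ContinuousOn.mul (by fun_prop) (hc.mono fun r hr => ha0.le.trans hr.1)
    · intro r hr
      obtain ⟨W', h', -⟩ := H.lowerBound_outer hf hω hV hr.1 hr.2
      exact h'.differentiableAt.hasDerivAt.hasDerivWithinAt
    · intro r hr
      obtain ⟨W', h', hle⟩ := H.lowerBound_outer hf hω hV hr.1 hr.2
      rwa [h'.deriv]
  have hW0 : W 0 = 0 := by
    rw [hW, energyOnRay, rayEnergy]
    simp
  rw [sub_self, zero_div, zero_mul, div_self (by linarith : R - a ≠ 0), one_mul] at h2
  linarith

/-! ### Integrability over the whole space -/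

/-- In dimension at least `3` the singularity `r⁻²` at the origin is integrable. -/
theorem integrable_radial_inv_sq {G : ℝ → ℝ} (hG : ContinuousOn G (Set.Ici 0))
    (hR : ∀ r, R < r → G r = 0) :
    Integrable fun x : Space (k + 3) => (‖x‖ ^ 2)⁻¹ * G ‖x‖ := by
  have key := integrable_fun_norm_addHaar (volume : Measure (Space (k + 3)))
    (f := fun r : ℝ => (r ^ 2)⁻¹ * G r)
  rw [key]
  have hdim : Module.finrank ℝ (Space (k + 3)) - 1 = k + 2 := by simp
  rw [hdim]
  have h1 : IntegrableOn (fun r : ℝ => r ^ k * G r) (Set.Icc 0 R) :=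
    (ContinuousOn.mul (by fun_prop) (hG.mono Set.Icc_subset_Ici_self)).integrableOn_Icc
  have h2 : IntegrableOn (fun r : ℝ => r ^ k * G r) (Set.Ioi 0) := by
    refine h1.of_forall_sdiff_eq_zero measurableSet_Ioi fun r hr => ?_
    have hr0 : (0 : ℝ) < r := hr.1
    rw [hR r (not_le.mp fun h' => hr.2 ⟨hr0.le, h'⟩), mul_zero]
  refine h2.congr_fun (fun r hr => ?_) measurableSet_Ioi
  have hr0 : (0 : ℝ) < r := hr
  simp only [smul_eq_mul]
  field_simp
  ring

theorem integrable_angWeight (hs : 1 / 2 < s) (ha : 0 < a) (hR : a < R) :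
    Integrable fun x : Space (k + 3) => angWeight k s τ a h e R ‖x‖ := by
  have h1 := integrable_radial_inv_sq (k := k) (R := R) (G := fun r => cutoff a R r *
    weightSq τ a h r * (h ^ 2 * (2 * mult s a r * rayCoeff k h (slope τ a r) r +
      lowerCoeff s a h e))) ?_ ?_
  · refine h1.congr (Filter.Eventually.of_forall fun x => ?_)
    simp only [angWeight]
    ring
  · have hm := continuousOn_mult hs ha
    have h2 := (continuous_rayCoeff (k := k) (h := h) (τ := τ) ha.le).continuousOn
      (s := Set.Ici 0)
    have h3 := ((continuous_cutoff a R).mul (continuous_weightSq (τ := τ) (h := h)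
      ha.le)).continuousOn (s := Set.Ici 0)
    exact h3.mul (continuousOn_const.mul (((continuousOn_const.mul hm).mul h2).add
      continuousOn_const))
  · intro r hr
    rw [cutoff_of_ge hR hr.le]
    ring

theorem integrable_angWeightEuler (hs : 1 / 2 < s) (ha : 0 < a) (hR : a < R) :
    Integrable fun x : Space (k + 3) => angWeightEuler s τ a h R ‖x‖ := by
  have h1 := integrable_radial_inv_sq (k := k) (R := R) (G := fun r => cutoff a R r *
    weightSq τ a h r * (2 * h ^ 2 * mult s a r)) ?_ ?_
  · refine h1.congr (Filter.Eventually.of_forall fun x => ?_)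
    simp only [angWeightEuler]
    ring
  · have h3 := ((continuous_cutoff a R).mul (continuous_weightSq (τ := τ) (h := h)
      ha.le)).continuousOn (s := Set.Ici 0)
    exact h3.mul (continuousOn_const.mul (continuousOn_mult hs ha))
  · intro r hr
    rw [cutoff_of_ge hR hr.le]
    ring

theorem weightSq_le (ha : 0 ≤ a) (hτ : 0 ≤ τ) (hh : 0 < h) {r : ℝ} (hr : 0 ≤ r) :
    weightSq τ a h r ≤ Real.exp (2 * (τ * a) / h) := by
  unfold weightSq
  gcongr
  exact phaseExt_le ha hτ hr

theorem continuous_cutoff_mul {n : ℕ} (ha : 0 ≤ a) (p : ℝ) : Continuous fun x : Space n =>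
    cutoff a R ‖x‖ * weightSq τ a h ‖x‖ * (‖x‖ + 1) ^ p := by
  refine (((continuous_cutoff a R).comp continuous_norm).mul
    ((continuous_weightSq ha).comp continuous_norm)).mul ?_
  exact (continuous_norm.add continuous_const).rpow_const fun x =>
    Or.inl (show ‖x‖ + 1 ≠ 0 by positivity)

/-- The weights `cutoff * e^{2φ/h} * (r + 1)^p` are bounded, having compact support. -/
theorem memLp_top_cutoff_mul {n : ℕ} (ha : 0 ≤ a) (hR : a < R) (p : ℝ) :
    MemLp (fun x : Space n => cutoff a R ‖x‖ * weightSq τ a h ‖x‖ * (‖x‖ + 1) ^ p) ∞ := by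
  have hc := continuous_cutoff_mul (n := n) (R := R) (τ := τ) (h := h) ha p
  have hs : HasCompactSupport fun x : Space n =>
      cutoff a R ‖x‖ * weightSq τ a h ‖x‖ * (‖x‖ + 1) ^ p := by
    refine HasCompactSupport.intro (isCompact_closedBall 0 R) fun x hx => ?_
    have : R ≤ ‖x‖ := by
      rw [mem_closedBall_zero_iff, not_le] at hx
      exact hx.le
    rw [cutoff_of_ge hR this]
    ring
  obtain ⟨C, hC⟩ := hc.bounded_above_of_compact_support hs
  exact memLp_top_of_bound hc.aestronglyMeasurable C (Filter.Eventually.of_forall hC)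

theorem integrable_cutoff_mul (ha : 0 ≤ a) (hR : a < R) (p : ℝ) {u : Space (k + 3) → ℝ}
    (hu : Integrable u) :
    Integrable fun x => cutoff a R ‖x‖ * weightSq τ a h ‖x‖ * (‖x‖ + 1) ^ p * u x :=
  memLp_one_iff_integrable.mp
    ((memLp_one_iff_integrable.mpr hu).mul (p := ∞) (memLp_top_cutoff_mul ha hR p))

end Carleman

/-! ### The estimate for functions of class `C²` -/

namespace Carleman

variable {δ s E cV τ a h e R : ℝ} {k : ℕ} {V : Space (k + 3) → ℝ} {f : Space (k + 3) → ℂ}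

theorem Admissible.integrable_cutoffError (H : Admissible δ s E cV τ a h e) (hR : a < R)
    (hf2 : Integrable fun x => ‖f x‖ ^ 2) (hgrad : Integrable (gradSq f)) :
    Integrable (cutoffError k s E τ a h R f) := by
  have ha : 0 ≤ a := by linarith [H.a_ge]
  have hτ : 0 ≤ τ := by linarith [H.τ_ge]
  have hM := H.multBound_ge
  have hE := H.E_pos
  have hC : 0 ≤ cutoffConst k s E a := by unfold cutoffConst; positivity
  have hRa : 0 ≤ (R - a)⁻¹ := inv_nonneg.mpr (by linarith)
  refine (hgrad.add hf2).bdd_mul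
    (c := (R - a)⁻¹ * (cutoffConst k s E a * Real.exp (2 * (τ * a) / h))) ?_ ?_
  · have h1 : Measurable fun r : ℝ => (Set.Ioc a R).indicator
        (fun r => (R - a)⁻¹ * (cutoffConst k s E a * weightSq τ a h r)) r :=
      (measurable_const.mul (measurable_const.mul
        (continuous_weightSq ha).measurable)).indicator measurableSet_Ioc
    exact (h1.comp measurable_norm).aestronglyMeasurable
  · refine Filter.Eventually.of_forall fun x => ?_
    have hψ := weightSq_le ha hτ H.h_pos (norm_nonneg x)
    have hψ0 : 0 ≤ weightSq τ a h ‖x‖ := (Real.exp_pos _).le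
    refine (norm_indicator_le_norm_self _ _).trans ?_
    rw [Real.norm_of_nonneg (by positivity)]
    gcongr

theorem Admissible.integral_cutoffError_le (H : Admissible δ s E cV τ a h e) (hR : a < R)
    (hf2 : Integrable fun x => ‖f x‖ ^ 2) (hgrad : Integrable (gradSq f)) :
    ∫ x, cutoffError k s E τ a h R f x ≤ (R - a)⁻¹ *
      (cutoffConst k s E a * Real.exp (2 * (τ * a) / h)) * ∫ x, (gradSq f x + ‖f x‖ ^ 2) := by
  have ha : 0 ≤ a := by linarith [H.a_ge]
  have hτ : 0 ≤ τ := by linarith [H.τ_ge]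
  have hM := H.multBound_ge
  have hE := H.E_pos
  have hC : 0 ≤ cutoffConst k s E a := by unfold cutoffConst; positivity
  have hRa : 0 ≤ (R - a)⁻¹ := inv_nonneg.mpr (by linarith)
  rw [← integral_const_mul]
  refine integral_mono (H.integrable_cutoffError hR hf2 hgrad) ((hgrad.add hf2).const_mul _)
    fun x => ?_
  have hψ := weightSq_le ha hτ H.h_pos (norm_nonneg x)
  have hψ0 : 0 ≤ weightSq τ a h ‖x‖ := (Real.exp_pos _).le
  have hg0 : 0 ≤ gradSq f x := Finset.sum_nonneg fun j _ => by positivity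
  refine mul_le_mul_of_nonneg_right ?_ (by positivity)
  by_cases hx : ‖x‖ ∈ Set.Ioc a R
  · rw [Set.indicator_of_mem hx]
    gcongr
  · rw [Set.indicator_of_notMem hx]
    positivity

/-- The Carleman estimate for a function of class `C²`, with a cutoff in the radial variable. -/
theorem Admissible.spatial_estimate (H : Admissible δ s E cV τ a h e) (hf : ContDiff ℝ 2 f)
    (hR : a < R) (hV : ∀ x, |V x| ≤ cV * (‖x‖ + 1) ^ (-δ))
    (hf2 : Integrable fun x => ‖f x‖ ^ 2) (hgrad : Integrable (gradSq f))
    (hg : Integrable fun x => ‖schrodingerC2 h E e V f x‖ ^ 2) :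
    E / 4 * ∫ x, cutoff a R ‖x‖ * weightSq τ a h ‖x‖ * (‖x‖ + 1) ^ (-(2 * s)) * ‖f x‖ ^ 2 ≤
      sourceConst s E * (a ^ 4 / h ^ 2) * (∫ x, cutoff a R ‖x‖ * weightSq τ a h ‖x‖ *
        (‖x‖ + 1) ^ (2 * s) * ‖schrodingerC2 h E e V f x‖ ^ 2) +
      remainderConst s E cV * (|e| / h) * a ^ 2 * τ ^ 2 *
        (∫ x, cutoff a R ‖x‖ * weightSq τ a h ‖x‖ * (‖x‖ + 1) ^ (0 : ℝ) * ‖f x‖ ^ 2) +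
      (R - a)⁻¹ * (cutoffConst k s E a * Real.exp (2 * (τ * a) / h)) *
        ∫ x, (gradSq f x + ‖f x‖ ^ 2) := by
  have ha : 0 < a := by linarith [H.a_ge]
  have hcut : ∀ r, R < r → cutoff a R r = 0 := fun r hr => cutoff_of_ge hR hr.le
  obtain ⟨i1, z1⟩ := integral_radial_mul_angDiv hf
    (integrable_angWeight (k := k) (τ := τ) (h := h) (e := e) H.s_gt ha hR) (R := R)
    fun r hr => by rw [angWeight, hcut r hr]; ring
  obtain ⟨i2, z2⟩ := integral_radial_mul_angDivEuler hf
    (integrable_angWeightEuler (k := k) (τ := τ) (h := h) H.s_gt ha hR) (R := R)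
    fun r hr => by rw [angWeightEuler, hcut r hr]; ring
  have i3 := H.integrable_cutoffError hR hf2 hgrad
  have j1 := integrable_cutoff_mul (τ := τ) (h := h) ha.le hR (-(2 * s)) hf2
  have j2 := integrable_cutoff_mul (τ := τ) (h := h) ha.le hR (2 * s) hg
  have j3 := integrable_cutoff_mul (τ := τ) (h := h) ha.le hR 0 hf2
  have e1 : ∀ x, lowerBound k s E cV τ a h e R V f x =
      (((E / 4 * (cutoff a R ‖x‖ * weightSq τ a h ‖x‖ * (‖x‖ + 1) ^ (-(2 * s)) * ‖f x‖ ^ 2) -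
      sourceConst s E * (a ^ 4 / h ^ 2) * (cutoff a R ‖x‖ * weightSq τ a h ‖x‖ *
        (‖x‖ + 1) ^ (2 * s) * ‖schrodingerC2 h E e V f x‖ ^ 2)) -
      remainderConst s E cV * (|e| / h) * a ^ 2 * τ ^ 2 *
        (cutoff a R ‖x‖ * weightSq τ a h ‖x‖ * (‖x‖ + 1) ^ (0 : ℝ) * ‖f x‖ ^ 2)) -
      angWeight k s τ a h e R ‖x‖ * angDiv f x - angWeightEuler s τ a h R ‖x‖ * angDivEuler f x)
      - cutoffError k s E τ a h R f x := by
    intro x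
    rw [lowerBound, bulkBound, Real.rpow_zero]
    ring
  have k1 := j1.const_mul (E / 4)
  have k2 := j2.const_mul (sourceConst s E * (a ^ 4 / h ^ 2))
  have k3 := j3.const_mul (remainderConst s E cV * (|e| / h) * a ^ 2 * τ ^ 2)
  have hsum := ((((k1.sub k2).sub k3).sub i1).sub i2).sub i3
  have hfun := (funext e1 : lowerBound k s E cV τ a h e R V f = _)
  have hint : Integrable (lowerBound k s E cV τ a h e R V f) := by
    rw [hfun]; exact hsum
  have hneg := integral_nonpos_of_rays (by omega) hint
    fun ω hω hray => H.integral_ray_nonpos hf hω hR hV hray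
  have herr := H.integral_cutoffError_le hR hf2 hgrad
  have hval := (integral_sub' ((((k1.sub k2).sub k3).sub i1).sub i2) i3)
  rw [integral_sub' (((k1.sub k2).sub k3).sub i1) i2, integral_sub' ((k1.sub k2).sub k3) i1,
    integral_sub' (k1.sub k2) k3, integral_sub' k1 k2, z1, z2, integral_const_mul,
    integral_const_mul, integral_const_mul] at hval
  rw [hfun] at hneg
  have := hval.symm.trans_le hneg
  linarith

end Carleman

/-! ### Density of Schwartz functions in `H²` -/

namespace Carleman

variable {n : ℕ}

theorem toTemperedDistribution_injective {u v : L2 n}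
    (h : (u : 𝓢'(Space n, ℂ)) = (v : 𝓢'(Space n, ℂ))) : u = v := by
  have hk := Lp.ker_toTemperedDistributionCLM_eq_bot (E := Space n) (F := ℂ) (p := 2)
    (μ := volume)
  exact (LinearMap.ker_eq_bot.mp hk) (by simpa using h)

/-- A Fourier multiplier with a bounded symbol is bounded on `L²`. -/
theorem norm_le_of_fourierMultiplierCLM_eq {g : Space n → ℂ} (hg : g.HasTemperateGrowth) {C : ℝ}
    (hC0 : 0 ≤ C) (hC : ∀ x, ‖g x‖ ≤ C) {u v : L2 n}
    (h : TemperedDistribution.fourierMultiplierCLM ℂ g (u : 𝓢'(Space n, ℂ)) =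
      (v : 𝓢'(Space n, ℂ))) : ‖v‖ ≤ C * ‖u‖ := by
  have hm : MemLp g ∞ (volume : Measure (Space n)) :=
    memLp_top_of_bound hg.1.continuous.aestronglyMeasurable C (Filter.Eventually.of_forall hC)
  have hfou : (FourierTransform.fourier v : L2 n) =
      (hm.toLp g • (FourierTransform.fourier u : L2 n) : L2 n) := by
    apply toTemperedDistribution_injective
    rw [Lp.toTemperedDistribution_smul_eq hg, ← Lp.fourier_toTemperedDistribution_eq,
      ← Lp.fourier_toTemperedDistribution_eq, ← h,
      TemperedDistribution.fourierMultiplierCLM_apply, FourierTransform.fourier_fourierInv_eq]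
  rw [← Lp.norm_fourier_eq v, hfou, ← Lp.norm_fourier_eq u]
  refine (Lp.norm_smul_le _ _).trans (mul_le_mul_of_nonneg_right ?_ (norm_nonneg _))
  rw [Lp.norm_toLp, eLpNorm_exponent_top]
  exact ENNReal.toReal_le_of_le_ofReal hC0
    (eLpNormEssSup_le_of_ae_bound (μ := volume) (Filter.Eventually.of_forall hC))

/-- Schwartz functions are dense in `H²(ℝⁿ)`. If `û = (1 + |ξ|²) f̂`, and `u` is approximated by a
Schwartz function `w` in `L²`, the multipliers `(1 + |ξ|²)⁻¹` and `-(2π)² |ξ|² (1 + |ξ|²)⁻¹`, which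
are bounded, map `w - u` to the differences of the functions and of their Laplacians. -/
theorem exists_schwartz_norm_sub_le {f : L2 n} (hf : MemH2 f) {η : ℝ} (hη : 0 < η) :
    ∃ φ : 𝓢(Space n, ℂ), ‖φ.toLp 2 volume - f‖ ≤ η ∧
      ‖(Δ φ).toLp 2 volume - laplacianH2 hf‖ ≤ η := by
  obtain ⟨u, hu⟩ := id hf
  have hd := SchwartzMap.denseRange_toLpCLM (E := Space n) (F := ℂ) (p := 2) (μ := volume)
    (by norm_num)
  set η' := η / (2 * Real.pi) ^ 2 with hη'
  have hπ : 1 ≤ (2 * Real.pi) ^ 2 := by nlinarith [Real.pi_gt_three]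
  have hη'0 : 0 < η' := by positivity
  obtain ⟨w, hw⟩ := Metric.denseRange_iff.mp hd u η' hη'0
  rw [SchwartzMap.toLpCLM_apply, dist_comm, dist_eq_norm] at hw
  set g : Space n → ℝ := fun x => (1 + ‖x‖ ^ 2) ^ ((-2 : ℝ) / 2) with hg
  have hgt : g.HasTemperateGrowth := by fun_prop
  set φ : 𝓢(Space n, ℂ) := SchwartzMap.fourierMultiplierCLM ℂ g w with hφ
  have hφB : TemperedDistribution.besselPotential (Space n) ℂ (-2)
      (w.toLp 2 (volume : Measure (Space n)) : 𝓢'(Space n, ℂ)) =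
      (φ.toLp 2 (volume : Measure (Space n)) : 𝓢'(Space n, ℂ)) := by
    rw [TemperedDistribution.besselPotential, Lp.toTemperedDistribution_toLp_eq,
      Lp.toTemperedDistribution_toLp_eq,
      TemperedDistribution.fourierMultiplierCLM_toTemperedDistributionCLM_eq (by fun_prop)]
    congr 1
    exact SchwartzMap.fourierMultiplierCLM_ofReal ℂ hgt w
  have hfB : TemperedDistribution.besselPotential (Space n) ℂ (-2) (u : 𝓢'(Space n, ℂ)) =
      (f : 𝓢'(Space n, ℂ)) :=
    (TemperedDistribution.besselPotential_neg_apply_eq_iff 2 _ _).mpr hu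
  have hφΔ : Δ (φ.toLp 2 (volume : Measure (Space n)) : 𝓢'(Space n, ℂ)) =
      ((Δ φ).toLp 2 (volume : Measure (Space n)) : 𝓢'(Space n, ℂ)) := by
    rw [Lp.toTemperedDistribution_toLp_eq, Lp.toTemperedDistribution_toLp_eq,
      TemperedDistribution.laplacian_toTemperedDistributionCLM_eq]
  have hsub : ∀ p q : L2 n, ((p - q : L2 n) : 𝓢'(Space n, ℂ)) = (p : 𝓢'(Space n, ℂ)) - q := by
    intro p q
    simp only [← Lp.toTemperedDistributionCLM_apply, map_sub]
  have hg0 : ∀ x, 0 ≤ g x := fun x => by positivity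
  have hg1 : ∀ x, (1 + ‖x‖ ^ 2) * g x = 1 := fun x => by
    have h1 : (0 : ℝ) < 1 + ‖x‖ ^ 2 := by positivity
    simp only [hg]
    rw [show (-2 : ℝ) / 2 = -1 by norm_num, Real.rpow_neg_one, mul_inv_cancel₀ h1.ne']
  refine ⟨φ, ?_, ?_⟩
  · have := norm_le_of_fourierMultiplierCLM_eq (n := n) (g := fun x => (g x : ℂ)) (C := 1)
      (u := w.toLp 2 (volume : Measure (Space n)) - u)
      (v := φ.toLp 2 (volume : Measure (Space n)) - f) (by fun_prop) zero_le_one ?_ ?_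
    · refine this.trans ?_
      rw [one_mul]
      exact hw.le.trans (div_le_self hη.le hπ)
    · intro x
      rw [Complex.norm_real, Real.norm_of_nonneg (hg0 x)]
      nlinarith [hg1 x, hg0 x, mul_nonneg (sq_nonneg ‖x‖) (hg0 x)]
    · rw [hsub, hsub, map_sub, ← hφB, ← hfB]
      rfl
  · -- `η'` is chosen with the factor `(2π)²` of the Laplacian in mind
    have := norm_le_of_fourierMultiplierCLM_eq (n := n)
      (g := fun x => (((-(2 * Real.pi) ^ 2 : ℝ)) : ℂ) • ((g x : ℂ) * (‖x‖ ^ 2 : ℝ)))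
      (C := (2 * Real.pi) ^ 2)
      (u := w.toLp 2 (volume : Measure (Space n)) - u)
      (v := (Δ φ).toLp 2 (volume : Measure (Space n)) - laplacianH2 hf) (by fun_prop)
      (by positivity) ?_ ?_
    · refine this.trans ?_
      refine (mul_le_mul_of_nonneg_left hw.le (by positivity)).trans_eq ?_
      rw [hη']
      field_simp
    · intro x
      rw [norm_smul, Complex.norm_real, ← Complex.ofReal_mul, Complex.norm_real, norm_neg,
        Real.norm_of_nonneg (by positivity),
        Real.norm_of_nonneg (mul_nonneg (hg0 x) (sq_nonneg _))]
      refine mul_le_of_le_one_right (by positivity) ?_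
      nlinarith [hg1 x, hg0 x]
    · have hsm := TemperedDistribution.fourierMultiplierCLM_smul (E := Space n) (F := ℂ)
        (g := fun x => (g x : ℂ) * ((‖x‖ ^ 2 : ℝ) : ℂ)) (by fun_prop)
        ((-(2 * Real.pi) ^ 2 : ℝ) : ℂ)
      refine (DFunLike.congr_fun hsm _).trans ?_
      rw [hsub, hsub, ← hφΔ, ← laplacianH2_spec hf, ← hφB, ← hfB,
        TemperedDistribution.laplacian_eq_fourierMultiplierCLM,
        TemperedDistribution.laplacian_eq_fourierMultiplierCLM,
        TemperedDistribution.besselPotential,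
        TemperedDistribution.fourierMultiplierCLM_fourierMultiplierCLM_apply (by fun_prop)
          (by fun_prop),
        TemperedDistribution.fourierMultiplierCLM_fourierMultiplierCLM_apply (by fun_prop)
          (by fun_prop), ← smul_sub, ← map_sub, ← hsub]
      have h2 : ∀ D : 𝓢'(Space n, ℂ), (((-(2 * Real.pi) ^ 2 : ℝ)) : ℂ) • D =
        (-(2 * Real.pi) ^ 2 : ℝ) • D := fun D => by
          ext; simp
      rw [smul_apply, h2]
      rfl

/-- The trace of the second derivative of a Schwartz function is its Laplacian. -/
theorem hessTrace_schwartz (φ : 𝓢(Space n, ℂ)) (x : Space n) : hessTrace φ x = Δ φ x := by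
  rw [SchwartzMap.laplacian_eq_sum (EuclideanSpace.basisFun (Fin n) ℝ)]
  simp only [hessTrace, hess, sum_apply]
  refine Finset.sum_congr rfl fun j _ => ?_
  have h1 : ∀ y, LineDeriv.lineDerivOp (EuclideanSpace.basisFun (Fin n) ℝ j) φ y =
      fderiv ℝ φ y (stdVec j) := fun y => by
    rw [SchwartzMap.lineDerivOp_apply_eq_fderiv, EuclideanSpace.basisFun_apply]
  have h2 : (LineDeriv.lineDerivOp (EuclideanSpace.basisFun (Fin n) ℝ j) φ : Space n → ℂ) =
      fun y => fderiv ℝ φ y (stdVec j) := funext h1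
  rw [SchwartzMap.lineDerivOp_apply_eq_fderiv, h2, EuclideanSpace.basisFun_apply,
    ((differentiable_fderiv_of_contDiff (φ.smooth 2) x).hasFDerivAt.clm_apply
      (hasFDerivAt_const (stdVec j) x)).fderiv]
  simp

theorem integrable_norm_sq_schwartz (φ : 𝓢(Space n, ℂ)) : Integrable fun x => ‖φ x‖ ^ 2 :=
  (φ.memLp 2).integrable_norm_pow (by norm_num)

theorem integral_norm_sq_eq (u : L2 n) : ∫ x, ‖u x‖ ^ 2 = ‖u‖ ^ 2 := by
  have h := L2.inner_def (𝕜 := ℂ) u u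
  simp only [inner_self_eq_norm_sq_to_K] at h
  have h2 : ((‖u‖ ^ 2 : ℝ) : ℂ) = ((∫ x, ‖u x‖ ^ 2 : ℝ) : ℂ) := by
    rw [← integral_complex_ofReal]
    push_cast
    exact h
  exact_mod_cast h2.symm

theorem integral_norm_sq_toLp {u : Space n → ℂ} (hu : MemLp u 2) :
    ∫ x, ‖u x‖ ^ 2 = ‖hu.toLp u‖ ^ 2 := by
  rw [← integral_norm_sq_eq]
  refine integral_congr_ae ?_
  filter_upwards [hu.coeFn_toLp] with x hx
  rw [hx]

theorem integrable_inner_of_sq {u v : Space n → ℂ} (hu : MemLp u 2) (hv : MemLp v 2) :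
    Integrable fun x => inner ℝ (u x) (v x) := by
  refine ((hu.integrable_norm_pow (by norm_num)).add
    (hv.integrable_norm_pow (by norm_num))).mono'
    (hu.aestronglyMeasurable.inner hv.aestronglyMeasurable) ?_
  refine Filter.Eventually.of_forall fun x => (norm_inner_le_norm _ _).trans ?_
  simp only [Pi.add_apply]
  nlinarith [sq_nonneg (‖u x‖ - ‖v x‖), sq_nonneg ‖u x‖, sq_nonneg ‖v x‖]

theorem integrable_gradSq_schwartz (φ : 𝓢(Space n, ℂ)) : Integrable (gradSq φ) := by
  unfold gradSq
  refine integrable_finsetSum _ fun j _ => ?_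
  simpa only [SchwartzMap.lineDerivOp_apply_eq_fderiv] using
    integrable_norm_sq_schwartz (LineDeriv.lineDerivOp (stdVec j) φ)

/-- The gradient is controlled by the function and its Laplacian: integrate by parts. -/
theorem integral_gradSq_schwartz_le (φ : 𝓢(Space n, ℂ)) :
    ∫ x, gradSq φ x ≤ (‖φ.toLp 2 (volume : Measure (Space n))‖ ^ 2 +
      ‖(Δ φ).toLp 2 (volume : Measure (Space n))‖ ^ 2) / 2 := by
  have h2 : ∀ j, ∫ x, ‖fderiv ℝ φ x (stdVec j)‖ ^ 2 = -∫ x, inner ℝ (φ x)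
      (LineDeriv.lineDerivOp (stdVec j) (LineDeriv.lineDerivOp (stdVec j) φ) x) := by
    intro j
    have := SchwartzMap.integral_bilinear_lineDerivOp_right_eq_neg_left (μ := volume) φ
      (LineDeriv.lineDerivOp (stdVec j) φ) (innerSL ℝ) (stdVec j)
    refine Eq.trans ?_ (neg_eq_iff_eq_neg.mpr this).symm
    refine integral_congr_ae (Filter.Eventually.of_forall fun x => ?_)
    simp only [SchwartzMap.lineDerivOp_apply_eq_fderiv]
    exact (real_inner_self_eq_norm_sq _).symm
  have h1 : ∫ x, gradSq φ x = ∫ x, -inner ℝ (φ x) (Δ φ x) := by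
    rw [integral_neg]
    unfold gradSq
    rw [integral_finsetSum, Finset.sum_congr rfl fun j _ => h2 j, Finset.sum_neg_distrib,
      ← integral_finsetSum]
    · refine congrArg _ (integral_congr_ae (Filter.Eventually.of_forall fun x => ?_))
      dsimp only
      rw [← inner_sum, SchwartzMap.laplacian_eq_sum (EuclideanSpace.basisFun (Fin n) ℝ),
        sum_apply]
      simp only [EuclideanSpace.basisFun_apply]
    · exact fun j _ => integrable_inner_of_sq (φ.memLp 2 volume) (SchwartzMap.memLp _ 2 volume)
    · intro j _
      simpa only [SchwartzMap.lineDerivOp_apply_eq_fderiv] using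
        integrable_norm_sq_schwartz (LineDeriv.lineDerivOp (stdVec j) φ)
  have e1 : ∫ x, ‖φ x‖ ^ 2 = ‖φ.toLp 2 (volume : Measure (Space n))‖ ^ 2 :=
    integral_norm_sq_toLp (φ.memLp 2)
  have e2 : ∫ x, ‖Δ φ x‖ ^ 2 = ‖(Δ φ).toLp 2 (volume : Measure (Space n))‖ ^ 2 :=
    integral_norm_sq_toLp ((Δ φ).memLp 2)
  have i1 := integrable_norm_sq_schwartz φ
  have i2 := integrable_norm_sq_schwartz (Δ φ)
  rw [h1, ← e1, ← e2, ← integral_add i1 i2, ← integral_div]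
  refine integral_mono (integrable_inner_of_sq (φ.memLp 2) ((Δ φ).memLp 2)).neg
    ((i1.add i2).div_const 2) fun x => ?_
  have h3 := abs_le.mp (abs_real_inner_le_norm (φ x) (Δ φ x))
  simp only
  nlinarith [sq_nonneg (‖φ x‖ - ‖Δ φ x‖), h3.1]

end Carleman

/-! ### The estimate in `H²` -/

namespace Carleman

variable {n : ℕ}

/-- Multiplication by a bounded function, as an operator on `L²(ℝⁿ)`. -/
noncomputable def mulL2 (q : Space n → ℂ) (hq : MemLp q ∞) : L2 n →L[ℂ] L2 n :=
  (ContinuousLinearMap.lsmul ℂ ℂ).holderL volume ∞ 2 2 (hq.toLp q)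

theorem coeFn_mulL2 {q : Space n → ℂ} (hq : MemLp q ∞) (u : L2 n) :
    mulL2 q hq u =ᵐ[volume] fun x => q x * u x := by
  have h := ContinuousLinearMap.coeFn_holder (r := 2) (ContinuousLinearMap.lsmul ℂ ℂ)
    (hq.toLp q) u
  refine Filter.EventuallyEq.trans (f := mulL2 q hq u) h ?_
  filter_upwards [hq.coeFn_toLp] with x hx
  rw [hx]
  rfl

/-- The quadratic form of a bounded weight is continuous on `L²`. -/
theorem continuous_integral_mul_norm_sq {q : Space n → ℝ} (hq : MemLp q ∞) :
    Continuous fun u : L2 n => ∫ x, q x * ‖u x‖ ^ 2 := by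
  have hq' : MemLp (fun x => (q x : ℂ)) ∞ := hq.ofReal
  have h1 : Continuous fun u : L2 n => (inner ℂ u (mulL2 _ hq' u) : ℂ).re :=
    Complex.continuous_re.comp (continuous_id.inner (mulL2 _ hq').continuous)
  refine h1.congr fun u => ?_
  rw [L2.inner_def]
  have h2 : ∫ x, inner ℂ (u x) (mulL2 _ hq' u x) = ∫ x, ((q x * ‖u x‖ ^ 2 : ℝ) : ℂ) := by
    refine integral_congr_ae ?_
    filter_upwards [coeFn_mulL2 hq' u] with x hx
    rw [hx, ← smul_eq_mul, inner_smul_right, inner_self_eq_norm_sq_to_K]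
    push_cast
    rfl
  rw [h2, integral_complex_ofReal, Complex.ofReal_re]

variable {δ s E cV τ a h e R : ℝ} {k : ℕ} {V : Space (k + 3) → ℝ}

/-- The function `-h² Δf + q f`, in terms of the pair `(f, Δf)`. -/
noncomputable def schrodingerL2 (h : ℝ) (q : Space n → ℂ) (hq : MemLp q ∞) (p : L2 n × L2 n) :
    L2 n :=
  (-(h : ℂ) ^ 2) • p.2 + mulL2 q hq p.1

theorem continuous_schrodingerL2 (h : ℝ) {q : Space n → ℂ} (hq : MemLp q ∞) :
    Continuous (schrodingerL2 h q hq) :=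
  (continuous_snd.const_smul (-(h : ℂ) ^ 2)).add ((mulL2 q hq).continuous.comp continuous_fst)

theorem coeFn_schrodingerL2 (h : ℝ) {q : Space n → ℂ} (hq : MemLp q ∞) (p : L2 n × L2 n) :
    schrodingerL2 h q hq p =ᵐ[volume] fun x => -(h : ℂ) ^ 2 * p.2 x + q x * p.1 x := by
  refine (Lp.coeFn_add _ _).trans ?_
  filter_upwards [Lp.coeFn_smul (-(h : ℂ) ^ 2) p.2, coeFn_mulL2 hq p.1] with x h1 h2
  rw [Pi.add_apply, h1, h2]
  rfl

/-- A closed relation between `f` and `Δf` extends from Schwartz functions to `H²`. -/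
theorem mem_of_isClosed_of_schwartz {S : Set (L2 n × L2 n)} (hS : IsClosed S)
    (h : ∀ φ : 𝓢(Space n, ℂ), (φ.toLp 2 volume, (Δ φ).toLp 2 volume) ∈ S) {f : L2 n}
    (hf : MemH2 f) : (f, laplacianH2 hf) ∈ S := by
  rw [← hS.closure_eq, Metric.mem_closure_iff]
  intro η hη
  obtain ⟨φ, h1, h2⟩ := exists_schwartz_norm_sub_le hf (half_pos hη)
  refine ⟨_, h φ, ?_⟩
  rw [dist_comm, Prod.dist_eq, dist_eq_norm, dist_eq_norm]
  exact max_lt (h1.trans_lt (half_lt_self hη)) (h2.trans_lt (half_lt_self hη))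

/-- The squared norm of `u` with weight `e^{2φ/h} (r + 1)^p`, cut off in the radial variable. -/
noncomputable def cutoffNormSq (τ a h R p : ℝ) (u : Space n → ℂ) : ℝ :=
  ∫ x, cutoff a R ‖x‖ * weightSq τ a h ‖x‖ * (‖x‖ + 1) ^ p * ‖u x‖ ^ 2

theorem cutoffNormSq_congr {p : ℝ} {u v : Space n → ℂ} (h' : u =ᵐ[volume] v) :
    cutoffNormSq τ a h R p u = cutoffNormSq τ a h R p v :=
  integral_congr_ae (by
    filter_upwards [h'] with x hx
    rw [hx])

theorem continuous_cutoffNormSq (ha : 0 ≤ a) (hR : a < R) (p : ℝ) :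
    Continuous fun u : L2 n => cutoffNormSq τ a h R p u :=
  continuous_integral_mul_norm_sq (memLp_top_cutoff_mul ha hR p)

theorem schrodingerL2_schwartz (hq : MemLp (fun x => (V x : ℂ) - (E + Complex.I * e)) ∞)
    (φ : 𝓢(Space (k + 3), ℂ)) :
    schrodingerL2 h _ hq (φ.toLp 2, (Δ φ).toLp 2) =ᵐ[volume] schrodingerC2 h E e V φ := by
  filter_upwards [coeFn_schrodingerL2 h hq (φ.toLp 2, (Δ φ).toLp 2),
    φ.coeFn_toLp 2 (volume : Measure (Space (k + 3))),
    (Δ φ).coeFn_toLp 2 (volume : Measure (Space (k + 3)))] with x h3 h4 h5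
  rw [h3, schrodingerC2, hessTrace_schwartz, h4, h5]

/-- The Carleman estimate for Schwartz functions, all terms being continuous in `(f, Δf)`. -/
theorem Admissible.schwartz_estimate (H : Admissible δ s E cV τ a h e) (hR : a < R)
    (hV : ∀ x, |V x| ≤ cV * (‖x‖ + 1) ^ (-δ))
    (hq : MemLp (fun x => (V x : ℂ) - (E + Complex.I * e)) ∞) (φ : 𝓢(Space (k + 3), ℂ)) :
    E / 4 * cutoffNormSq τ a h R (-(2 * s)) φ ≤
      sourceConst s E * (a ^ 4 / h ^ 2) *
        cutoffNormSq τ a h R (2 * s) (schrodingerC2 h E e V φ) +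
      remainderConst s E cV * (|e| / h) * a ^ 2 * τ ^ 2 * cutoffNormSq τ a h R 0 φ +
      (R - a)⁻¹ * (cutoffConst k s E a * Real.exp (2 * (τ * a) / h)) *
        ((3 * ‖φ.toLp 2 (volume : Measure (Space (k + 3)))‖ ^ 2 +
          ‖(Δ φ).toLp 2 (volume : Measure (Space (k + 3)))‖ ^ 2) / 2) := by
  have hM := H.multBound_ge
  have hE := H.E_pos
  have hC : 0 ≤ cutoffConst k s E a := by unfold cutoffConst; positivity
  have hRa : 0 ≤ (R - a)⁻¹ := inv_nonneg.mpr (by linarith)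
  have hgi : Integrable fun x => ‖schrodingerC2 h E e V φ x‖ ^ 2 :=
    ((memLp_congr_ae (schrodingerL2_schwartz (h := h) hq φ)).mp
      (Lp.memLp _)).integrable_norm_pow (by norm_num)
  have i1 := integrable_norm_sq_schwartz φ
  have i2 := integrable_gradSq_schwartz φ
  have key := H.spatial_estimate (φ.smooth 2) hR hV i1 i2 hgi
  have hgrad := integral_gradSq_schwartz_le φ
  have e0 : ∫ x, ‖φ x‖ ^ 2 = ‖φ.toLp 2 (volume : Measure (Space (k + 3)))‖ ^ 2 :=
    integral_norm_sq_toLp (φ.memLp 2)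
  rw [integral_add i2 i1, e0] at key
  refine key.trans (add_le_add_right (mul_le_mul_of_nonneg_left ?_ (by positivity)) _)
  linarith

theorem Admissible.memLp_potential (H : Admissible δ s E cV τ a h e) (hVm : AEMeasurable V)
    (hV : ∀ x, |V x| ≤ cV * (‖x‖ + 1) ^ (-δ)) :
    MemLp (fun x => (V x : ℂ) - (E + Complex.I * e)) ∞ := by
  have h1 : MemLp V ∞ := memLp_top_of_bound hVm.aestronglyMeasurable cV
    (Filter.Eventually.of_forall fun x => (hV x).trans (mul_le_of_le_one_right H.cV_nonneg
      (Real.rpow_le_one_of_one_le_of_nonpos (by linarith [norm_nonneg x])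
        (by linarith [H.δ_ge]))))
  have h2 : MemLp (fun x => (V x : ℂ)) ∞ := h1.ofReal
  exact h2.sub (memLp_top_const _)

/-- The Carleman estimate in `H²`, with a cutoff in the radial variable. -/
theorem Admissible.cutoff_estimate (H : Admissible δ s E cV τ a h e) (hR : a < R)
    (hVm : AEMeasurable V) (hV : ∀ x, |V x| ≤ cV * (‖x‖ + 1) ^ (-δ)) {f : L2 (k + 3)}
    (hf : MemH2 f) :
    E / 4 * cutoffNormSq τ a h R (-(2 * s)) f ≤
      sourceConst s E * (a ^ 4 / h ^ 2) *
        cutoffNormSq τ a h R (2 * s) (schrodingerSub h V (E + Complex.I * e) hf) +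
      remainderConst s E cV * (|e| / h) * a ^ 2 * τ ^ 2 * cutoffNormSq τ a h R 0 f +
      (R - a)⁻¹ * (cutoffConst k s E a * Real.exp (2 * (τ * a) / h)) *
        ((3 * ‖f‖ ^ 2 + ‖laplacianH2 hf‖ ^ 2) / 2) := by
  have ha : 0 ≤ a := by linarith [H.a_ge]
  have hq := H.memLp_potential hVm hV
  have hc := continuous_cutoffNormSq (n := k + 3) (τ := τ) (h := h) ha hR
  have hG := continuous_schrodingerL2 h hq
  have hclosed : IsClosed {p : L2 (k + 3) × L2 (k + 3) |
      E / 4 * cutoffNormSq τ a h R (-(2 * s)) p.1 ≤ sourceConst s E * (a ^ 4 / h ^ 2) *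
          cutoffNormSq τ a h R (2 * s) (schrodingerL2 h _ hq p) +
        remainderConst s E cV * (|e| / h) * a ^ 2 * τ ^ 2 * cutoffNormSq τ a h R 0 p.1 +
        (R - a)⁻¹ * (cutoffConst k s E a * Real.exp (2 * (τ * a) / h)) *
          ((3 * ‖p.1‖ ^ 2 + ‖p.2‖ ^ 2) / 2)} :=
    isClosed_le (continuous_const.mul ((hc _).comp continuous_fst))
      (((continuous_const.mul ((hc _).comp hG)).add
      (continuous_const.mul ((hc _).comp continuous_fst))).add (continuous_const.mul
        (((continuous_const.mul (continuous_fst.norm.pow 2)).add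
          (continuous_snd.norm.pow 2)).div_const 2)))
  have hmem := mem_of_isClosed_of_schwartz hclosed (fun φ => ?_) hf
  · rw [Set.mem_ofPred_eq] at hmem
    rwa [cutoffNormSq_congr (u := schrodingerL2 h _ hq (f, laplacianH2 hf))
      (v := schrodingerSub h V (E + Complex.I * e) hf)] at hmem
    filter_upwards [coeFn_schrodingerL2 h hq (f, laplacianH2 hf)] with x hx
    rw [hx, schrodingerSub, sub_mul, add_sub_assoc]
  · have c1 := φ.coeFn_toLp 2 (volume : Measure (Space (k + 3)))
    rw [Set.mem_ofPred_eq, cutoffNormSq_congr (schrodingerL2_schwartz hq φ),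
      cutoffNormSq_congr c1, cutoffNormSq_congr c1]
    exact H.schwartz_estimate hR hV hq φ

theorem tendsto_cutoff (a r : ℝ) :
    Filter.Tendsto (fun R => cutoff a R r) Filter.atTop (nhds 1) := by
  have h1 : Filter.Tendsto (fun R : ℝ => 1 - (r - a) * (R - a)⁻¹) Filter.atTop
      (nhds (1 - (r - a) * 0)) :=
    ((tendsto_inv_atTop_zero.comp (Filter.tendsto_atTop_add_const_right _ (-a)
      Filter.tendsto_id)).const_mul _).const_sub _
  have h2 : Filter.Tendsto (fun R : ℝ => max 0 (min 1 (1 - (r - a) * (R - a)⁻¹))) Filter.atTop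
      (nhds (max 0 (min 1 (1 - (r - a) * 0)))) :=
    tendsto_const_nhds.max (tendsto_const_nhds.min h1)
  simp only [mul_zero, sub_zero, min_self, max_eq_right zero_le_one] at h2
  refine h2.congr' ?_
  filter_upwards [Filter.eventually_gt_atTop a] with R hR
  have : R - a ≠ 0 := by linarith
  rw [cutoff]
  congr 2
  field_simp
  ring

theorem aestronglyMeasurable_schrodingerSub (hVm : AEMeasurable V) (z : ℂ) {f : L2 (k + 3)}
    (hf : MemH2 f) : AEStronglyMeasurable (schrodingerSub h V z hf) := by
  have h1 := Lp.aestronglyMeasurable (laplacianH2 hf)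
  have h2 := Lp.aestronglyMeasurable f
  have h3 : AEStronglyMeasurable (fun x => (V x : ℂ)) :=
    (Complex.measurable_ofReal.comp_aemeasurable hVm).aestronglyMeasurable
  exact ((h1.const_mul _).add (h3.mul h2)).sub (h2.const_mul _)

/-- The Carleman estimate in `H²`, obtained by removing the cutoff. -/
theorem Admissible.estimate (H : Admissible δ s E cV τ a h e)
    (hVm : AEMeasurable V) (hV : ∀ x, |V x| ≤ cV * (‖x‖ + 1) ^ (-δ)) {f : L2 (k + 3)}
    (hf : MemH2 f) (hg : Integrable fun x => (‖x‖ + 1) ^ (2 * s) *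
      ‖schrodingerSub h V (E + Complex.I * e) hf x‖ ^ 2) :
    E / 4 * ∫ x, weightSq τ a h ‖x‖ * (‖x‖ + 1) ^ (-(2 * s)) * ‖f x‖ ^ 2 ≤
      sourceConst s E * (a ^ 4 / h ^ 2) * (∫ x, weightSq τ a h ‖x‖ *
        (‖x‖ + 1) ^ (2 * s) * ‖schrodingerSub h V (E + Complex.I * e) hf x‖ ^ 2) +
      remainderConst s E cV * (|e| / h) * a ^ 2 * τ ^ 2 *
        (∫ x, weightSq τ a h ‖x‖ * ‖f x‖ ^ 2) := by
  have ha : 0 ≤ a := by linarith [H.a_ge]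
  have hτ : 0 ≤ τ := by linarith [H.τ_ge]
  have hM := H.multBound_ge
  have hE := H.E_pos
  have hh := H.h_pos
  have hcV := H.cV_nonneg
  have hS : 0 ≤ sourceConst s E * (a ^ 4 / h ^ 2) := by unfold sourceConst; positivity
  have hRc : 0 ≤ remainderConst s E cV * (|e| / h) * a ^ 2 * τ ^ 2 := by
    unfold remainderConst; positivity
  set z : ℂ := E + Complex.I * e
  set g := schrodingerSub h V z hf
  have hψ : ∀ x : Space (k + 3), 0 ≤ weightSq τ a h ‖x‖ := fun x => (Real.exp_pos _).le
  have hψm : AEStronglyMeasurable fun x : Space (k + 3) => weightSq τ a h ‖x‖ :=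
    ((continuous_weightSq ha).comp continuous_norm).aestronglyMeasurable
  have hψb : ∀ x : Space (k + 3), ‖weightSq τ a h ‖x‖‖ ≤ Real.exp (2 * (τ * a) / h) := fun x => by
    rw [Real.norm_of_nonneg (hψ x)]
    exact weightSq_le ha hτ hh (norm_nonneg x)
  have hf2 : Integrable fun x => ‖f x‖ ^ 2 := (Lp.memLp f).integrable_norm_pow (by norm_num)
  have hpm : ∀ p : ℝ, Continuous fun x : Space (k + 3) => (‖x‖ + 1) ^ p := fun p =>
    (continuous_norm.add continuous_const).rpow_const fun x =>
      Or.inl (show ‖x‖ + 1 ≠ 0 by positivity)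
  have hpf : Integrable fun x => (‖x‖ + 1) ^ (-(2 * s)) * ‖f x‖ ^ 2 := by
    refine hf2.bdd_mul (c := 1) (hpm _).aestronglyMeasurable
      (Filter.Eventually.of_forall fun x => ?_)
    rw [Real.norm_of_nonneg (by positivity)]
    exact Real.rpow_le_one_of_one_le_of_nonpos (by linarith [norm_nonneg x])
      (by linarith [H.s_gt])
  have I1 : Integrable fun x => weightSq τ a h ‖x‖ * (‖x‖ + 1) ^ (-(2 * s)) * ‖f x‖ ^ 2 := by
    simpa only [mul_assoc] using hpf.bdd_mul hψm (Filter.Eventually.of_forall hψb)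
  have I2 : Integrable fun x => weightSq τ a h ‖x‖ * (‖x‖ + 1) ^ (2 * s) * ‖g x‖ ^ 2 := by
    simpa only [mul_assoc] using hg.bdd_mul hψm (Filter.Eventually.of_forall hψb)
  have I3 : Integrable fun x => weightSq τ a h ‖x‖ * ‖f x‖ ^ 2 :=
    hf2.bdd_mul hψm (Filter.Eventually.of_forall hψb)
  have hle : ∀ (R p : ℝ) (u : Space (k + 3) → ℂ), Integrable (fun x => weightSq τ a h ‖x‖ *
      (‖x‖ + 1) ^ p * ‖u x‖ ^ 2) → cutoffNormSq τ a h R p u ≤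
      ∫ x, weightSq τ a h ‖x‖ * (‖x‖ + 1) ^ p * ‖u x‖ ^ 2 := fun R p u hu => by
    refine integral_mono_of_nonneg (Filter.Eventually.of_forall fun x => ?_) hu
      (Filter.Eventually.of_forall fun x => ?_)
    · have := (cutoff_mem_Icc a R ‖x‖).1
      have := hψ x
      simp only [Pi.zero_apply]
      positivity
    · have h1 := (cutoff_mem_Icc a R ‖x‖).2
      have h2 : 0 ≤ weightSq τ a h ‖x‖ * (‖x‖ + 1) ^ p * ‖u x‖ ^ 2 := by
        have := hψ x
        positivity
      simp only [mul_assoc] at h2 ⊢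
      exact mul_le_of_le_one_left h2 h1
  have hlim1 : Filter.Tendsto (fun R => E / 4 * cutoffNormSq τ a h R (-(2 * s)) f) Filter.atTop
      (nhds (E / 4 * ∫ x, weightSq τ a h ‖x‖ * (‖x‖ + 1) ^ (-(2 * s)) * ‖f x‖ ^ 2)) := by
    refine Filter.Tendsto.const_mul _ ?_
    refine tendsto_integral_filter_of_dominated_convergence
      (fun x => weightSq τ a h ‖x‖ * (‖x‖ + 1) ^ (-(2 * s)) * ‖f x‖ ^ 2)
      (Filter.Eventually.of_forall fun R => ?_)
      (Filter.Eventually.of_forall fun R => Filter.Eventually.of_forall fun x => ?_) I1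
      (Filter.Eventually.of_forall fun x => ?_)
    · have := (((continuous_cutoff a R).comp continuous_norm).aestronglyMeasurable
        (μ := (volume : Measure (Space (k + 3))))).mul I1.aestronglyMeasurable
      refine this.congr (Filter.Eventually.of_forall fun x => ?_)
      simp only [Pi.mul_apply, Function.comp_apply, mul_assoc]
    · have h1 := cutoff_mem_Icc a R ‖x‖
      have h2 : 0 ≤ weightSq τ a h ‖x‖ * (‖x‖ + 1) ^ (-(2 * s)) * ‖f x‖ ^ 2 := by
        have := hψ x
        positivity
      simp only [mul_assoc] at h2 ⊢
      rw [Real.norm_of_nonneg (mul_nonneg h1.1 h2)]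
      exact mul_le_of_le_one_left h2 h1.2
    · have := (tendsto_cutoff a ‖x‖).mul_const
        (weightSq τ a h ‖x‖ * (‖x‖ + 1) ^ (-(2 * s)) * ‖f x‖ ^ 2)
      simpa only [mul_assoc, one_mul] using this
  set K := cutoffConst k s E a * Real.exp (2 * (τ * a) / h) *
    ((3 * ‖f‖ ^ 2 + ‖laplacianH2 hf‖ ^ 2) / 2) with hK
  have hlim2 : Filter.Tendsto (fun R => (sourceConst s E * (a ^ 4 / h ^ 2) * (∫ x,
      weightSq τ a h ‖x‖ * (‖x‖ + 1) ^ (2 * s) * ‖g x‖ ^ 2) +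
      remainderConst s E cV * (|e| / h) * a ^ 2 * τ ^ 2 *
        (∫ x, weightSq τ a h ‖x‖ * ‖f x‖ ^ 2)) + (R - a)⁻¹ * K) Filter.atTop
      (nhds ((sourceConst s E * (a ^ 4 / h ^ 2) * (∫ x,
      weightSq τ a h ‖x‖ * (‖x‖ + 1) ^ (2 * s) * ‖g x‖ ^ 2) +
      remainderConst s E cV * (|e| / h) * a ^ 2 * τ ^ 2 *
        (∫ x, weightSq τ a h ‖x‖ * ‖f x‖ ^ 2)) + 0 * K)) :=
    ((tendsto_inv_atTop_zero.comp (Filter.tendsto_atTop_add_const_right _ (-a)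
      Filter.tendsto_id)).mul_const K).const_add _
  rw [zero_mul, add_zero] at hlim2
  refine le_of_tendsto_of_tendsto hlim1 hlim2 ?_
  filter_upwards [Filter.eventually_gt_atTop a] with R hR
  refine (H.cutoff_estimate hR hVm hV hf).trans ?_
  have h1 := hle R (2 * s) g I2
  have h2 := hle R 0 f (by simpa only [Real.rpow_zero, mul_one] using I3)
  simp only [Real.rpow_zero, mul_one] at h2
  rw [mul_assoc ((R - a)⁻¹), hK]
  gcongr

/-- The Carleman estimate in `H²` for a potential which satisfies its bound almost everywhere. -/
theorem Admissible.estimate_of_ae (H : Admissible δ s E cV τ a h e)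
    (hVm : AEMeasurable V) (hV : ∀ᵐ x, |V x| ≤ cV * (‖x‖ + 1) ^ (-δ)) {f : L2 (k + 3)}
    (hf : MemH2 f) (hg : Integrable fun x => (‖x‖ + 1) ^ (2 * s) *
      ‖schrodingerSub h V (E + Complex.I * e) hf x‖ ^ 2) :
    E / 4 * ∫ x, weightSq τ a h ‖x‖ * (‖x‖ + 1) ^ (-(2 * s)) * ‖f x‖ ^ 2 ≤
      sourceConst s E * (a ^ 4 / h ^ 2) * (∫ x, weightSq τ a h ‖x‖ *
        (‖x‖ + 1) ^ (2 * s) * ‖schrodingerSub h V (E + Complex.I * e) hf x‖ ^ 2) +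
      remainderConst s E cV * (|e| / h) * a ^ 2 * τ ^ 2 *
        (∫ x, weightSq τ a h ‖x‖ * ‖f x‖ ^ 2) := by
  classical
  set V' : Space (k + 3) → ℝ := fun x => if |V x| ≤ cV * (‖x‖ + 1) ^ (-δ) then V x else 0
    with hV'
  have hVV' : V =ᵐ[volume] V' := by
    filter_upwards [hV] with x hx
    rw [hV']
    exact (if_pos hx).symm
  have hb : ∀ x, |V' x| ≤ cV * (‖x‖ + 1) ^ (-δ) := fun x => by
    have := H.cV_nonneg
    by_cases hx : |V x| ≤ cV * (‖x‖ + 1) ^ (-δ)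
    · simpa only [hV', if_pos hx] using hx
    · simp only [hV', if_neg hx, abs_zero]
      positivity
  have hGG' : schrodingerSub h V (E + Complex.I * e) hf =ᵐ[volume]
      schrodingerSub h V' (E + Complex.I * e) hf := by
    filter_upwards [hVV'] with x hx
    rw [schrodingerSub, schrodingerSub, hx]
  have key := H.estimate (hVm.congr hVV') hb hf (hg.congr (by
    filter_upwards [hGG'] with x hx
    rw [hx]))
  refine key.trans_eq ?_
  congr 2
  refine integral_congr_ae ?_
  filter_upwards [hGG'] with x hx
  rw [hx]

end Carleman

/-! ### Choice of the parameters and the weights -/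

namespace Carleman

variable {n : ℕ}

theorem continuous_bracket : Continuous (bracket : Space n → ℝ) := by
  unfold bracket; fun_prop

theorem one_le_bracket (x : Space n) : 1 ≤ bracket x := by
  rw [bracket, Real.one_le_sqrt]
  nlinarith [sq_nonneg ‖x‖]

theorem le_sqrt_two_mul_bracket (x : Space n) : ‖x‖ + 1 ≤ √2 * bracket x := by
  rw [bracket, ← Real.sqrt_mul (by norm_num)]
  apply Real.le_sqrt_of_sq_le
  nlinarith [sq_nonneg (‖x‖ - 1)]

theorem bracket_rpow_neg_le {p : ℝ} (hp : 0 ≤ p) (x : Space n) :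
    bracket x ^ (-p) ≤ √2 ^ p * (‖x‖ + 1) ^ (-p) := by
  have hb : 0 < bracket x := zero_lt_one.trans_le (one_le_bracket x)
  have hr : 0 < ‖x‖ + 1 := by positivity
  have h1 := Real.rpow_le_rpow hr.le (le_sqrt_two_mul_bracket x) hp
  rw [Real.mul_rpow (by positivity) hb.le] at h1
  rw [Real.rpow_neg hb.le, Real.rpow_neg hr.le, ← div_eq_mul_inv, inv_eq_one_div,
    div_le_div_iff₀ (by positivity) (by positivity), one_mul]
  exact h1

theorem norm_add_one_rpow_le {p : ℝ} (hp : 0 ≤ p) (x : Space n) :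
    (‖x‖ + 1) ^ p ≤ √2 ^ p * bracket x ^ p := by
  rw [← Real.mul_rpow (by positivity) (zero_le_one.trans (one_le_bracket x))]
  exact Real.rpow_le_rpow (by positivity) (le_sqrt_two_mul_bracket x) hp

variable {δ s E cV τ a h e : ℝ}

theorem expWeight_eq (τ a h : ℝ) (x : Space n) :
    expWeight τ a h x = Real.exp (phaseExt τ a ‖x‖ / h) := by
  rw [expWeight, phaseExt_eq_phase (norm_nonneg x)]

theorem expWeight_sq (τ a h : ℝ) (x : Space n) : expWeight τ a h x ^ 2 = weightSq τ a h ‖x‖ := by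
  rw [expWeight_eq, weightSq, ← Real.exp_nat_mul]
  congr 1
  push_cast
  ring

theorem continuous_expWeight (ha : 0 ≤ a) (τ h : ℝ) :
    Continuous (expWeight τ a h : Space n → ℝ) := by
  rw [funext (expWeight_eq τ a h)]
  exact (((continuous_phaseExt ha).comp continuous_norm).div_const h).rexp

theorem expWeight_le (ha : 0 ≤ a) (hτ : 0 ≤ τ) (hh : 0 < h) (x : Space n) :
    expWeight τ a h x ≤ Real.exp (τ * a / h) := by
  rw [expWeight_eq]
  gcongr
  exact phaseExt_le ha hτ (norm_nonneg x)

theorem eLpNorm_two_eq_ofReal_sqrt {u : Space n → ℂ} (hu : MemLp u 2) :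
    eLpNorm u 2 volume = ENNReal.ofReal √(∫ x, ‖u x‖ ^ 2) := by
  rw [integral_norm_sq_toLp hu, Real.sqrt_sq (norm_nonneg _), Lp.norm_toLp,
    ENNReal.ofReal_toReal hu.eLpNorm_ne_top]

theorem memLp_mul_of_bounded {q : Space n → ℝ} {u : Space n → ℂ} (hu : MemLp u 2)
    (hq : Continuous q) {C : ℝ} (hC : ∀ x, |q x| ≤ C) :
    MemLp (fun x => (q x : ℂ) * u x) 2 := by
  refine hu.of_le_mul (c := C) ((Complex.continuous_ofReal.comp hq).aestronglyMeasurable.mul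
    hu.aestronglyMeasurable) (Filter.Eventually.of_forall fun x => ?_)
  rw [norm_mul, Complex.norm_real]
  exact mul_le_mul_of_nonneg_right (hC x) (norm_nonneg _)

/-- A monomial with a positive exponent is small near the origin. -/
theorem eventually_mul_rpow_le {p : ℝ} (hp : 0 < p) (c : ℝ) (hE : 0 < E) :
    ∀ᶠ h : ℝ in nhds 0, c * h ^ p ≤ E := by
  have h1 : Filter.Tendsto (fun h : ℝ => c * h ^ p) (nhds 0) (nhds (c * 0 ^ p)) :=
    ((Real.continuous_rpow_const hp.le).const_mul c).tendsto 0
  rw [Real.zero_rpow hp.ne', mul_zero] at h1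
  exact (h1.eventually_lt_const hE).mono fun h hh => hh.le

/-- The parameters `a = h^{-m}`, `τ = τ₀ h^{-1/3}` are admissible for small `h`. The lower bound for
`m` gives `a h ≥ 1` and `a^{4 + 4s - 2δ} ≤ h⁴`; the lower bound for `τ₀` gives `2 cV² ≤ h τ³ = τ₀³`;
all other conditions hold as soon as a power of `h` is small. -/
theorem exists_admissible (hδ : 3 < δ) (hs : 1 / 2 < s) (hs' : s < (δ - 2) / 2) (hE : 0 < E)
    (hcV : 0 ≤ cV) {m τ₀ : ℝ} (hm : 1 + 2 / (δ - 2 - 2 * s) ≤ m) (hτ₀ : 1 ≤ τ₀)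
    (hτcV : 2 * cV ^ 2 ≤ τ₀) :
    ∃ h₀ : ℝ, 0 < h₀ ∧ ∀ h : ℝ, 0 < h → h ≤ h₀ → ∀ e : ℝ, |e| ≤ h / aParam m h ^ 2 →
      Admissible δ s E cV (tauParam τ₀ h) (aParam m h) h e := by
  have hγ : 0 < δ - 2 - 2 * s := by linarith
  have hm1 : 1 ≤ m := by
    have : 0 < 2 / (δ - 2 - 2 * s) := by positivity
    linarith
  have hmγ : 2 ≤ m * (δ - 2 - 2 * s) := by
    have h1 : 2 / (δ - 2 - 2 * s) ≤ m := by linarith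
    rwa [div_le_iff₀ hγ] at h1
  have hev : ∀ᶠ h : ℝ in nhds 0, h < 1 ∧ 2 * τ₀ * h ^ (2 / 3 : ℝ) ≤ E ∧
      8 * τ₀ ^ 2 * h ^ (1 / 3 : ℝ) ≤ E ∧ 64 * cV ^ 2 * h ^ (2 : ℝ) ≤ E ∧
      4 * multBound s ^ 2 * cV ^ 2 * h ^ (2 : ℝ) ≤ E :=
    (eventually_lt_nhds zero_lt_one).and <|
      (eventually_mul_rpow_le (by norm_num) _ hE).and <|
      (eventually_mul_rpow_le (by norm_num) _ hE).and <|
      (eventually_mul_rpow_le (by norm_num) _ hE).and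
        (eventually_mul_rpow_le (by norm_num) _ hE)
  obtain ⟨h₀, hh₀, hball⟩ := Metric.eventually_nhds_iff.mp hev
  refine ⟨h₀ / 2, by positivity, fun h hh hle e he => ?_⟩
  obtain ⟨h1, c1, c2, c3, c4⟩ := hball (y := h) (by
    rw [Real.dist_eq, sub_zero, abs_of_pos hh]; linarith)
  have hap : ∀ p : ℝ, aParam m h ^ p = h ^ (-(m * p)) := fun p => by
    rw [aParam, ← Real.rpow_mul hh.le, neg_mul]
  have hainv : h ^ (-1 : ℝ) ≤ aParam m h :=
    Real.rpow_le_rpow_of_exponent_ge hh h1.le (by linarith)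
  have ha1 : 1 ≤ aParam m h := Real.one_le_rpow_of_pos_of_le_one_of_nonpos hh h1.le (by linarith)
  have hha : 1 ≤ h * aParam m h := by
    rw [Real.rpow_neg_one] at hainv
    rwa [inv_le_iff_one_le_mul₀' hh] at hainv
  have ht1 : 1 ≤ h ^ (-(1 / 3 : ℝ)) :=
    Real.one_le_rpow_of_pos_of_le_one_of_nonpos hh h1.le (by norm_num)
  have ht3 : (h ^ (-(1 / 3 : ℝ))) ^ 3 * h = 1 := by
    rw [← Real.rpow_mul_natCast hh.le, Nat.cast_ofNat,
      show -(1 / 3 : ℝ) * 3 = -1 by norm_num, Real.rpow_neg_one, inv_mul_cancel₀ hh.ne']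
  have h2 : h ^ (2 : ℝ) = h ^ 2 := Real.rpow_two h
  rw [h2] at c3 c4
  refine ⟨hs, hδ.le, by linarith, hE, hcV, ?_, ha1, hh, h1.le, ?_, ?_, ?_, ?_, ?_, he⟩
  · exact hτ₀.trans (le_mul_of_one_le_right (by linarith) ht1)
  · calc 2 * cV ^ 2 ≤ τ₀ := hτcV
      _ ≤ τ₀ ^ 3 := le_self_pow₀ hτ₀ (by norm_num)
      _ = τ₀ ^ 3 * ((h ^ (-(1 / 3 : ℝ))) ^ 3 * h) := by rw [ht3, mul_one]
      _ = h * tauParam τ₀ h ^ 3 := by rw [tauParam]; ring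
  · have h3 : h ^ (-(1 / 3 : ℝ)) * h = h ^ (2 / 3 : ℝ) := by
      conv_lhs => rw [← Real.rpow_one h, ← Real.rpow_mul hh.le, one_mul,
        ← Real.rpow_add hh]
      norm_num
    rw [tauParam]
    calc _ = 2 * τ₀ * (h ^ (-(1 / 3 : ℝ)) * h) := by ring
      _ ≤ E := by rwa [h3]
  · have h3 : (h ^ (-(1 / 3 : ℝ))) ^ 2 * h = h ^ (1 / 3 : ℝ) := by
      rw [← Real.rpow_mul_natCast hh.le]
      conv_lhs => rw [← Real.rpow_one h, ← Real.rpow_mul hh.le, one_mul,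
        ← Real.rpow_add hh]
      norm_num
    rw [tauParam]
    calc 8 * (τ₀ * h ^ (-(1 / 3 : ℝ))) ^ 2 ≤
        8 * (τ₀ * h ^ (-(1 / 3 : ℝ))) ^ 2 * (h * aParam m h) :=
          le_mul_of_one_le_right (by positivity) hha
      _ = 8 * τ₀ ^ 2 * ((h ^ (-(1 / 3 : ℝ))) ^ 2 * h) * aParam m h := by ring
      _ ≤ E * aParam m h := by
        rw [h3]
        exact mul_le_mul_of_nonneg_right c2 (by linarith)
  · calc 64 * cV ^ 2 ≤ 64 * cV ^ 2 * (h * aParam m h) ^ 4 :=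
          le_mul_of_one_le_right (by positivity) (one_le_pow₀ hha)
      _ = 64 * cV ^ 2 * h ^ 2 * (h ^ 2 * aParam m h ^ 4) := by ring
      _ ≤ E * (h ^ 2 * aParam m h ^ 4) :=
          mul_le_mul_of_nonneg_right c3 (by positivity)
      _ = _ := by ring
  · -- the exponent of `h` on the left is `2 m (δ - 2 - 2 s) ≥ 4`
    have h3 : aParam m h ^ 4 * aParam m h ^ (4 * s - 2 * δ) ≤ h ^ 4 := by
      rw [← Real.rpow_natCast, ← Real.rpow_add (by linarith), hap, ← Real.rpow_natCast h 4]
      refine Real.rpow_le_rpow_of_exponent_ge hh h1.le ?_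
      push_cast
      nlinarith
    have hM : multBound s = 3 + 1 / (2 * s - 1) := rfl
    rw [← hM]
    calc _ = 4 * multBound s ^ 2 * cV ^ 2 * (aParam m h ^ 4 * aParam m h ^ (4 * s - 2 * δ)) := by
          ring
      _ ≤ 4 * multBound s ^ 2 * cV ^ 2 * h ^ 4 := by gcongr
      _ = 4 * multBound s ^ 2 * cV ^ 2 * h ^ 2 * h ^ 2 := by ring
      _ ≤ E * h ^ 2 := by gcongr

/-- The constant in the Carleman estimate. -/
noncomputable def carlemanConst (s E cV : ℝ) : ℝ :=
  √(4 / E * √2 ^ (2 * s) * (sourceConst s E * √2 ^ (2 * s) + remainderConst s E cV))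

theorem carlemanConst_pos (hs : 1 / 2 < s) (hE : 0 < E) (hcV : 0 ≤ cV) :
    0 < carlemanConst s E cV := by
  have h1 : 0 < 1 / (2 * s - 1) := one_div_pos.mpr (by linarith)
  have hM : 0 < multBound s := by unfold multBound; linarith
  have hS : 0 < sourceConst s E := by unfold sourceConst; positivity
  have hR : 0 ≤ remainderConst s E cV := by unfold remainderConst; positivity
  unfold carlemanConst
  positivity

variable {k : ℕ} {V : Space (k + 3) → ℝ}

/-- The Carleman estimate with the weights `⟨x⟩^{± s}`, in terms of norms. -/
theorem Admissible.eLpNorm_le (H : Admissible δ s E cV τ a h e)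
    (hVm : AEMeasurable V) (hV : ∀ᵐ x, |V x| ≤ cV * (‖x‖ + 1) ^ (-δ)) {f : L2 (k + 3)}
    (hf : MemH2 f) (hg : MemLp (fun x => ((bracket x ^ s : ℝ) : ℂ) *
      schrodingerSub h V (E + Complex.I * e) hf x) 2 volume) :
    eLpNorm (fun x => ((bracket x ^ (-s) * expWeight τ a h x : ℝ) : ℂ) * f x) 2 volume ≤
      ENNReal.ofReal (carlemanConst s E cV * a ^ 2 * h⁻¹) *
        eLpNorm (fun x => ((bracket x ^ s * expWeight τ a h x : ℝ) : ℂ) *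
          schrodingerSub h V (E + Complex.I * e) hf x) 2 volume +
      ENNReal.ofReal (carlemanConst s E cV * a * τ * √(|e| / h)) *
        eLpNorm (fun x => ((expWeight τ a h x : ℝ) : ℂ) * f x) 2 volume := by
  have ha : 0 ≤ a := by linarith [H.a_ge]
  have hτ : 0 ≤ τ := by linarith [H.τ_ge]
  have hs : 0 ≤ s := by linarith [H.s_gt]
  have hM := H.multBound_ge
  have hE := H.E_pos
  have hh := H.h_pos
  have hcV := H.cV_nonneg
  have hS : 0 ≤ sourceConst s E := by unfold sourceConst; positivity
  have hRc : 0 ≤ remainderConst s E cV := by unfold remainderConst; positivity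
  set g := schrodingerSub h V (E + Complex.I * e) hf
  have hb1 : ∀ x : Space (k + 3), 1 ≤ bracket x := one_le_bracket
  have hb0 : ∀ x : Space (k + 3), 0 ≤ bracket x := fun x => zero_le_one.trans (hb1 x)
  have hbc : ∀ p : ℝ, Continuous fun x : Space (k + 3) => bracket x ^ p := fun p =>
    continuous_bracket.rpow_const fun x => Or.inl (zero_lt_one.trans_le (hb1 x)).ne'
  have hw0 : ∀ x : Space (k + 3), 0 ≤ expWeight τ a h x := fun x => (Real.exp_pos _).le
  have hwc := continuous_expWeight (n := k + 3) ha τ h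
  have hwb : ∀ x : Space (k + 3), |expWeight τ a h x| ≤ Real.exp (τ * a / h) := fun x => by
    rw [abs_of_nonneg (hw0 x)]
    exact expWeight_le ha hτ hh x
  have m3 := memLp_mul_of_bounded (Lp.memLp f) hwc hwb
  have m1 : MemLp (fun x => ((bracket x ^ (-s) * expWeight τ a h x : ℝ) : ℂ) * f x) 2 := by
    refine memLp_mul_of_bounded (Lp.memLp f) ((hbc _).mul hwc)
      (C := Real.exp (τ * a / h)) fun x => ?_
    rw [abs_mul, abs_of_nonneg (Real.rpow_nonneg (hb0 x) _)]
    exact (mul_le_of_le_one_left (abs_nonneg _)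
      (Real.rpow_le_one_of_one_le_of_nonpos (hb1 x) (by linarith))).trans (hwb x)
  have m2 : MemLp (fun x => ((bracket x ^ s * expWeight τ a h x : ℝ) : ℂ) * g x) 2 := by
    refine (memLp_congr_ae (Filter.Eventually.of_forall fun x => ?_)).mp
      (memLp_mul_of_bounded hg hwc hwb)
    push_cast
    ring
  have hsq : ∀ (p : ℝ) (x : Space (k + 3)), (bracket x ^ p) ^ 2 = bracket x ^ (2 * p) :=
      fun p x => by
    rw [← Real.rpow_mul_natCast (hb0 x), Nat.cast_ofNat, mul_comm]
  have n1 : ∀ x, ‖((bracket x ^ (-s) * expWeight τ a h x : ℝ) : ℂ) * f x‖ ^ 2 =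
      bracket x ^ (-(2 * s)) * (weightSq τ a h ‖x‖ * ‖f x‖ ^ 2) := fun x => by
    rw [norm_mul, mul_pow, Complex.norm_real, Real.norm_eq_abs, sq_abs, mul_pow, hsq,
      expWeight_sq, mul_neg, mul_assoc]
  have n2 : ∀ x, ‖((bracket x ^ s * expWeight τ a h x : ℝ) : ℂ) * g x‖ ^ 2 =
      bracket x ^ (2 * s) * (weightSq τ a h ‖x‖ * ‖g x‖ ^ 2) := fun x => by
    rw [norm_mul, mul_pow, Complex.norm_real, Real.norm_eq_abs, sq_abs, mul_pow, hsq,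
      expWeight_sq, mul_assoc]
  have n3 : ∀ x, ‖((expWeight τ a h x : ℝ) : ℂ) * f x‖ ^ 2 =
      weightSq τ a h ‖x‖ * ‖f x‖ ^ 2 := fun x => by
    rw [norm_mul, mul_pow, Complex.norm_real, Real.norm_eq_abs, sq_abs, expWeight_sq]
  have hψ : ∀ x : Space (k + 3), 0 ≤ weightSq τ a h ‖x‖ := fun x => (Real.exp_pos _).le
  have hpm : ∀ p : ℝ, Continuous fun x : Space (k + 3) => (‖x‖ + 1) ^ p := fun p =>
    (continuous_norm.add continuous_const).rpow_const fun x =>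
      Or.inl (show ‖x‖ + 1 ≠ 0 by positivity)
  set c : ℝ := √2 ^ (2 * s) with hc
  have hc0 : 0 < c := by positivity
  have i1 := m1.integrable_norm_pow (p := 2) (by norm_num)
  have i2 := m2.integrable_norm_pow (p := 2) (by norm_num)
  have i3 := m3.integrable_norm_pow (p := 2) (by norm_num)
  simp only [n1] at i1
  simp only [n2] at i2
  simp only [n3] at i3
  have hle : ∀ x : Space (k + 3), (‖x‖ + 1) ^ (2 * s) ≤ c * bracket x ^ (2 * s) :=
    norm_add_one_rpow_le (by positivity)
  have hgi : Integrable fun x => (‖x‖ + 1) ^ (2 * s) * ‖g x‖ ^ 2 := by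
    refine ((hg.integrable_norm_pow (p := 2) (by norm_num)).const_mul c).mono'
      ((hpm _).aestronglyMeasurable.mul
        ((aestronglyMeasurable_schrodingerSub hVm _ hf).norm.pow 2))
      (Filter.Eventually.of_forall fun x => ?_)
    rw [Real.norm_of_nonneg (by positivity), norm_mul, Complex.norm_real, mul_pow,
      Real.norm_eq_abs, sq_abs, hsq, ← mul_assoc]
    exact mul_le_mul_of_nonneg_right (hle x) (by positivity)
  have key := H.estimate_of_ae hVm hV hf hgi
  have j1 : Integrable fun x => weightSq τ a h ‖x‖ * (‖x‖ + 1) ^ (-(2 * s)) * ‖f x‖ ^ 2 := by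
    refine (i3.bdd_mul (c := 1) (hpm (-(2 * s))).aestronglyMeasurable
      (Filter.Eventually.of_forall fun x => ?_)).congr
      (Filter.Eventually.of_forall fun x => ?_)
    · rw [Real.norm_of_nonneg (by positivity)]
      exact Real.rpow_le_one_of_one_le_of_nonpos (by linarith [norm_nonneg x]) (by linarith)
    · simp only
      ring
  have k1 : ∫ x, ‖((bracket x ^ (-s) * expWeight τ a h x : ℝ) : ℂ) * f x‖ ^ 2 ≤
      c * ∫ x, weightSq τ a h ‖x‖ * (‖x‖ + 1) ^ (-(2 * s)) * ‖f x‖ ^ 2 := by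
    simp only [n1]
    rw [← integral_const_mul]
    refine integral_mono i1 (j1.const_mul c) fun x => ?_
    have := mul_le_mul_of_nonneg_right (bracket_rpow_neg_le (p := 2 * s) (by positivity) x)
      (mul_nonneg (hψ x) (sq_nonneg ‖f x‖))
    refine this.trans_eq ?_
    ring
  have k2 : ∫ x, weightSq τ a h ‖x‖ * (‖x‖ + 1) ^ (2 * s) * ‖g x‖ ^ 2 ≤
      c * ∫ x, ‖((bracket x ^ s * expWeight τ a h x : ℝ) : ℂ) * g x‖ ^ 2 := by
    simp only [n2]
    rw [← integral_const_mul]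
    refine integral_mono_of_nonneg (Filter.Eventually.of_forall fun x => ?_) (i2.const_mul c)
      (Filter.Eventually.of_forall fun x => ?_)
    · have := hψ x
      simp only [Pi.zero_apply]
      positivity
    · have := mul_le_mul_of_nonneg_right (hle x) (mul_nonneg (hψ x) (sq_nonneg ‖g x‖))
      simp only
      linarith
  simp only [← n3] at key
  rw [eLpNorm_two_eq_ofReal_sqrt m1, eLpNorm_two_eq_ofReal_sqrt m2,
    eLpNorm_two_eq_ofReal_sqrt m3]
  set X := ∫ x, ‖((bracket x ^ (-s) * expWeight τ a h x : ℝ) : ℂ) * f x‖ ^ 2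
  set Y := ∫ x, ‖((bracket x ^ s * expWeight τ a h x : ℝ) : ℂ) * g x‖ ^ 2
  set Z := ∫ x, ‖((expWeight τ a h x : ℝ) : ℂ) * f x‖ ^ 2
  have hY : 0 ≤ Y := integral_nonneg fun x => by positivity
  have hZ : 0 ≤ Z := integral_nonneg fun x => by positivity
  set C := carlemanConst s E cV with hC
  have hC0 : 0 ≤ C := Real.sqrt_nonneg _
  have hCsq : C ^ 2 = 4 / E * c * (sourceConst s E * c + remainderConst s E cV) :=
    Real.sq_sqrt (by positivity)
  rw [← ENNReal.ofReal_mul (by positivity), ← ENNReal.ofReal_mul (by positivity),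
    ← ENNReal.ofReal_add (by positivity) (by positivity)]
  refine ENNReal.ofReal_le_ofReal (Real.sqrt_le_iff.mpr ⟨by positivity, ?_⟩)
  have hA : 0 ≤ a ^ 4 / h ^ 2 * Y := by positivity
  have hB : 0 ≤ |e| / h * a ^ 2 * τ ^ 2 * Z := by positivity
  calc X ≤ 4 / E * c * (E / 4 * ∫ x, weightSq τ a h ‖x‖ * (‖x‖ + 1) ^ (-(2 * s)) * ‖f x‖ ^ 2) := by
        refine k1.trans_eq ?_
        field_simp
    _ ≤ 4 / E * c * (sourceConst s E * (a ^ 4 / h ^ 2) * (c * Y) +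
          remainderConst s E cV * (|e| / h) * a ^ 2 * τ ^ 2 * Z) := by
        refine mul_le_mul_of_nonneg_left (key.trans ?_) (by positivity)
        gcongr
    _ = 4 / E * c * (sourceConst s E * c) * (a ^ 4 / h ^ 2 * Y) +
          4 / E * c * remainderConst s E cV * (|e| / h * a ^ 2 * τ ^ 2 * Z) := by ring
    _ ≤ C ^ 2 * (a ^ 4 / h ^ 2 * Y) + C ^ 2 * (|e| / h * a ^ 2 * τ ^ 2 * Z) := by
        rw [hCsq]
        gcongr
        · exact le_add_of_nonneg_right hRc
        · exact le_add_of_nonneg_left (by positivity)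
    _ = (C * a ^ 2 * h⁻¹ * √Y) ^ 2 + (C * a * τ * √(|e| / h) * √Z) ^ 2 := by
        rw [mul_pow _ √Y, mul_pow _ √Z, mul_pow _ √(|e| / h), Real.sq_sqrt hY, Real.sq_sqrt hZ,
          Real.sq_sqrt (by positivity)]
        ring
    _ ≤ (C * a ^ 2 * h⁻¹ * √Y + C * a * τ * √(|e| / h) * √Z) ^ 2 := by
        have h1 : 0 ≤ C * a ^ 2 * h⁻¹ * √Y := by positivity
        have h2 : 0 ≤ C * a * τ * √(|e| / h) * √Z := by positivity
        nlinarith [mul_nonneg h1 h2]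

end Carleman

theorem theorem3p1 (δ s : ℝ) (hδ : 3 < δ) (hs : 1 / 2 < s) (hs' : s < (δ - 2) / 2) :
    ∃ m₀ : ℝ, 0 < m₀ ∧ ∀ m : ℝ, m₀ ≤ m →
      ∀ (n : ℕ), 3 ≤ n → ∀ E : ℝ, 0 < E →
      ∀ V : Carleman.Space n → ℝ, AEMeasurable V volume →
      (∃ CV : ℝ, 0 < CV ∧ ∀ᵐ x : Carleman.Space n, |V x| ≤ CV * Carleman.bracket x ^ (-δ)) →
      ∃ T : ℝ, 1 ≤ T ∧ ∀ τ₀ : ℝ, T ≤ τ₀ →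
      ∃ h₀ : ℝ, 0 < h₀ ∧ ∃ C : ℝ, 0 < C ∧
      ∀ h : ℝ, 0 < h → h ≤ h₀ →
      ∀ ε : ℝ, 0 < ε → ε ≤ h * (Carleman.aParam m h)⁻¹ ^ 2 →
      ∀ z : ℂ, z = (E : ℂ) - Complex.I * (ε : ℂ) ∨ z = (E : ℂ) + Complex.I * (ε : ℂ) →
      ∀ (f : Carleman.L2 n) (hf : Carleman.MemH2 f),
      MemLp (fun x => ((Carleman.bracket x ^ s : ℝ) : ℂ) *
        Carleman.schrodingerSub h V z hf x) 2 volume →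
      eLpNorm (fun x => ((Carleman.bracket x ^ (-s) *
          Carleman.expWeight (Carleman.tauParam τ₀ h) (Carleman.aParam m h) h x : ℝ) : ℂ) *
          f x) 2 volume
        ≤ ENNReal.ofReal (C * Carleman.aParam m h ^ 2 * h⁻¹) *
            eLpNorm (fun x => ((Carleman.bracket x ^ s *
              Carleman.expWeight (Carleman.tauParam τ₀ h) (Carleman.aParam m h) h x : ℝ) : ℂ) *
              Carleman.schrodingerSub h V z hf x) 2 volume
          + ENNReal.ofReal (C * Carleman.aParam m h * Carleman.tauParam τ₀ h *
              Real.sqrt (ε / h)) *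
            eLpNorm (fun x =>
              ((Carleman.expWeight (Carleman.tauParam τ₀ h) (Carleman.aParam m h) h x : ℝ) : ℂ) *
              f x) 2 volume := by
  have hγ : 0 < δ - 2 - 2 * s := by linarith
  refine ⟨1 + 2 / (δ - 2 - 2 * s), by positivity, ?_⟩
  intro m hm n hn E hE V hVm ⟨CV, hCV, hV⟩
  obtain ⟨k, rfl⟩ : ∃ k, n = k + 3 := ⟨n - 3, by omega⟩
  -- the bound on the potential in terms of the equivalent weight `|x| + 1`
  set cV := CV * √2 ^ δ with hcV
  have hcV0 : 0 ≤ cV := by positivity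
  have hV' : ∀ᵐ x, |V x| ≤ cV * (‖x‖ + 1) ^ (-δ) := by
    filter_upwards [hV] with x hx
    refine hx.trans ?_
    rw [hcV, mul_assoc]
    exact mul_le_mul_of_nonneg_left (Carleman.bracket_rpow_neg_le (by linarith) x) hCV.le
  refine ⟨max 1 (2 * cV ^ 2), le_max_left _ _, fun τ₀ hτ₀ => ?_⟩
  obtain ⟨h₀, hh₀, hadm⟩ := Carleman.exists_admissible hδ hs hs' hE hcV0 hm
    ((le_max_left _ _).trans hτ₀) ((le_max_right _ _).trans hτ₀)
  refine ⟨h₀, hh₀, Carleman.carlemanConst s E cV,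
    Carleman.carlemanConst_pos hs hE hcV0, fun h hh hle ε hε hεle z hz f hf hg => ?_⟩
  have hε' : ε ≤ h / Carleman.aParam m h ^ 2 := by rwa [div_eq_mul_inv, ← inv_pow]
  obtain ⟨e, he, rfl⟩ : ∃ e : ℝ, |e| = ε ∧ z = (E : ℂ) + Complex.I * e := by
    rcases hz with hz | hz
    · exact ⟨-ε, by rw [abs_neg, abs_of_pos hε], by rw [hz]; push_cast; ring⟩
    · exact ⟨ε, abs_of_pos hε, hz⟩
  rw [← he]
  exact (hadm h hh hle e (he.trans_le hε')).eLpNorm_le hVm hV' hf hg
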